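/- Let $2\le k\le n$ be integers and let $\Omega\subset\mathbb{R}^n$ be a bounded domain with $\partial\Omega\in C^{3,1}$ which is strictly $(k-1)$-convex, i.e. there is $\delta>0$ such that the principal curvatures $\kappa=(\kappa_1,\dots,\kappa_{n-1})$ of $\partial\Omega$ (with respect to the interior normal) satisfy $\sigma_j(\kappa)\ge\delta$ on $\partial\Omega$ for all $1\le j\le k-1$, where $\sigma_j$ is the $j$-th elementary symmetric polynomial. For a real symmetric matrix $A$ with eigenvalues $\lambda(A)$ put $\sigma_k[A]=\sigma_k(\lambda(A))$, and call $u\in C^2(\Omega)\cap C^0(\overline\Omega)$ $k$-admissible if $\sigma_j[D^2u(x)]>0$ for all $x\in\Omega$ and $1\le j\le k$. Let $\Omega_0$ be a domain with $\overline\Omega\subset\Omega_0$, let $\varphi\in C^{3,1}(\partial\Omega)$, and let $f$ satisfy $\inf_{\Omega_0}f>0$ and $f^{3/(2k-2)}\in C^{1,1}(\overline{\Omega_0})$, with finite $C^{1,1}$ norm. Let $u\in C^{3,1}(\overline\Omega)$ be a $k$-admissible solution of $$\sigma_k[D^2u]=f\ \text{ in }\Omega,\qquad u=\varphi\ \text{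 on }\partial\Omega .$$ Then $$\|u\|_{C^1(\overline\Omega)}+\sup_{\partial\Omega}\big(|u_{\nu\eta}|+|u_{\eta\eta}|\big)\le C,$$ where $\nu$ is the unit interior normal to $\partial\Omega$ and the supremum is taken over all points of $\partial\Omega$ and all unit tangential vectors $\eta$ there. The constant $C$ depends only on $n$, $k$, $\Omega$, an upper bound for $\|\varphi\|_{C^3(\partial\Omega)}$, a positive lower bound for $\operatorname{dist}(\Omega,\partial\Omega_0)$, and an upper bound for $\|f^{3/(2k-2)}\|_{C^{1,1}(\overline{\Omega_0})}$; in particular it is independent of $\inf_{\Omega_0}f$. -/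

import Mathlib

noncomputable section

open Set Filter Topology
open scoped ENNReal NNReal

namespace KHess

/-- Euclidean space `ℝⁿ`. -/
abbrev E (n : ℕ) : Type := EuclideanSpace ℝ (Fin n)

/-! ### The spaces `C^m(Ω̄)`, `C^{m,1}(Ω̄)` and their norms -/

/-- `u ∈ C^m(Ω̄)`: `u` is of class `C^m` in the open set `Ω` and all its derivatives of order at
most `m` extend continuously to `Ω̄` (the extension of `u` itself being `u`). -/
def MemC {n : ℕ} (m : ℕ) (Ω : Set (E n)) (u : E n → ℝ) : Prop :=
  ContDiffOn ℝ m u Ω ∧ ContinuousOn u (closure Ω) ∧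
    ∀ j ≤ m, ∃ F : E n → ContinuousMultilinearMap ℝ (fun _ : Fin j => E n) ℝ,
      ContinuousOn F (closure Ω) ∧ EqOn F (iteratedFDeriv ℝ j u) Ω

/-- `‖u‖_{C^m(Ω̄)} = ∑_{j ≤ m} sup_Ω |D^j u|`, with values in `[0, ∞]`. -/
def normC {n : ℕ} (m : ℕ) (Ω : Set (E n)) (u : E n → ℝ) : ℝ≥0∞ :=
  ∑ j ∈ Finset.range (m + 1), ⨆ x ∈ Ω, ‖iteratedFDeriv ℝ j u x‖ₑ

/-- The Lipschitz seminorm `sup_{x ≠ y ∈ Ω} |D^m u(x) - D^m u(y)| / |x - y|`, with values in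
`[0, ∞]` (the terms with `x = y` are `0`). -/
def lipSeminorm {n : ℕ} (m : ℕ) (Ω : Set (E n)) (u : E n → ℝ) : ℝ≥0∞ :=
  ⨆ x ∈ Ω, ⨆ y ∈ Ω, ‖iteratedFDeriv ℝ m u x - iteratedFDeriv ℝ m u y‖ₑ / edist x y

/-- `u ∈ C^{m,1}(Ω̄)`. -/
def MemCLip {n : ℕ} (m : ℕ) (Ω : Set (E n)) (u : E n → ℝ) : Prop :=
  MemC m Ω u ∧ lipSeminorm m Ω u < ⊤

/-- `‖u‖_{C^{m,1}(Ω̄)}`. -/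
def normCLip {n : ℕ} (m : ℕ) (Ω : Set (E n)) (u : E n → ℝ) : ℝ≥0∞ :=
  normC m Ω u + lipSeminorm m Ω u

/-- `φ ∈ C^{m,1}(∂Ω)`: `φ` is the restriction to `∂Ω` of a function in `C^{m,1}(Ω̄)`.
Only the values of `φ` on `∂Ω` matter. -/
def MemCLipBdry {n : ℕ} (m : ℕ) (Ω : Set (E n)) (φ : E n → ℝ) : Prop :=
  ∃ Φ : E n → ℝ, MemCLip m Ω Φ ∧ EqOn Φ φ (frontier Ω)

/-- `‖φ‖_{C^m(∂Ω)}`: the infimum of `‖Φ‖_{C^m(Ω̄)}` over all extensions `Φ ∈ C^m(Ω̄)` of `φ`. -/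
def normCBdry {n : ℕ} (m : ℕ) (Ω : Set (E n)) (φ : E n → ℝ) : ℝ≥0∞ :=
  ⨅ (Φ : E n → ℝ) (_ : MemC m Ω Φ ∧ EqOn Φ φ (frontier Ω)), normC m Ω Φ

/-- `D²u(x)(v, w)` at a point `x ∈ Ω̄`; at boundary points this is the limit of the second
derivative taken from inside the open set `Ω`. -/
def secondDeriv {n : ℕ} (Ω : Set (E n)) (u : E n → ℝ) (x v w : E n) : ℝ :=
  extendFrom Ω (iteratedFDeriv ℝ 2 u) x ![v, w]

/-! ### The `k`-Hessian operator and admissible functions -/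

/-- The Hessian matrix `D²u(x)`. -/
def hessian {n : ℕ} (u : E n → ℝ) (x : E n) : Matrix (Fin n) (Fin n) ℝ :=
  Matrix.of fun i j =>
    iteratedFDeriv ℝ 2 u x ![EuclideanSpace.single i 1, EuclideanSpace.single j 1]

/-- The eigenvalues `λ(A)` of a real symmetric matrix `A`, repeated according to multiplicity. -/
def eigenvalues {n : ℕ} (A : Matrix (Fin n) (Fin n) ℝ) : Multiset ℝ := A.charpoly.roots

/-- `σ_k[A]`, the `k`-th elementary symmetric polynomial of the eigenvalues of `A`. -/
def sigma {n : ℕ} (k : ℕ) (A : Matrix (Fin n) (Fin n) ℝ) : ℝ := (eigenvalues A).esymm k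

/-- The Gårding cone `Γ_k`, as a set of (unordered) tuples. -/
def gardingCone (k : ℕ) : Set (Multiset ℝ) := {l | ∀ j, 1 ≤ j → j ≤ k → 0 < l.esymm j}

/-- `u ∈ C²(Ω) ∩ C⁰(Ω̄)` is `k`-admissible. -/
def IsAdmissible {n : ℕ} (k : ℕ) (Ω : Set (E n)) (u : E n → ℝ) : Prop :=
  ContDiffOn ℝ 2 u Ω ∧ ContinuousOn u (closure Ω) ∧
    ∀ x ∈ Ω, eigenvalues (hessian u x) ∈ gardingCone k

/-- `u` solves `σ_k[D²u] = f` in `Ω`, `u = φ` on `∂Ω`. -/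
def SolvesDirichlet {n : ℕ} (k : ℕ) (Ω : Set (E n)) (f φ u : E n → ℝ) : Prop :=
  (∀ x ∈ Ω, sigma k (hessian u x) = f x) ∧ ∀ x ∈ frontier Ω, u x = φ x

/-! ### Domains, their boundaries and curvature -/

/-- A domain: a nonempty connected open set. -/
def IsDomainSet {n : ℕ} (Ω : Set (E n)) : Prop := IsOpen Ω ∧ IsConnected Ω

/-- `r` is a local defining function of class `C^{m,1}` for `Ω` on the neighbourhood `U` of the
boundary point `x₀`: in `U`, the set `Ω` is `{r > 0}`, its boundary is `{r = 0}`, and `∇r ≠ 0`. -/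
structure IsDefiningFn {n : ℕ} (m : ℕ) (Ω : Set (E n)) (x₀ : E n) (U : Set (E n))
    (r : E n → ℝ) : Prop where
  isOpen : IsOpen U
  mem : x₀ ∈ U
  contDiffOn : ContDiffOn ℝ m r U
  lip : lipSeminorm m U r < ⊤
  pos_iff : ∀ x ∈ U, x ∈ Ω ↔ 0 < r x
  zero_iff : ∀ x ∈ U, x ∈ frontier Ω ↔ r x = 0
  gradient_ne_zero : ∀ x ∈ U, gradient r x ≠ 0

/-- `∂Ω ∈ C^{m,1}`. -/
def HasCLipBoundary {n : ℕ} (m : ℕ) (Ω : Set (E n)) : Prop :=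
  ∀ x₀ ∈ frontier Ω, ∃ (U : Set (E n)) (r : E n → ℝ), IsDefiningFn m Ω x₀ U r

/-- `ν` is the unit interior normal of the `C^{3,1}` hypersurface `∂Ω` at `x`:
`ν = ∇r / |∇r|`, where `r > 0` inside `Ω`. -/
def IsInteriorNormal {n : ℕ} (Ω : Set (E n)) (x ν : E n) : Prop :=
  ∃ (U : Set (E n)) (r : E n → ℝ), IsDefiningFn 3 Ω x U r ∧
    ν = ‖gradient r x‖⁻¹ • gradient r x

/-- The tangent space at `x` of the level set of `r` through `x`. -/
abbrev tangentSpace {n : ℕ} (r : E n → ℝ) (x : E n) : Submodule ℝ (E n) :=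
  (Submodule.span ℝ {gradient r x})ᗮ

/-- The shape operator, with respect to the unit normal `∇r / |∇r|`, of the level set of `r`
through `x`. It is the self-adjoint endomorphism of the tangent space that represents the second
fundamental form `(v, w) ↦ - D²r(x)(v, w) / |∇r(x)|`; with the interior normal, spheres have
positive curvature. -/
def shapeOperator {n : ℕ} (r : E n → ℝ) (x : E n) :
    tangentSpace r x →ₗ[ℝ] tangentSpace r x :=
  -(‖gradient r x‖⁻¹ • ((tangentSpace r x).orthogonalProjectionOnto.toLinearMap ∘ₗ
    (fderiv ℝ (gradient r) x).toLinearMap ∘ₗ (tangentSpace r x).subtype))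

/-- The principal curvatures `κ₁, …, κ_{n-1}` at `x` of the level set of `r` through `x`, with
multiplicity. -/
def principalCurvatures {n : ℕ} (r : E n → ℝ) (x : E n) : Multiset ℝ :=
  (shapeOperator r x).charpoly.roots

/-- `∂Ω ∈ C^{3,1}` is strictly `l`-convex: there is `δ > 0` with `σ_j(κ) ≥ δ` everywhere on `∂Ω`
for `1 ≤ j ≤ l`, where `κ` are the principal curvatures with respect to the interior normal
(they do not depend on the defining function). -/
def StrictlyConvexBdry {n : ℕ} (l : ℕ) (Ω : Set (E n)) : Prop :=
  ∃ δ : ℝ, 0 < δ ∧ ∀ x ∈ frontier Ω, ∀ (U : Set (E n)) (r : E n → ℝ), IsDefiningFn 3 Ω x U r →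
    ∀ j, 1 ≤ j → j ≤ l → δ ≤ (principalCurvatures r x).esymm j

/-- `dist(A, B)`, with values in `[0, ∞]` (it is `∞` if `A` or `B` is empty). -/
def setDist {n : ℕ} (A B : Set (E n)) : ℝ≥0∞ := ⨅ x ∈ A, ⨅ y ∈ B, edist x y

/-- `sup (|u_{νη}| + |u_{ηη}|)` over all boundary points of `Ω` and all unit tangential
vectors `η` there, `ν` being the unit interior normal. -/
def bdryTangentialSup {n : ℕ} (Ω : Set (E n)) (u : E n → ℝ) : ℝ≥0∞ :=
  ⨆ (x ∈ frontier Ω) (ν : E n) (_ : IsInteriorNormal Ω x ν) (η : E n)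
    (_ : ‖η‖ = 1 ∧ inner ℝ η ν = 0),
      ENNReal.ofReal (|secondDeriv Ω u x ν η| + |secondDeriv Ω u x η η|)

end KHess

end

/-! The differential of `σ_k` at `D²u(x)` is `L B = ∑ gᵢ B(qᵢ, qᵢ)` in an orthonormal eigenbasis
`q`, with all `gᵢ > 0`. Every error term is measured by the trace `T = ∑ gᵢ`. Newton–Maclaurin
inequalities give `f^(k-1) ≤ T^k` and `‖D²u‖ f^(k-2) ≤ T^(k-1)` (`Bil.Symm.exists_isLinearization`).

A nonnegative `C^{1,1}` function `g` satisfies `|Dg| ≤ C √g` at points that have some room around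
them. For `g = f^{3/(2k-2)}` this turns into `|Df|^(k-1) ≤ M f^(k-2)` (`exists_rhs_bound`). Together
with the second trace inequality it yields `|Df| ≤ M T` wherever `‖D²u‖ ≥ 1`, without any lower
bound for `f`. Points with `‖D²u‖ < 1` do no harm: the minimum principle
`nonneg_of_exists_hessForm_neg` inspects only critical points of a comparison function, and there
the gradient of the barrier forces `D²u` to be large.

Boundary convexity enters through `eventually_sig_neg_hess_add_pos`: `-D²r + t ∇r ⊗ ∇r` lies in
`Γ_k` for large `t`, since each `σ_{j+1}` of it is affine in `t` with slope a positive multiple of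
`σ_j(κ)`. By Gårding's inequality the barrier `r - (K/2) r² + ε |· - x'|²` then satisfies `L ≤ -ε
T`, while its gradient stays away from zero. `LocalBarrier.compare` deduces that a function `v`
which is `O(|y - x'|²)` on `∂Ω`, with `|L v|` controlled by `T` where `|Dv|` is large, has a bounded
gradient at `x'`.

The sup bound follows from `L u = k f`. The boundary gradient bound is the comparison for `v = u -
Φ`, where `Φ` extends the boundary values, and `exists_gradient_le` carries it inside. For the
second derivatives, `v` is the derivative of `u - Φ` along an affine field `η + W(y - x')` with `W`
skew. Rotation invariance of `σ_k` makes the linearized equation for this derivative of `u` free of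
commutator terms, and `LocalBarrier.exists_rotation` chooses `W` so that the field is tangential to
`∂Ω` up to `O(|y - x'|²)`. The full gradient of `v` at `x'` contains both `u_{νη}` and `u_{ηη}`.
Compactness of `∂Ω` makes the local constants global. -/

noncomputable section

set_option maxSynthPendingDepth 3
set_option linter.unusedSectionVars false

namespace KHess

open Finset Polynomial

/-! ### Elementary symmetric polynomials and the Gårding cone. -/

section ElementarySymmetric

variable {ι : Type*} [DecidableEq ι]

/-- The `k`-th elementary symmetric polynomial of the numbers `l i`, `i ∈ s`. -/
def esy (k : ℕ) (s : Finset ι) (l : ι → ℝ) : ℝ := (s.val.map l).esymm k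

lemma esy_zero (s : Finset ι) (l : ι → ℝ) : esy 0 s l = 1 := by
  simp [esy, Multiset.esymm]

lemma esy_succ_empty (k : ℕ) (l : ι → ℝ) : esy (k + 1) ∅ l = 0 := by
  simp [esy, Multiset.esymm, Multiset.powersetCard_zero_right]

lemma esy_insert {s : Finset ι} {a : ι} (ha : a ∉ s) (k : ℕ) (l : ι → ℝ) :
    esy (k + 1) (insert a s) l = esy (k + 1) s l + l a * esy k s l := by
  simp [esy, Multiset.esymm, insert_val_of_notMem ha, Multiset.powersetCard_cons,
    Multiset.sum_map_mul_left]

lemma esy_erase {s : Finset ι} {a : ι} (ha : a ∈ s) (k : ℕ) (l : ι → ℝ) :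
    esy (k + 1) s l = esy (k + 1) (s.erase a) l + l a * esy k (s.erase a) l := by
  rw [← esy_insert (notMem_erase a s), insert_erase ha]

/-- Euler's identity for a homogeneous polynomial: each product of `k + 1` numbers is counted once
for each of its factors. -/
lemma sum_mul_esy_erase (k : ℕ) (s : Finset ι) (l : ι → ℝ) :
    ∑ i ∈ s, l i * esy k (s.erase i) l = (k + 1) * esy (k + 1) s l := by
  induction s using Finset.induction_on generalizing k with
  | empty => simp [esy_succ_empty]
  | insert a s ha ih =>
    rw [sum_insert ha, erase_insert ha, esy_insert ha]
    have h : ∀ i ∈ s, (insert a s).erase i = insert a (s.erase i) := fun i hi =>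
      erase_insert_of_ne (fun h => ha (h ▸ hi))
    cases k with
    | zero =>
      have := ih 0
      simp only [esy_zero] at this ⊢
      simp only [mul_one, Nat.cast_zero, zero_add, one_mul] at this ⊢
      rw [this]; ring
    | succ k =>
      have h2 : ∀ i ∈ s, l i * esy (k + 1) ((insert a s).erase i) l =
          l i * esy (k + 1) (s.erase i) l + l a * (l i * esy k (s.erase i) l) := by
        intro i hi
        rw [h i hi, esy_insert (fun h => ha (mem_of_mem_erase h))]
        ring
      rw [sum_congr rfl h2, sum_add_distrib, ← mul_sum, ih, ih]
      push_cast
      ring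

/-- A product of `k` of the numbers survives the removal of exactly those indices that do not occur
in it. -/
lemma sum_esy_erase (k : ℕ) (s : Finset ι) (l : ι → ℝ) :
    ∑ i ∈ s, esy k (s.erase i) l = (s.card - k) * esy k s l := by
  cases k with
  | zero => simp [esy_zero]
  | succ k =>
    have h : ∀ i ∈ s, esy (k + 1) (s.erase i) l = esy (k + 1) s l - l i * esy k (s.erase i) l :=
      fun i hi => by rw [esy_erase hi]; ring
    rw [sum_congr rfl h, sum_sub_distrib, sum_mul_esy_erase]
    simp
    ring

/-- The difference of the two sides is `P'(0)² - P(0) P''(0)`, which is nonnegative for a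
real-rooted `P`. A new factor `X - a` multiplies it by `a²` and adds `P(0)²`. -/
lemma coeff_one_sq_ge_of_multiset (m : Multiset ℝ) :
    2 * (m.map fun a => X - C a).prod.coeff 0 * (m.map fun a => X - C a).prod.coeff 2 ≤
      (m.map fun a => X - C a).prod.coeff 1 ^ 2 := by
  induction m using Multiset.induction_on with
  | empty => simp [coeff_one]
  | cons a m ih =>
    rw [Multiset.map_cons, Multiset.prod_cons]
    set P := (m.map fun a => X - C a).prod
    have h0 : ((X - C a) * P).coeff 0 = -a * P.coeff 0 := by simp [sub_mul]
    have h1 : ((X - C a) * P).coeff 1 = P.coeff 0 - a * P.coeff 1 := by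
      simp [sub_mul, coeff_X_mul]
    have h2 : ((X - C a) * P).coeff 2 = P.coeff 1 - a * P.coeff 2 := by
      simp [sub_mul, coeff_X_mul]
    rw [h0, h1, h2]
    nlinarith [mul_nonneg (sq_nonneg a) (sub_nonneg.2 ih), sq_nonneg (P.coeff 0)]

lemma Splits.coeff_one_sq_ge {P : ℝ[X]} (hP : P.Splits) :
    2 * P.coeff 0 * P.coeff 2 ≤ P.coeff 1 ^ 2 := by
  rw [hP.eq_prod_roots]
  simp only [coeff_C_mul]
  nlinarith [mul_nonneg (sq_nonneg P.leadingCoeff)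
    (sub_nonneg.2 (coeff_one_sq_ge_of_multiset P.roots))]

/-- Rolle's theorem: passing to the derivative loses at most one real root, and the degree drops as
well. -/
lemma splits_derivative_of_splits {P : ℝ[X]} (hP : P.Splits) : P.derivative.Splits := by
  rcases eq_or_ne P.derivative 0 with h | h
  · rw [h]; exact Splits.zero
  · rw [splits_iff_card_roots]
    have h1 := card_roots_le_derivative P
    rw [splits_iff_card_roots.1 hP] at h1
    have h2 := natDegree_derivative_lt (p := P) (fun h0 => h (by
      rw [eq_C_of_natDegree_eq_zero h0]; simp))
    have h3 := card_roots' P.derivative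
    omega

lemma splits_iterate_derivative {P : ℝ[X]} (hP : P.Splits) (k : ℕ) :
    (derivative^[k] P).Splits := by
  induction k with
  | zero => exact hP
  | succ k ih => rw [Function.iterate_succ_apply']; exact splits_derivative_of_splits ih

/-- The inequality at the lowest coefficients is applied to the `k`-th derivative. The factorials
produce the sharper factor `(k + 2) / (k + 1)` on the left, which is dropped. -/
lemma Splits.coeff_sq_ge {P : ℝ[X]} (hP : P.Splits) (k : ℕ) :
    P.coeff k * P.coeff (k + 2) ≤ P.coeff (k + 1) ^ 2 := by
  have h := Splits.coeff_one_sq_ge (splits_iterate_derivative hP k)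
  simp only [coeff_iterate_derivative, nsmul_eq_mul, zero_add] at h
  have e0 : ((0 + k).descFactorial k : ℝ) = (k.factorial : ℝ) := by
    simp [Nat.descFactorial_self]
  have e1 : ((1 + k).descFactorial k : ℝ) = (k.factorial : ℝ) * (k + 1) := by
    have := Nat.factorial_mul_descFactorial (show k ≤ 1 + k by omega)
    simp at this
    rw [this, add_comm, Nat.factorial_succ]; push_cast; ring
  have e2 : 2 * ((2 + k).descFactorial k : ℝ) = (k.factorial : ℝ) * (k + 1) * (k + 2) := by
    have := Nat.factorial_mul_descFactorial (show k ≤ 2 + k by omega)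
    simp at this
    have h3 : ((2 : ℕ) * (2 + k).descFactorial k : ℝ) = ((2 + k).factorial : ℕ) := by
      rw [← this]; push_cast; simp
    rw [add_comm 2 k, Nat.factorial_succ, Nat.factorial_succ] at h3
    rw [add_comm 2 k]
    push_cast at h3 ⊢; rw [h3]; ring
  have c0 : ((0 + k).descFactorial k : ℝ) = ((k).descFactorial k : ℝ) := by simp
  rw [← c0, e0, e1, add_comm 1 k, add_comm 2 k] at h
  rw [add_comm 2 k] at e2
  set a := P.coeff k
  set b := P.coeff (k + 1)
  set c := P.coeff (k + 2)
  have hf : (0 : ℝ) < k.factorial := by exact_mod_cast k.factorial_pos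
  have hk : (0 : ℝ) ≤ k := Nat.cast_nonneg k
  have h4 : (k.factorial : ℝ) ^ 2 * ((k + 1) * ((k + 2) * (a * c))) ≤
      (k.factorial : ℝ) ^ 2 * ((k + 1) * ((k + 1) * b ^ 2)) := by
    calc _ = (k.factorial * a) * (2 * ((k + 2).descFactorial k : ℝ)) * c := by rw [e2]; ring
      _ ≤ _ := by nlinarith [h]
  have h5 := le_of_mul_le_mul_left h4 (by positivity)
  have h6 := le_of_mul_le_mul_left h5 (by positivity)
  by_contra! h7
  nlinarith [sq_nonneg b]

/-- **Newton's inequality** (without the sharp constant), for real numbers of any sign. -/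
lemma esy_mul_esy_le_sq (s : Finset ι) (l : ι → ℝ) (k : ℕ) :
    esy k s l * esy (k + 2) s l ≤ esy (k + 1) s l ^ 2 := by
  rcases lt_or_ge s.card (k + 2) with h | h
  · have : esy (k + 2) s l = 0 := by
      rw [esy, Multiset.esymm, Multiset.powersetCard_eq_empty]
      · simp
      · simpa using h
    rw [this]; simpa using sq_nonneg _
  · have hs : ((s.val.map l).map fun r => X + C r).prod.Splits :=
      Splits.multisetProd (by
        intro p hp
        obtain ⟨r, -, rfl⟩ := Multiset.mem_map.1 hp
        exact Splits.X_add_C r)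
    -- The elementary symmetric polynomials are the coefficients of `∏ (X + l i)` read from the top,
    -- so the coefficient inequality appears in reversed order.
    have hc : ∀ j, j ≤ s.card → esy j s l =
        ((s.val.map l).map fun r => X + C r).prod.coeff (s.card - j) := by
      intro j hj
      rw [Multiset.prod_X_add_C_coeff _ (by simp)]
      simp [esy, Nat.sub_sub_self hj]
    have := Splits.coeff_sq_ge hs (s.card - (k + 2))
    rw [hc k (by omega), hc (k + 1) (by omega), hc (k + 2) h]
    rw [show s.card - k = s.card - (k + 2) + 2 by omega,
      show s.card - (k + 1) = s.card - (k + 2) + 1 by omega, mul_comm]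
    exact this

/-- The Gårding cone for families indexed by `s`. -/
def InCone (k : ℕ) (s : Finset ι) (l : ι → ℝ) : Prop := ∀ j ≤ k, 0 < esy j s l

lemma InCone.mono {k m : ℕ} {s : Finset ι} {l : ι → ℝ} (h : InCone k s l) (hm : m ≤ k) :
    InCone m s l := fun j hj => h j (hj.trans hm)

/-- Write `a`, `b`, `c` for three consecutive polynomials of the shortened family, with `a > 0`. If
`b ≤ 0`, then `b + l i * a > 0` and `c + l i * b > 0` combine to `b² < a c`, against Newton's
inequality. -/
lemma InCone.erase {k : ℕ} {s : Finset ι} {l : ι → ℝ} (h : InCone (k + 1) s l) {i : ι}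
    (hi : i ∈ s) : InCone k (s.erase i) l := by
  induction k with
  | zero => intro j hj; obtain rfl : j = 0 := by omega
            simp [esy_zero]
  | succ k ih =>
    have ih' := ih (h.mono (by omega))
    intro j hj
    rcases Nat.lt_or_ge j (k + 1) with hj' | hj'
    · exact ih' j (by omega)
    obtain rfl : j = k + 1 := by omega
    by_contra! hneg
    have h1 := h (k + 1) (by omega)
    have h2 := h (k + 2) le_rfl
    rw [esy_erase hi] at h1 h2
    have h0 := ih' k le_rfl
    have hN := esy_mul_esy_le_sq (s.erase i) l k
    nlinarith [mul_nonneg h1.le (neg_nonneg.2 hneg), mul_pos h0 h2]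

/-- The function `a² / y` is convex and homogeneous of degree one, hence subadditive; enlarging the
denominator only helps. -/
lemma sq_div_superadd {a b y z w : ℝ} (hy : 0 < y) (hz : 0 < z) (hw : y + z ≤ w) :
    (a + b) ^ 2 / w ≤ a ^ 2 / y + b ^ 2 / z := by
  have h1 : (a + b) ^ 2 / w ≤ (a + b) ^ 2 / (y + z) :=
    div_le_div_of_nonneg_left (sq_nonneg _) (by positivity) hw
  refine h1.trans ?_
  rw [div_add_div _ _ hy.ne' hz.ne', div_le_div_iff₀ (by positivity) (by positivity)]
  nlinarith [sq_nonneg (a * z - b * y), mul_pos hy hz, mul_nonneg (mul_pos hy hz).le (sq_nonneg (a * z - b * y)), mul_nonneg (add_pos hy hz).le (sq_nonneg (a * z - b * y))]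

/-- This reduces a quotient to quotients of one order less on shortened families, in the form `a -
a² / w`. That expression is superadditive as soon as `w` is, which drives the induction in
`InCone.add`. -/
lemma esy_quotient_eq {k : ℕ} {s : Finset ι} {l : ι → ℝ} (h : InCone (k + 1) s l) :
    (k + 2) * (esy (k + 2) s l / esy (k + 1) s l) =
      ∑ i ∈ s, (l i - l i ^ 2 / (l i + esy (k + 1) (s.erase i) l / esy k (s.erase i) l)) := by
  have hk := h (k + 1) le_rfl
  have h1 := sum_mul_esy_erase (k + 1) s l
  push_cast at h1
  rw [← mul_div_assoc, show ((k : ℝ) + 2) = k + 1 + 1 by ring, ← h1, sum_div]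
  refine sum_congr rfl fun i hi => ?_
  have he := h.erase hi k le_rfl
  have h2 := esy_erase hi k l
  have h3 : l i + esy (k + 1) (s.erase i) l / esy k (s.erase i) l =
      esy (k + 1) s l / esy k (s.erase i) l := by
    rw [h2]; field_simp; ring
  rw [h3]
  field_simp
  rw [h2]; ring

/-- The Gårding cone is convex and the quotients of consecutive elementary symmetric
polynomials are superadditive on it (Marcus–Lopes). -/
lemma InCone.add {k : ℕ} {s : Finset ι} {l m : ι → ℝ} (hl : InCone k s l) (hm : InCone k s m) :
    InCone k s (l + m) ∧ esy (k + 1) s l / esy k s l + esy (k + 1) s m / esy k s m ≤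
      esy (k + 1) s (l + m) / esy k s (l + m) := by
  induction k generalizing s with
  | zero =>
    refine ⟨fun j hj => ?_, ?_⟩
    · obtain rfl : j = 0 := by omega
      simp [esy_zero]
    · have h := fun l : ι → ℝ => sum_mul_esy_erase 0 s l
      simp only [esy_zero, mul_one, Nat.cast_zero, zero_add, one_mul] at h
      simp only [esy_zero, div_one, zero_add, ← h, Pi.add_apply, sum_add_distrib, le_refl]
  | succ k ih =>
    have hc : InCone (k + 1) s (l + m) := by
      have h0 := ih (hl.mono (Nat.le_succ k)) (hm.mono (Nat.le_succ k))
      intro j hj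
      rcases Nat.lt_or_ge j (k + 1) with hj' | hj'
      · exact h0.1 j (by omega)
      obtain rfl : j = k + 1 := by omega
      have h1 := div_pos (hl (k + 1) le_rfl) (hl k (Nat.le_succ k))
      have h2 := div_pos (hm (k + 1) le_rfl) (hm k (Nat.le_succ k))
      exact (div_pos_iff_of_pos_right (h0.1 k le_rfl)).1 (by linarith [h0.2])
    refine ⟨hc, ?_⟩
    have hk : (0 : ℝ) < k + 2 := by positivity
    rw [← mul_le_mul_iff_right₀ hk, mul_add, esy_quotient_eq hl, esy_quotient_eq hm,
      esy_quotient_eq hc, ← sum_add_distrib]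
    refine sum_le_sum fun i hi => ?_
    have pos : ∀ {l : ι → ℝ}, InCone (k + 1) s l →
        0 < l i + esy (k + 1) (s.erase i) l / esy k (s.erase i) l := by
      intro l hl
      have h := hl (k + 1) le_rfl
      have h0 := hl.erase hi k le_rfl
      rw [esy_erase hi] at h
      have : l i + esy (k + 1) (s.erase i) l / esy k (s.erase i) l =
        (esy (k + 1) (s.erase i) l + l i * esy k (s.erase i) l) / esy k (s.erase i) l := by
        field_simp; ring
      rw [this]; positivity
    have := sq_div_superadd (a := l i) (b := m i) (pos hl) (pos hm)
      (w := (l + m) i + esy (k + 1) (s.erase i) (l + m) / esy k (s.erase i) (l + m)) (by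
        have := (ih (hl.erase hi) (hm.erase hi)).2
        simp only [Pi.add_apply]
        linarith)
    simp only [Pi.add_apply] at this ⊢
    linarith

lemma esy_smul (k : ℕ) (s : Finset ι) (c : ℝ) (l : ι → ℝ) :
    esy k s (c • l) = c ^ k * esy k s l := by
  induction s using Finset.induction_on generalizing k with
  | empty => cases k <;> simp [esy_zero, esy_succ_empty]
  | insert a s ha ih =>
    cases k with
    | zero => simp [esy_zero]
    | succ k => simp only [esy_insert ha, ih, Pi.smul_apply, smul_eq_mul]; ring

lemma InCone.smul {k : ℕ} {s : Finset ι} {l : ι → ℝ} (h : InCone k s l) {c : ℝ} (hc : 0 < c) :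
    InCone k s (c • l) := fun j hj => by
  rw [esy_smul]; exact mul_pos (pow_pos hc j) (h j hj)

/-- `σ_j` is the product of the first `j` consecutive quotients, and each of them grows by
superadditivity. -/
lemma InCone.esy_le_esy_add {k : ℕ} {s : Finset ι} {l m : ι → ℝ} (hl : InCone k s l)
    (hm : InCone k s m) {j : ℕ} (hj : j ≤ k) : esy j s l ≤ esy j s (l + m) := by
  induction j with
  | zero => simp [esy_zero]
  | succ j ih =>
    have h := (hl.mono (show j ≤ k by omega)).add (hm.mono (show j ≤ k by omega))
    have h1 := ih (by omega)
    have h2 := hl j (by omega)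
    have h3 := hl (j + 1) hj
    have h4 := hm (j + 1) hj
    have h5 := hm j (by omega)
    have h6 : esy (j + 1) s l / esy j s l ≤ esy (j + 1) s (l + m) / esy j s (l + m) := by
      have := div_pos h4 h5
      linarith [h.2]
    have h7 : 0 < esy j s (l + m) := h.1 j le_rfl
    calc esy (j + 1) s l = esy (j + 1) s l / esy j s l * esy j s l := by field_simp
      _ ≤ esy (j + 1) s (l + m) / esy j s (l + m) * esy j s (l + m) := by
        refine mul_le_mul h6 h1 h2.le (le_trans (div_pos h3 h2).le h6)
      _ = _ := by field_simp

lemma hasDerivAt_esy_add_smul (k : ℕ) (s : Finset ι) (l m : ι → ℝ) :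
    HasDerivAt (fun t : ℝ => esy (k + 1) s (l + t • m))
      (∑ i ∈ s, esy k (s.erase i) l * m i) 0 := by
  induction s using Finset.induction_on generalizing k with
  | empty => simpa [esy_succ_empty] using hasDerivAt_const (0 : ℝ) (0 : ℝ)
  | insert a s ha ih =>
    simp only [esy_insert ha]
    have h0 : HasDerivAt (fun t : ℝ => (l + t • m) a) (m a) 0 := by
      simpa using ((hasDerivAt_id (0 : ℝ)).mul_const (m a)).const_add (l a)
    have h : ∀ i ∈ s, (insert a s).erase i = insert a (s.erase i) := fun i hi =>
      erase_insert_of_ne (fun h => ha (h ▸ hi))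
    cases k with
    | zero =>
      simp only [esy_zero, mul_one]
      have := (ih 0).add h0
      simp only [esy_zero] at this
      refine HasDerivAt.congr_deriv (f := fun t : ℝ => _) this ?_
      rw [sum_insert ha]; ring
    | succ k =>
      have := (ih (k + 1)).add (h0.mul (ih k))
      refine HasDerivAt.congr_deriv (f := fun t : ℝ => _) this ?_
      rw [sum_insert ha, erase_insert ha]
      have h2 : ∀ i ∈ s, esy (k + 1) ((insert a s).erase i) l * m i =
          esy (k + 1) (s.erase i) l * m i + l a * (esy k (s.erase i) l * m i) := by
        intro i hi
        rw [h i hi, esy_insert (fun h => ha (mem_of_mem_erase h))]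
        ring
      rw [sum_congr rfl h2, sum_add_distrib, ← mul_sum]
      simp
      ring

/-- **Gårding's inequality** in its weakest form: the differential of `σ_{k+1}` at a point of the
cone is nonnegative on the cone. -/
lemma InCone.sum_esy_erase_mul_nonneg {k : ℕ} {s : Finset ι} {l m : ι → ℝ}
    (hl : InCone (k + 1) s l) (hm : InCone (k + 1) s m) :
    0 ≤ ∑ i ∈ s, esy k (s.erase i) l * m i := by
  have h := hasDerivAt_esy_add_smul k s l m
  have h1 := h.hasDerivWithinAt (s := Set.Ioi 0)
  rw [hasDerivWithinAt_iff_tendsto_slope' (by simp)] at h1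
  refine ge_of_tendsto h1 ?_
  filter_upwards [self_mem_nhdsWithin] with t ht
  have := hl.esy_le_esy_add (hm.smul ht) (j := k + 1) le_rfl
  simp only [slope_def_field, zero_smul, add_zero, sub_zero]
  exact div_nonneg (sub_nonneg.2 this) (le_of_lt ht)

/-- Consecutive quotients decrease, hence `σ_{k+1}^k ≤ σ_k^{k+1}` on the cone. -/
lemma InCone.quotient_antitone {k : ℕ} {s : Finset ι} {l : ι → ℝ} (hl : InCone (k + 1) s l)
    {j : ℕ} (hj : j ≤ k) :
    esy (k + 1) s l / esy k s l ≤ esy (j + 1) s l / esy j s l := by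
  induction k with
  | zero => obtain rfl : j = 0 := by omega
            exact le_rfl
  | succ k ih =>
    rcases Nat.lt_or_ge k j with h | h
    · obtain rfl : j = k + 1 := by omega
      exact le_rfl
    · refine le_trans ?_ (ih (hl.mono (by omega)) h)
      have h0 := hl k (by omega)
      have h1 := hl (k + 1) (by omega)
      rw [div_le_div_iff₀ h1 h0]
      nlinarith [esy_mul_esy_le_sq s l k]

/-- `σ_j / σ_i` is a product of `j - i` consecutive quotients, none smaller than the last one. The
cases `i = 0` and `i = 1` give the two trace inequalities; in the second, `σ_1` stands for the size
of the Hessian. -/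
lemma InCone.esy_pow_mul_le {k : ℕ} {s : Finset ι} {l : ι → ℝ} (hl : InCone (k + 1) s l)
    {j : ℕ} (hj : j ≤ k) {i : ℕ} (hi : i ≤ j) :
    esy i s l * (esy (k + 1) s l / esy k s l) ^ (j - i) ≤ esy j s l := by
  induction j, hi using Nat.le_induction with
  | base => simp
  | succ j hij ih =>
    have h1 := hl.quotient_antitone (show j ≤ k by omega)
    have h2 := ih (by omega)
    have hq := div_pos (hl (k + 1) le_rfl) (hl k (by omega))
    have hj0 := hl j (by omega)
    rw [Nat.succ_sub hij, pow_succ, ← mul_assoc]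
    calc _ ≤ esy j s l * (esy (j + 1) s l / esy j s l) := mul_le_mul h2 h1 hq.le hj0.le
      _ = _ := by field_simp

lemma InCone.maclaurin {k : ℕ} {s : Finset ι} {l : ι → ℝ} (hl : InCone (k + 1) s l) :
    esy (k + 1) s l ^ k ≤ esy k s l ^ (k + 1) := by
  have h := hl.esy_pow_mul_le (le_refl k) (Nat.zero_le k)
  have hk := hl k (by omega)
  rw [esy_zero, one_mul, Nat.sub_zero, div_pow, div_le_iff₀ (by positivity)] at h
  rwa [pow_succ, mul_comm]

lemma InCone.maclaurin_one {k : ℕ} {s : Finset ι} {l : ι → ℝ} (hl : InCone (k + 2) s l) :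
    esy 1 s l * esy (k + 2) s l ^ k ≤ esy (k + 1) s l ^ (k + 1) := by
  have h := hl.esy_pow_mul_le (le_refl (k + 1)) (show 1 ≤ k + 1 by omega)
  have hk := hl (k + 1) (by omega)
  rw [Nat.add_sub_cancel, div_pow, mul_div_assoc', div_le_iff₀ (by positivity)] at h
  rwa [pow_succ, mul_comm (_ ^ k)]

end ElementarySymmetric

end KHess

end

noncomputable section

set_option maxSynthPendingDepth 3

namespace KHess

open Finset Polynomial

/-! ### Symmetric bilinear forms and the linearization of the Hessian operator. -/

section BilinearForms

variable {n : ℕ}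

/-- The space of bilinear forms on `ℝⁿ`. -/
abbrev Bil (n : ℕ) : Type := E n →L[ℝ] E n →L[ℝ] ℝ

/-- The matrix of a bilinear form in an orthonormal basis. -/
def Bil.matrix {ι : Type*} [Fintype ι] (B : Bil n) (q : OrthonormalBasis ι ℝ (E n)) :
    Matrix ι ι ℝ := Matrix.of fun i j => B (q i) (q j)

/-- The matrix of a bilinear form in the standard basis. -/
def Bil.toMat (B : Bil n) : Matrix (Fin n) (Fin n) ℝ := B.matrix (EuclideanSpace.basisFun (Fin n) ℝ)

lemma Bil.apply_eq_sum {ι κ : Type*} [Fintype ι] [Fintype κ] (B : Bil n)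
    (q : OrthonormalBasis ι ℝ (E n)) (p : OrthonormalBasis κ ℝ (E n)) (v w : E n) :
    B v w = ∑ i, ∑ j, inner ℝ (q i) v * inner ℝ (p j) w * B (q i) (p j) := by
  conv_lhs => rw [← q.sum_repr' v, ← p.sum_repr' w]
  simp only [map_sum, map_smul, _root_.sum_apply, _root_.smul_apply,
    smul_eq_mul, mul_sum]
  rw [sum_comm]
  exact sum_congr rfl fun i _ => sum_congr rfl fun j _ => by ring

/-- Two orthonormal bases differ by an orthogonal matrix `P`, and `Pᵀ B P` is then a conjugate of
`B`. -/
lemma Bil.charpoly_matrix_eq {ι κ : Type*} [Fintype ι] [Fintype κ] [DecidableEq ι] [DecidableEq κ]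
    (B : Bil n) (q : OrthonormalBasis ι ℝ (E n)) (p : OrthonormalBasis κ ℝ (E n)) :
    (B.matrix q).charpoly = (B.matrix p).charpoly := by
  have e : ι ≃ κ := q.toBasis.indexEquiv p.toBasis
  let p' := p.reindex e.symm
  have h1 : (B.matrix p).charpoly = (B.matrix p').charpoly := by
    rw [← Matrix.charpoly_reindex e.symm (B.matrix p)]
    congr 1
    ext i j
    simp [Bil.matrix, p']
  rw [h1]
  let P : Matrix ι ι ℝ := Matrix.of fun a i => inner ℝ (p' a) (q i)
  have hP : P.transpose * P = 1 := by
    ext i j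
    simp only [Matrix.mul_apply, Matrix.transpose_apply, P, Matrix.of_apply]
    have := p'.sum_inner_mul_inner (q i) (q j)
    rw [orthonormal_iff_ite.1 q.orthonormal i j] at this
    rw [Matrix.one_apply, ← this]
    exact sum_congr rfl fun a _ => by rw [real_inner_comm]
  have hB : B.matrix q = P.transpose * B.matrix p' * P := by
    ext i j
    simp only [Matrix.mul_apply, Matrix.transpose_apply, P, Matrix.of_apply, Bil.matrix]
    rw [B.apply_eq_sum p' p' (q i) (q j), sum_comm]
    refine sum_congr rfl fun a _ => ?_
    rw [sum_mul]
    exact sum_congr rfl fun b _ => by ring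
  rw [hB, Matrix.charpoly_mul_comm, ← mul_assoc, mul_eq_one_comm.1 hP, one_mul]

/-- A bilinear form is symmetric. -/
def Bil.Symm (B : Bil n) : Prop := ∀ v w, B v w = B w v

/-- The orthonormal basis `q` diagonalizes `B`, with eigenvalues `l`. -/
def Bil.IsDiag (B : Bil n) (q : OrthonormalBasis (Fin n) ℝ (E n)) (l : Fin n → ℝ) : Prop :=
  ∀ i j, B (q i) (q j) = if i = j then l i else 0

lemma Bil.Symm.exists_isDiag {B : Bil n} (hB : B.Symm) : ∃ q l, B.IsDiag q l := by
  have hA : B.toMat.IsHermitian := by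
    ext i j
    simp [Bil.toMat, Bil.matrix, hB (EuclideanSpace.single i 1)]
  refine ⟨hA.eigenvectorBasis, hA.eigenvalues, fun i j => ?_⟩
  set q := hA.eigenvectorBasis
  have h1 := hA.mulVec_eigenvectorBasis i
  have h2 : ∀ b, ∑ a, q i a * B.toMat b a = hA.eigenvalues i * q i b := by
    intro b
    have := congrFun h1 b
    simp only [Matrix.mulVec, dotProduct, Pi.smul_apply, smul_eq_mul] at this
    rw [← this]
    exact sum_congr rfl fun a _ => mul_comm _ _
  rw [B.apply_eq_sum (EuclideanSpace.basisFun (Fin n) ℝ) (EuclideanSpace.basisFun (Fin n) ℝ),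
    sum_comm]
  have h3 : ∀ b, ∑ a, inner ℝ (EuclideanSpace.basisFun (Fin n) ℝ a) (q i) *
      inner ℝ (EuclideanSpace.basisFun (Fin n) ℝ b) (q j) *
      B (EuclideanSpace.basisFun (Fin n) ℝ a) (EuclideanSpace.basisFun (Fin n) ℝ b) =
      hA.eigenvalues i * (q j b * q i b) := by
    intro b
    rw [show hA.eigenvalues i * (q j b * q i b) = q j b * (hA.eigenvalues i * q i b) by ring,
      ← h2, mul_sum]
    refine sum_congr rfl fun a _ => ?_
    rw [hB]
    simp only [Bil.toMat, Bil.matrix, Matrix.of_apply]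
    rw [EuclideanSpace.basisFun_inner, EuclideanSpace.basisFun_inner]
    ring
  rw [sum_congr rfl fun b _ => h3 b, ← mul_sum]
  have h4 : ∑ b, q j b * q i b = inner ℝ (q i) (q j) := by
    simp [PiLp.inner_apply]
  rw [h4, orthonormal_iff_ite.1 q.orthonormal i j]
  simp

lemma Bil.IsDiag.matrix {B : Bil n} {q l} (h : B.IsDiag q l) : B.matrix q = Matrix.diagonal l := by
  ext i j
  simp [Bil.matrix, h i j, Matrix.diagonal_apply]

lemma Bil.IsDiag.eigenvalues_toMat {B : Bil n} {q l} (h : B.IsDiag q l) :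
    eigenvalues B.toMat = univ.val.map l := by
  rw [eigenvalues, Bil.toMat, B.charpoly_matrix_eq _ q, h.matrix, Matrix.charpoly_diagonal]
  rw [Polynomial.roots_prod _ _ (prod_ne_zero_iff.2 fun i _ => X_sub_C_ne_zero _)]
  simp

lemma Bil.IsDiag.sigma_toMat {B : Bil n} {q l} (h : B.IsDiag q l) (k : ℕ) :
    sigma k B.toMat = esy k univ l := by
  rw [sigma, h.eigenvalues_toMat, esy]

/-- `σ_k` as a polynomial on the space of all bilinear forms. -/
def Bil.sig (k : ℕ) (B : Bil n) : ℝ := (-1) ^ k * B.toMat.charpoly.coeff (n - k)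

lemma sig_of_charpoly {k : ℕ} (hk : k ≤ n) {B : Bil n} {q : OrthonormalBasis (Fin n) ℝ (E n)}
    {l : Fin n → ℝ} (h : (B.matrix q).charpoly = ∏ i, (X - C (l i))) :
    B.sig k = esy k univ l := by
  rw [Bil.sig, Bil.toMat, B.charpoly_matrix_eq _ q, h]
  have : ∏ i, (X - C (l i)) = ((univ.val.map l).map fun t => X - C t).prod := by
    rw [Multiset.map_map]; rfl
  rw [this, Multiset.prod_X_sub_C_coeff _ (by simp)]
  simp only [Multiset.card_map, card_val, card_univ, Fintype.card_fin, Nat.sub_sub_self hk]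
  rw [← mul_assoc, ← mul_pow]
  simp [esy]

lemma Bil.IsDiag.sig_eq {B : Bil n} {q l} (h : B.IsDiag q l) {k : ℕ} (hk : k ≤ n) :
    B.sig k = esy k univ l :=
  sig_of_charpoly hk (by rw [h.matrix, Matrix.charpoly_diagonal])

lemma Bil.Symm.sig_eq_sigma {B : Bil n} (hB : B.Symm) {k : ℕ} (hk : k ≤ n) :
    B.sig k = sigma k B.toMat := by
  obtain ⟨q, l, h⟩ := hB.exists_isDiag
  rw [h.sig_eq hk, h.sigma_toMat]

lemma Bil.IsDiag.mem_gardingCone {B : Bil n} {q l} (h : B.IsDiag q l) (k : ℕ) :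
    eigenvalues B.toMat ∈ gardingCone k ↔ InCone k univ l := by
  rw [h.eigenvalues_toMat]
  refine ⟨fun H j hj => ?_, fun H j _ hj => H j hj⟩
  rcases Nat.eq_zero_or_pos j with rfl | h0
  · simp [esy_zero]
  · exact H j h0 hj

lemma Bil.Symm.mem_gardingCone {B : Bil n} (hB : B.Symm) {k : ℕ} (hk : k ≤ n) :
    eigenvalues B.toMat ∈ gardingCone k ↔ ∀ j ≤ k, 0 < B.sig j := by
  obtain ⟨q, l, h⟩ := hB.exists_isDiag
  rw [h.mem_gardingCone]
  exact forall₂_congr fun j hj => by rw [h.sig_eq (hj.trans hk)]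

/-- Eigenvalues need not be smooth, but coefficients of the characteristic polynomial are
polynomials in the entries. This is why the equation is differentiated through `Bil.sig` rather than
`sigma`. -/
lemma contDiff_sig (k : ℕ) {m : WithTop ℕ∞} : ContDiff ℝ m (Bil.sig k : Bil n → ℝ) := by
  let F : Bil n →ₗ[ℝ] (Fin n × Fin n → ℝ) :=
    { toFun := fun B p => B (EuclideanSpace.basisFun (Fin n) ℝ p.1)
        (EuclideanSpace.basisFun (Fin n) ℝ p.2)
      map_add' := fun _ _ => rfl
      map_smul' := fun _ _ => rfl }
  have h := AnalyticOnNhd.eval_linearMap F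
    ((Matrix.charpoly.univ ℝ (Fin n)).coeff (n - k))
  have h2 : (Bil.sig k : Bil n → ℝ) = fun B => (-1) ^ k *
      MvPolynomial.eval (F B) ((Matrix.charpoly.univ ℝ (Fin n)).coeff (n - k)) := by
    ext B
    rw [Bil.sig]
    have := Matrix.charpoly.univ_coeff_eval₂Hom (Fin n) (RingHom.id ℝ) (F B) (n - k)
    rw [show MvPolynomial.eval (F B) ((Matrix.charpoly.univ ℝ (Fin n)).coeff (n - k)) = _
      from this]
    rfl
  rw [h2]
  exact contDiff_const.mul (contDiffOn_univ.1 (h.contDiffOn uniqueDiffOn_univ))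

/-- The elementary bilinear form `(v, w) ↦ ⟨a, v⟩ ⟨b, w⟩`. -/
def Bil.tensor (a b : E n) : Bil n := (innerSL ℝ a).smulRight (innerSL ℝ b)

@[simp] lemma Bil.tensor_apply (a b v w : E n) :
    Bil.tensor a b v w = inner ℝ a v * inner ℝ b w := by
  simp [Bil.tensor]

lemma Bil.eq_sum_tensor (B : Bil n) (q : OrthonormalBasis (Fin n) ℝ (E n)) :
    B = ∑ i, ∑ j, B (q i) (q j) • Bil.tensor (q i) (q j) := by
  ext v w
  rw [B.apply_eq_sum q q]
  simp only [_root_.sum_apply, _root_.smul_apply, Bil.tensor_apply,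
    smul_eq_mul]
  exact sum_congr rfl fun i _ => sum_congr rfl fun j _ => by ring

/-- The perturbed matrix is triangular. Hence off-diagonal directions contribute nothing to the
differential of `σ_k` at a diagonal matrix. -/
lemma charpoly_diagonal_add_single {l : Fin n → ℝ} {i j : Fin n} (hij : i ≠ j) (t : ℝ) :
    (Matrix.diagonal l + Matrix.single i j t).charpoly = ∏ i, (X - C (l i)) := by
  wlog h : i < j generalizing i j
  · rw [← Matrix.charpoly_transpose, Matrix.transpose_add, Matrix.diagonal_transpose,
      Matrix.transpose_single]
    exact this hij.symm (lt_of_le_of_ne (not_lt.1 h) hij.symm)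
  rw [Matrix.charpoly_of_isUpperTriangular]
  · refine prod_congr rfl fun a _ => ?_
    have : Matrix.single i j t a a = 0 := by
      rw [Matrix.single_apply]
      exact if_neg fun h' => hij (h'.1.trans h'.2.symm)
    simp [this]
  · intro a b hab
    have h1 : Matrix.single i j t a b = 0 := by
      rw [Matrix.single_apply]
      refine if_neg fun h' => ?_
      obtain ⟨rfl, rfl⟩ := h'
      exact absurd h (not_lt.2 (le_of_lt hab))
    have h2 : a ≠ b := (ne_of_lt hab).symm
    simp [h1, Matrix.diagonal_apply_ne l h2]

/-- The differential of `σ_k` at a bilinear form diagonalized by `q`. -/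
lemma Bil.IsDiag.fderiv_sig {A : Bil n} {q l} (h : A.IsDiag q l) {k : ℕ} (hk : k + 1 ≤ n)
    (B : Bil n) : fderiv ℝ (Bil.sig (k + 1)) A B =
      ∑ i, esy k (univ.erase i) l * B (q i) (q i) := by
  have hd : ∀ B : Bil n, HasDerivAt (fun t : ℝ => Bil.sig (k + 1) (A + t • B))
      (fderiv ℝ (Bil.sig (k + 1)) A B) 0 := by
    intro B
    have h1 : HasFDerivAt (Bil.sig (k + 1)) (fderiv ℝ (Bil.sig (k + 1)) A) (A + (0 : ℝ) • B) := by
      rw [zero_smul, add_zero]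
      exact ((contDiff_sig (k + 1) (m := 1)).differentiable (by simp) A).hasFDerivAt
    have h2 : HasDerivAt (fun t : ℝ => A + t • B) B 0 := by
      simpa using ((hasDerivAt_id (0 : ℝ)).smul_const B).const_add A
    exact h1.comp_hasDerivAt (0 : ℝ) h2
  have hmat : ∀ i j (t : ℝ), (A + t • Bil.tensor (q i) (q j)).matrix q =
      Matrix.diagonal l + Matrix.single i j t := by
    intro i j t
    ext a b
    have h1 := orthonormal_iff_ite.1 q.orthonormal i a
    have h2 := orthonormal_iff_ite.1 q.orthonormal j b
    simp only [Bil.matrix, Matrix.of_apply, _root_.add_apply, h a b,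
      _root_.smul_apply, Bil.tensor_apply, h1, h2, Matrix.add_apply,
      Matrix.diagonal_apply, Matrix.single_apply, smul_eq_mul]
    congr 1
    by_cases h3 : i = a <;> by_cases h4 : j = b <;> simp [h3, h4]
  have hoff : ∀ i j, fderiv ℝ (Bil.sig (k + 1)) A (Bil.tensor (q i) (q j)) =
      if i = j then esy k (univ.erase i) l else 0 := by
    intro i j
    refine (hd (Bil.tensor (q i) (q j))).unique ?_
    split_ifs with hij
    · subst hij
      have h1 : (fun t : ℝ => Bil.sig (k + 1) (A + t • Bil.tensor (q i) (q i))) =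
          fun t => esy (k + 1) univ (l + t • Pi.single i 1) := by
        ext t
        refine sig_of_charpoly hk ?_ (q := q)
        rw [hmat, ← Matrix.diagonal_single, Matrix.diagonal_add, Matrix.charpoly_diagonal]
        refine prod_congr rfl fun a _ => ?_
        congr 2
        simp only [Pi.add_apply, Pi.smul_apply, smul_eq_mul, Pi.single_apply]
        split_ifs <;> simp
      rw [h1]
      have h2 := hasDerivAt_esy_add_smul k univ l (Pi.single i 1)
      refine h2.congr_deriv ?_
      rw [sum_eq_single i] <;> simp +contextual
    · have h1 : (fun t : ℝ => Bil.sig (k + 1) (A + t • Bil.tensor (q i) (q j))) =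
          fun _ => esy (k + 1) univ l := by
        ext t
        refine sig_of_charpoly hk ?_ (q := q)
        rw [hmat, charpoly_diagonal_add_single hij]
      rw [h1]
      exact hasDerivAt_const _ _
  conv_lhs => rw [B.eq_sum_tensor q]
  simp only [map_sum, map_smul, hoff, smul_eq_mul, mul_ite, mul_zero, sum_ite_eq, mem_univ, if_true]
  exact sum_congr rfl fun i _ => mul_comm _ _

/-- Passage from eigenvalues to matrices, by Birkhoff's theorem. -/
lemma Bil.IsDiag.sum_mul_nonneg {B : Bil n} {p m} (h : B.IsDiag p m)
    (q : OrthonormalBasis (Fin n) ℝ (E n)) {g : Fin n → ℝ}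
    (hg : ∀ σ : Equiv.Perm (Fin n), 0 ≤ ∑ i, g i * m (σ i)) : 0 ≤ ∑ i, g i * B (q i) (q i) := by
  -- The diagonal entries of `B` in the basis `q` are averages of its eigenvalues, with weights the
  -- squared inner products of two orthonormal bases. These weights form a doubly stochastic matrix,
  -- hence a convex combination of permutations.
  let P : Matrix (Fin n) (Fin n) ℝ := Matrix.of fun i j => inner ℝ (p j) (q i) ^ 2
  have hP : P ∈ doublyStochastic ℝ (Fin n) := by
    rw [mem_doublyStochastic_iff_sum]
    refine ⟨fun i j => sq_nonneg _, fun i => ?_, fun j => ?_⟩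
    · have := p.sum_sq_inner_right (q i)
      simpa [P] using this
    · have := q.sum_sq_inner_left (p j)
      simpa [P] using this
  obtain ⟨w, hw0, -, hw⟩ := exists_eq_sum_perm_of_mem_doublyStochastic hP
  have hB : ∀ i, B (q i) (q i) = ∑ j, P i j * m j := by
    intro i
    rw [B.apply_eq_sum p p]
    refine sum_congr rfl fun a _ => ?_
    simp only [h a, mul_ite, mul_zero, sum_ite_eq, mem_univ, if_true, P, Matrix.of_apply, sq]
  have hB2 : ∀ i, B (q i) (q i) = ∑ σ, w σ * m (σ i) := by
    intro i
    rw [hB, ← hw]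
    simp only [Matrix.sum_apply, sum_mul, Matrix.smul_apply, smul_eq_mul]
    rw [sum_comm]
    refine sum_congr rfl fun σ _ => ?_
    rw [sum_eq_single (σ i)]
    · simp [Equiv.Perm.permMatrix, PEquiv.toMatrix_apply, Equiv.toPEquiv_apply]
    · intro b _ hb
      simp [Equiv.Perm.permMatrix, PEquiv.toMatrix_apply, Equiv.toPEquiv_apply, hb.symm]
    · simp
  simp only [hB2, mul_sum]
  rw [sum_comm]
  refine sum_nonneg fun σ _ => ?_
  have := mul_nonneg (hw0 σ) (hg σ)
  rw [mul_sum] at this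
  exact this.trans_eq (sum_congr rfl fun i _ => by ring)

/-- The linearization of `σ_k` at `A` is `B ↦ ∑ i, g i * B (q i) (q i)`, together with the
inequalities for its trace. -/
structure IsLinearization (k : ℕ) (A : Bil n) (q : OrthonormalBasis (Fin n) ℝ (E n))
    (g : Fin n → ℝ) : Prop where
  pos : ∀ i, 0 < g i
  off_diag : ∀ i j, i ≠ j → A (q i) (q j) = 0
  fderiv_eq : ∀ B : Bil n, fderiv ℝ (Bil.sig k) A B = ∑ i, g i * B (q i) (q i)
  euler : ∑ i, g i * A (q i) (q i) = k * A.sig k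
  trace_ge : A.sig k ^ (k - 1) ≤ (∑ i, g i) ^ k
  trace_ge_norm : ‖A‖ * A.sig k ^ (k - 2) ≤ (∑ i, g i) ^ (k - 1)
  garding : ∀ B : Bil n, B.Symm → eigenvalues B.toMat ∈ gardingCone k →
    0 ≤ ∑ i, g i * B (q i) (q i)

/-- From `σ_1² = ∑ l_i² + 2 σ_2` and `σ_2 > 0`, every `|l_i|` is at most `σ_1`. -/
lemma Bil.IsDiag.norm_le {A : Bil n} {q l} (h : A.IsDiag q l) (hl : InCone 2 univ l) :
    ‖A‖ ≤ esy 1 univ l := by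
  have h1 := hl 1 (by norm_num)
  have h2 := hl 2 le_rfl
  have hs : ∑ i, l i ^ 2 ≤ esy 1 univ l ^ 2 := by
    have e0 := sum_mul_esy_erase 0 univ l
    have e1 := sum_mul_esy_erase 1 univ l
    simp only [esy_zero, mul_one, Nat.cast_zero, zero_add, one_mul] at e0
    have e2 : ∀ i ∈ univ, l i * esy 1 (univ.erase i) l = l i * esy 1 univ l - l i ^ 2 := by
      intro i hi
      rw [esy_erase hi 0 l, esy_zero]; ring
    rw [sum_congr rfl e2, sum_sub_distrib, ← sum_mul, e0] at e1
    push_cast at e1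
    nlinarith
  have hi : ∀ i, |l i| ≤ esy 1 univ l := fun i =>
    abs_le_of_sq_le_sq ((single_le_sum (fun j _ => sq_nonneg (l j)) (mem_univ i)).trans hs) h1.le
  refine ContinuousLinearMap.opNorm_le_bound₂ _ h1.le fun v w => ?_
  have e : A v w = ∑ i, inner ℝ (q i) v * inner ℝ (q i) w * l i := by
    rw [A.apply_eq_sum q q]
    refine sum_congr rfl fun a _ => ?_
    simp only [h a, mul_ite, mul_zero, sum_ite_eq, mem_univ, if_true]
  have hcs : ∑ i, |inner ℝ (q i) v| * |inner ℝ (q i) w| ≤ ‖v‖ * ‖w‖ := by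
    refine le_of_sq_le_sq ?_ (by positivity) |>.trans le_rfl
    refine (sum_mul_sq_le_sq_mul_sq univ _ _).trans_eq ?_
    simp only [sq_abs, q.sum_sq_inner_right]
    ring
  rw [e, Real.norm_eq_abs, mul_assoc]
  calc _ ≤ ∑ i, |inner ℝ (q i) v| * |inner ℝ (q i) w| * |l i| := by
        refine (abs_sum_le_sum_abs _ _).trans_eq ?_
        simp only [abs_mul]
    _ ≤ ∑ i, |inner ℝ (q i) v| * |inner ℝ (q i) w| * esy 1 univ l :=
        sum_le_sum fun i _ => mul_le_mul_of_nonneg_left (hi i) (by positivity)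
    _ ≤ _ := by
        rw [← sum_mul, mul_comm]
        exact mul_le_mul_of_nonneg_left hcs h1.le

/-- The weights are `σ_{k-1}` of the eigenvalues with one omitted; they are positive by
`InCone.erase`. -/
theorem Bil.Symm.exists_isLinearization {A : Bil n} (hA : A.Symm) {k : ℕ} (hk : 2 ≤ k)
    (hkn : k ≤ n) (hc : eigenvalues A.toMat ∈ gardingCone k) :
    ∃ q g, IsLinearization k A q g := by
  obtain ⟨q, l, h⟩ := hA.exists_isDiag
  obtain ⟨k, rfl⟩ : ∃ m, k = m + 2 := ⟨k - 2, by omega⟩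
  have hl := (h.mem_gardingCone _).1 hc
  have hg : ∀ i, 0 < esy (k + 1) (univ.erase i) l := fun i => hl.erase (mem_univ i) _ le_rfl
  -- The sum of the weights is a multiple of `σ_{k-1}` with a factor at least `1`, precisely because
  -- the order does not exceed `n`.
  have htr : esy (k + 1) univ l ≤ ∑ i, esy (k + 1) (univ.erase i) l := by
    rw [sum_esy_erase]
    have h1 := hl (k + 1) (by omega)
    have h2 : (1 : ℝ) ≤ ((univ : Finset (Fin n)).card : ℝ) - (k + 1 : ℕ) := by
      rw [card_univ, Fintype.card_fin, le_sub_iff_add_le]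
      exact_mod_cast (by omega : 1 + (k + 1) ≤ n)
    nlinarith
  have h1 := (hl (k + 1) (by omega)).le
  refine ⟨q, fun i => esy (k + 1) (univ.erase i) l, hg, fun i j hij => by simp [h i j, hij],
    fun B => h.fderiv_sig (by omega) B, ?_, ?_, ?_, ?_⟩
  · rw [h.sig_eq hkn]
    have := sum_mul_esy_erase (k + 1) univ l
    push_cast at this ⊢
    rw [show (k : ℝ) + 2 = k + 1 + 1 by ring, ← this]
    exact sum_congr rfl fun i _ => by rw [h i i, if_pos rfl, mul_comm]
  · rw [h.sig_eq hkn]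
    exact hl.maclaurin.trans (pow_le_pow_left₀ h1 htr _)
  · rw [h.sig_eq hkn]
    refine le_trans ?_ (hl.maclaurin_one.trans (pow_le_pow_left₀ h1 htr _))
    exact mul_le_mul_of_nonneg_right (h.norm_le (hl.mono (by omega)))
      (pow_nonneg (hl (k + 2) le_rfl).le _)
  · intro B hB hBc
    obtain ⟨p, m, hp⟩ := hB.exists_isDiag
    refine hp.sum_mul_nonneg q fun σ => ?_
    have hm := (hp.mem_gardingCone _).1 hBc
    -- The cone is invariant under permutations, so the scalar Gårding inequality holds for every
    -- reordering that Birkhoff's theorem asks for.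
    have hm' : InCone (k + 1 + 1) univ (m ∘ σ) := by
      intro j hj
      have : esy j univ (m ∘ σ) = esy j univ m := by
        simp only [esy]
        rw [← Multiset.map_map, Multiset.map_univ_val_equiv]
      rw [this]
      exact hm j hj
    exact hl.sum_esy_erase_mul_nonneg hm'

end BilinearForms

end KHess

end

noncomputable section

set_option maxSynthPendingDepth 3

namespace KHess

open Finset Polynomial Filter

/-! ### Rank-one perturbations and the role of the principal curvatures. -/

section RankOne

/-- The determinant is affine in its first row, and the new term is the complementary minor. -/
lemma Matrix.charpoly_add_single_zero {m : ℕ} (M : Matrix (Fin (m + 1)) (Fin (m + 1)) ℝ) (t : ℝ) :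
    (M + Matrix.single 0 0 t).charpoly =
      M.charpoly - C t * (M.submatrix Fin.succ Fin.succ).charpoly := by
  have h1 : (M + Matrix.single 0 0 t).charmatrix =
      M.charmatrix.updateRow 0 (M.charmatrix 0 + (-C t) • Pi.single 0 1) := by
    refine Matrix.ext fun i j => ?_
    rw [Matrix.updateRow_apply]
    by_cases hi : i = 0
    · subst hi
      by_cases hj : j = 0
      · subst hj
        simp
        ring
      · have : (0 : Fin (m + 1)) ≠ j := Ne.symm hj
        simp [hj, this]
    · have : (0 : Fin (m + 1)) ≠ i := Ne.symm hi
      simp [Matrix.charmatrix_apply, hi, this]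
  have h2 : (M.submatrix Fin.succ Fin.succ).charmatrix =
      M.charmatrix.submatrix Fin.succ Fin.succ := by
    refine Matrix.ext fun i j => ?_
    simp [Matrix.charmatrix_apply, Matrix.diagonal_apply]
  have h3 : (M.charmatrix.updateRow 0 (Pi.single 0 1)).det =
      (M.charmatrix.submatrix Fin.succ Fin.succ).det := by
    rw [← Matrix.adjugate_apply, Matrix.adjugate_fin_succ_eq_det_submatrix]
    simp [Fin.succAbove_zero]
  rw [Matrix.charpoly, h1, Matrix.det_updateRow_add, Matrix.det_updateRow_smul,
    Matrix.updateRow_eq_self, h3, Matrix.charpoly, Matrix.charpoly, h2]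
  simp [sub_eq_add_neg]

/-- A real symmetric matrix has all its roots real, so Vieta's formulas apply to `roots`, which
would otherwise lose complex eigenvalues. -/
lemma esymm_roots_charpoly {m : ℕ} {M : Matrix (Fin m) (Fin m) ℝ} (hM : M.IsHermitian) {j : ℕ}
    (hj : j ≤ m) : M.charpoly.roots.esymm j = (-1) ^ j * M.charpoly.coeff (m - j) := by
  have hd : M.charpoly.natDegree = m := by simp [Matrix.charpoly_natDegree_eq_dim]
  have h := Polynomial.coeff_eq_esymm_roots_of_card
    (splits_iff_card_roots.1 hM.splits_charpoly) (k := m - j) (by omega)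
  rw [h, hd, Nat.sub_sub_self hj, M.charpoly_monic.leadingCoeff, one_mul, ← mul_assoc, ← mul_pow]
  simp

variable {n : ℕ}

lemma exists_orthonormalBasis_cons {m : ℕ} {N : E (m + 1)} (hN : ‖N‖ = 1)
    (T : Submodule ℝ (E (m + 1))) (hT : T = (Submodule.span ℝ {N})ᗮ) :
    ∃ (b : OrthonormalBasis (Fin m) ℝ T) (q : OrthonormalBasis (Fin (m + 1)) ℝ (E (m + 1))),
      q 0 = N ∧ ∀ i, q (Fin.succ i) = b i := by
  have hN0 : N ≠ 0 := by rintro rfl; simp at hN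
  have hfin : Module.finrank ℝ T = m := by
    have h1 := (Submodule.span ℝ {N}).finrank_add_finrank_orthogonal
    rw [finrank_span_singleton hN0, finrank_euclideanSpace, Fintype.card_fin, ← hT] at h1
    omega
  let b : OrthonormalBasis (Fin m) ℝ T := (stdOrthonormalBasis ℝ T).reindex (finCongr hfin)
  let v : Fin (m + 1) → E (m + 1) := Fin.cons N (fun i => (b i : E (m + 1)))
  have hperp : ∀ i, inner ℝ N (b i : E (m + 1)) = 0 := fun i => by
    have h : (b i : E (m + 1)) ∈ (Submodule.span ℝ {N})ᗮ := hT ▸ (b i).2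
    exact Submodule.mem_orthogonal_singleton_iff_inner_right.1 h
  have hv : Orthonormal ℝ v := by
    rw [orthonormal_iff_ite]
    intro i j
    refine Fin.cases ?_ (fun i => ?_) i <;> refine Fin.cases ?_ (fun j => ?_) j
    · simp [v, hN]
    · simp [v, hperp, (Fin.succ_ne_zero _).symm]
    · simp [v, real_inner_comm, hperp, Fin.succ_ne_zero]
    · have := orthonormal_iff_ite.1 b.orthonormal i j
      simp only [v, Fin.cons_succ, Fin.succ_inj]
      rw [← this]; rfl
  have hspan : ⊤ ≤ Submodule.span ℝ (Set.range v) :=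
    (hv.linearIndependent.span_eq_top_of_card_eq_finrank' (by simp)).ge
  refine ⟨b, OrthonormalBasis.mk hv hspan, ?_, fun i => ?_⟩
  · simp [v]
  · simp [v]

/-- Perturbation in the direction `N` is affine in `t`; the slope of `σ_{j+1}` is `σ_j` of the
restriction to `N^⊥`. -/
lemma Bil.sig_add_smul_tensor {m : ℕ} {B : Bil (m + 1)} {N : E (m + 1)}
    (q : OrthonormalBasis (Fin (m + 1)) ℝ (E (m + 1))) (hq0 : q 0 = N)
    (t : ℝ) {j : ℕ} :
    (B + t • Bil.tensor N N).sig (j + 1) = B.sig (j + 1) +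
      t * ((-1) ^ j * ((B.matrix q).submatrix Fin.succ Fin.succ).charpoly.coeff (m - j)) := by
  have h1 : (B + t • Bil.tensor N N).matrix q = B.matrix q + Matrix.single 0 0 t := by
    ext i j
    have hi := orthonormal_iff_ite.1 q.orthonormal 0 i
    have hj := orthonormal_iff_ite.1 q.orthonormal 0 j
    simp only [Bil.matrix, Matrix.of_apply, _root_.add_apply, _root_.smul_apply, Bil.tensor_apply,
      ← hq0, hi, hj, Matrix.add_apply, Matrix.single_apply, smul_eq_mul]
    congr 1
    by_cases h3 : 0 = i <;> by_cases h4 : 0 = j <;> simp [h3, h4]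
  rw [Bil.sig, Bil.sig, Bil.toMat, Bil.toMat, Bil.charpoly_matrix_eq _ _ q,
    Bil.charpoly_matrix_eq B _ q, h1, Matrix.charpoly_add_single_zero]
  rw [show m + 1 - (j + 1) = m - j by omega, coeff_sub, coeff_C_mul]
  ring

lemma Bil.Symm.sig_smul {B : Bil n} (hB : B.Symm) {k : ℕ} (hk : k ≤ n) (c : ℝ) :
    (c • B).sig k = c ^ k * B.sig k := by
  obtain ⟨q, l, h⟩ := hB.exists_isDiag
  have h' : (c • B).IsDiag q (c • l) := fun i j => by
    rw [_root_.smul_apply, _root_.smul_apply, h i j]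
    simp
  rw [h'.sig_eq hk, h.sig_eq hk, esy_smul]

lemma Bil.sig_zero (B : Bil n) : B.sig 0 = 1 := by
  have h := B.toMat.charpoly_monic.coeff_natDegree
  rw [Matrix.charpoly_natDegree_eq_dim, Fintype.card_fin] at h
  simp [Bil.sig, h]

lemma inner_fderiv_gradient (r : E n → ℝ) (x v w : E n) :
    inner ℝ (fderiv ℝ (gradient r) x v) w = fderiv ℝ (fderiv ℝ r) x v w := by
  have h : gradient r = fun y => (InnerProductSpace.toDual ℝ (E n)).symm (fderiv ℝ r y) := rfl
  have h2 := (InnerProductSpace.toDual ℝ (E n)).symm.toContinuousLinearEquiv.comp_fderiv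
    (f := fderiv ℝ r) (x := x)
  have h3 : fderiv ℝ (gradient r) x v =
      (InnerProductSpace.toDual ℝ (E n)).symm (fderiv ℝ (fderiv ℝ r) x v) := by
    exact congrArg (fun L => L v) h2
  rw [h3, InnerProductSpace.toDual_symm_apply]

lemma shapeOperator_toMatrix {m : ℕ} (r : E n → ℝ) (x : E n)
    (b : OrthonormalBasis (Fin m) ℝ (tangentSpace r x)) :
    LinearMap.toMatrix b.toBasis b.toBasis (shapeOperator r x) =
      Matrix.of fun i j => -(‖gradient r x‖⁻¹ * fderiv ℝ (fderiv ℝ r) x (b j) (b i)) := by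
  ext i j
  rw [LinearMap.toMatrix_apply, OrthonormalBasis.coe_toBasis_repr_apply,
    OrthonormalBasis.repr_apply_apply, OrthonormalBasis.coe_toBasis, Matrix.of_apply,
    ← inner_fderiv_gradient]
  simp only [shapeOperator, LinearMap.neg_apply, LinearMap.smul_apply, LinearMap.comp_apply,
    inner_neg_right, inner_smul_right, ContinuousLinearMap.coe_coe, Submodule.subtype_apply]
  congr 2
  rw [Submodule.coe_inner, real_inner_comm]
  have h := (tangentSpace r x).starProjection_inner_eq_zero
    (fderiv ℝ (gradient r) x (b j)) (b i) (b i).2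
  rw [inner_sub_left, sub_eq_zero] at h
  exact h.symm

/-- If `∂Ω` is strictly `(k-1)`-convex, adding a large multiple of `∇r ⊗ ∇r` to `-D²r` gives a
form in the cone `Γ_k`. -/
theorem eventually_sig_neg_hess_add_pos {k : ℕ} (hkn : k ≤ n) {r : E n → ℝ} {x : E n}
    (hG : gradient r x ≠ 0) (hS : Bil.Symm (fderiv ℝ (fderiv ℝ r) x))
    (hκ : ∀ j, 1 ≤ j → j ≤ k - 1 → 0 < (principalCurvatures r x).esymm j) :
    ∀ᶠ t : ℝ in atTop, ∀ j ≤ k,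
      0 < Bil.sig j (-fderiv ℝ (fderiv ℝ r) x +
        t • Bil.tensor (gradient r x) (gradient r x)) := by
  rcases Nat.eq_zero_or_pos n with rfl | hn
  · obtain rfl : k = 0 := by omega
    refine Eventually.of_forall fun t j hj => ?_
    obtain rfl : j = 0 := by omega
    simp [Bil.sig_zero]
  obtain ⟨m, rfl⟩ : ∃ m, n = m + 1 := ⟨n - 1, by omega⟩
  set G := gradient r x
  set D := fderiv ℝ (fderiv ℝ r) x
  have hG0 : 0 < ‖G‖ := norm_pos_iff.2 hG
  set N := ‖G‖⁻¹ • G with hNdef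
  have hN : ‖N‖ = 1 := by rw [hNdef, norm_smul, norm_inv, norm_norm, inv_mul_cancel₀ hG0.ne']
  have hspan : Submodule.span ℝ {N} = Submodule.span ℝ {G} :=
    Submodule.span_singleton_smul_eq (isUnit_iff_ne_zero.2 (inv_ne_zero hG0.ne')) G
  obtain ⟨b, q, hq0, hqs⟩ := exists_orthonormalBasis_cons hN (tangentSpace r x)
    (by rw [tangentSpace, hspan])
  set B : Bil (m + 1) := -(‖G‖⁻¹ • D) with hB
  have hBS : B.Symm := fun v w => by
    simp only [hB, _root_.neg_apply, _root_.smul_apply, hS v w]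
  have hmat : ((B.matrix q).submatrix Fin.succ Fin.succ) =
      (LinearMap.toMatrix b.toBasis b.toBasis (shapeOperator r x)).transpose := by
    rw [shapeOperator_toMatrix]
    ext i j
    simp [Bil.matrix, hB, hqs, D, G]
  have hherm : ((B.matrix q).submatrix Fin.succ Fin.succ).IsHermitian := by
    ext i j
    simp [Bil.matrix, hBS (q i.succ)]
  have hsig : ∀ t : ℝ, ∀ j ≤ m, (B + t • Bil.tensor N N).sig (j + 1) =
      B.sig (j + 1) + t * (principalCurvatures r x).esymm j := by
    intro t j hj
    rw [Bil.sig_add_smul_tensor q hq0, ← esymm_roots_charpoly hherm hj, hmat,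
      Matrix.charpoly_transpose, LinearMap.charpoly_toMatrix]
    rfl
  -- The slope is `σ_j(κ)` with `j ≤ k - 1`: convexity makes it positive for `j ≥ 1`, and for `j =
  -- 0` it is `1`.
  have hev : ∀ j ∈ Finset.range k, ∀ᶠ t : ℝ in atTop,
      0 < B.sig (j + 1) + t * (principalCurvatures r x).esymm j := by
    intro j hj
    have hj' := Finset.mem_range.1 hj
    have hpos : 0 < (principalCurvatures r x).esymm j := by
      rcases Nat.eq_zero_or_pos j with rfl | h0
      · simp [Multiset.esymm]
      · exact hκ j h0 (by omega)
    exact (tendsto_atTop_add_const_left _ _ (tendsto_id.atTop_mul_const hpos)).eventually_gt_atTop 0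
  have hev2 := (Filter.eventually_all_finset (Finset.range k)).2 hev
  have hlim : Tendsto (fun t : ℝ => t * ‖G‖) atTop atTop := tendsto_id.atTop_mul_const hG0
  filter_upwards [hlim.eventually hev2] with t ht j hj
  have he : -D + t • Bil.tensor G G = ‖G‖ • (B + (t * ‖G‖) • Bil.tensor N N) := by
    ext v w
    simp only [hB, _root_.add_apply, _root_.neg_apply, _root_.smul_apply, Bil.tensor_apply,
      smul_eq_mul, hNdef, inner_smul_left, map_inv₀, conj_trivial]
    field_simp
  have hs : (B + (t * ‖G‖) • Bil.tensor N N).Symm := fun v w => by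
    simp only [_root_.add_apply, _root_.smul_apply, Bil.tensor_apply, hBS v w]
    ring_nf
  rw [he, hs.sig_smul (hj.trans hkn)]
  refine mul_pos (pow_pos hG0 _) ?_
  rcases Nat.eq_zero_or_pos j with rfl | h0
  · simp [Bil.sig_zero]
  obtain ⟨i, rfl⟩ : ∃ i, j = i + 1 := ⟨j - 1, by omega⟩
  rw [hsig _ i (by omega)]
  exact ht i (Finset.mem_range.2 (by omega))

end RankOne

end KHess

end

noncomputable section

set_option maxSynthPendingDepth 3

namespace KHess

open Set Filter Topology

/-! ### Minimum principle and differentiation of the equation along affine fields. -/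

section Calculus

variable {n : ℕ}

/-- The Hessian as a bilinear form. -/
abbrev hessForm (u : E n → ℝ) (x : E n) : Bil n := fderiv ℝ (fderiv ℝ u) x

lemma hessian_eq_toMat (u : E n → ℝ) (x : E n) : hessian u x = Bil.toMat (hessForm u x) := by
  ext i j
  simp only [hessian, Bil.toMat, Bil.matrix, Matrix.of_apply, iteratedFDeriv_two_apply,
    EuclideanSpace.basisFun_apply]
  rfl

lemma hessForm_symm {u : E n → ℝ} {x : E n} (hu : ContDiffAt ℝ 2 u x) : (hessForm u x).Symm :=
  fun v w => (hu.isSymmSndFDerivAt (by simp)).eq v w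

lemma ContDiffAt.fderiv_two {F : Type*} [NormedAddCommGroup F] [NormedSpace ℝ F]
    {u : E n → F} {x : E n} {m : ℕ} (hu : ContDiffAt ℝ (m + 1 : ℕ) u x) :
    ContDiffAt ℝ (m : ℕ) (fderiv ℝ u) x := hu.fderiv_right (by norm_cast)

lemma hessForm_apply {u : E n → ℝ} {x : E n} (hu : ContDiffAt ℝ 2 u x) (v w : E n) :
    hessForm u x v w = fderiv ℝ (fun y => fderiv ℝ u y w) x v := by
  have h : DifferentiableAt ℝ (fderiv ℝ u) x :=
    (ContDiffAt.fderiv_two (m := 1) hu).differentiableAt (by simp)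
  have := (h.hasFDerivAt.clm_apply (hasFDerivAt_const w x)).fderiv
  rw [this]
  simp

/-- On the line through `x` in direction `v` the second-derivative test gives a local maximum.
Together with the local minimum the restriction is locally constant, contradicting its negative
second derivative. -/
lemma exists_neg_imp_not_isLocalMin {Ψ : E n → ℝ} {x : E n} (h : ContDiffAt ℝ 2 Ψ x) {v : E n}
    (hv : hessForm Ψ x v v < 0) : ¬ IsLocalMin Ψ x := by
  intro hmin
  have hf0 : fderiv ℝ Ψ x = 0 := hmin.fderiv_eq_zero
  have hline : Continuous fun t : ℝ => x + t • v := by fun_prop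
  have hlim : Tendsto (fun t : ℝ => x + t • v) (𝓝 0) (𝓝 x) := by
    simpa using hline.tendsto 0
  have hd : ∀ᶠ y in 𝓝 x, DifferentiableAt ℝ Ψ y :=
    (h.eventually (by simp)).mono fun y hy => hy.differentiableAt (by simp)
  have hl : ∀ t : ℝ, HasDerivAt (fun t : ℝ => x + t • v) v t := fun t => by
    simpa using ((hasDerivAt_id t).smul_const v).const_add x
  have h1 : deriv (fun t : ℝ => Ψ (x + t • v)) =ᶠ[𝓝 0] fun t => fderiv ℝ Ψ (x + t • v) v := by
    filter_upwards [hlim.eventually hd] with t ht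
    exact (ht.hasFDerivAt.comp_hasDerivAt t (hl t)).deriv
  have hd2 : DifferentiableAt ℝ (fun y => fderiv ℝ Ψ y v) x := by
    have : DifferentiableAt ℝ (fderiv ℝ Ψ) x :=
      (ContDiffAt.fderiv_two (m := 1) h).differentiableAt (by simp)
    exact this.clm_apply (differentiableAt_const v)
  have h2 : HasDerivAt (fun t : ℝ => fderiv ℝ Ψ (x + t • v) v) (hessForm Ψ x v v) 0 := by
    rw [hessForm_apply h]
    have hd3 : HasFDerivAt (fun y => fderiv ℝ Ψ y v) (fderiv ℝ (fun y => fderiv ℝ Ψ y v) x)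
        (x + (0 : ℝ) • v) := by simpa using hd2.hasFDerivAt
    exact hd3.comp_hasDerivAt (0 : ℝ) (hl 0)
  have h3 : deriv (deriv fun t : ℝ => Ψ (x + t • v)) 0 = hessForm Ψ x v v := by
    rw [h1.deriv_eq, h2.deriv]
  have h4 : deriv (fun t : ℝ => Ψ (x + t • v)) 0 = 0 := by
    rw [h1.self_of_nhds]; simp [hf0]
  have hc : ContinuousAt (fun t : ℝ => Ψ (x + t • v)) 0 := by
    have : ContinuousAt Ψ (x + (0 : ℝ) • v) := by simpa using h.continuousAt
    exact ContinuousAt.comp (f := fun t : ℝ => x + t • v) this hline.continuousAt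
  have hmax := isLocalMax_of_deriv_deriv_neg (by rw [h3]; exact hv) h4 hc
  have hconst : (fun t : ℝ => Ψ (x + t • v)) =ᶠ[𝓝 0] fun _ => Ψ x := by
    filter_upwards [hmax, hlim.eventually hmin] with t ht1 ht2
    simp only [zero_smul, add_zero] at ht1
    exact le_antisymm ht1 ht2
  have h5 : deriv (fun t : ℝ => Ψ (x + t • v)) =ᶠ[𝓝 0] fun _ => 0 := by
    have := hconst.deriv
    simpa using this
  rw [h5.deriv_eq] at h3
  simp at h3
  linarith [h3 ▸ hv]

/-- A function without interior minimum is nonnegative if it is so on the boundary. -/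
theorem nonneg_of_exists_hessForm_neg {D : Set (E n)} (hD : IsOpen D)
    (hb : Bornology.IsBounded D) {Ψ : E n → ℝ} (hc : ContinuousOn Ψ (closure D))
    (h2 : ∀ x ∈ D, ContDiffAt ℝ 2 Ψ x) (hfr : ∀ x ∈ frontier D, 0 ≤ Ψ x)
    (hint : ∀ x ∈ D, fderiv ℝ Ψ x = 0 → ∃ v, hessForm Ψ x v v < 0) :
    ∀ x ∈ closure D, 0 ≤ Ψ x := by
  intro y hy
  obtain ⟨x, hx, hmin⟩ := hb.isCompact_closure.exists_isMinOn ⟨y, hy⟩ hc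
  refine le_trans ?_ (hmin hy)
  by_cases hxD : x ∈ D
  · have hloc : IsLocalMin Ψ x :=
      hmin.isLocalMin (mem_of_superset (hD.mem_nhds hxD) subset_closure)
    -- The condition is needed only where the gradient vanishes. The later estimates depend on this:
    -- at such points a lower bound for `D²u` becomes available.
    obtain ⟨v, hv⟩ := hint x hxD hloc.fderiv_eq_zero
    exact absurd hloc (exists_neg_imp_not_isLocalMin (h2 x hxD) hv)
  · exact hfr x ⟨hx, fun h => hxD (interior_subset h)⟩

lemma exists_hessForm_neg_of_sum_neg {Ψ : E n → ℝ} {x : E n} {q : Fin n → E n} {g : Fin n → ℝ}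
    (hg : ∀ i, 0 < g i) (h : ∑ i, g i * hessForm Ψ x (q i) (q i) < 0) :
    ∃ v, hessForm Ψ x v v < 0 := by
  by_contra! hcon
  exact absurd h (not_lt.2 (Finset.sum_nonneg fun i _ => mul_nonneg (hg i).le (hcon _)))

/-- The derivative of `u` along the affine vector field `y ↦ a + W y`. -/
def alongField (u : E n → ℝ) (a : E n) (W : E n →L[ℝ] E n) (y : E n) : ℝ :=
  fderiv ℝ u y (a + W y)

lemma hasFDerivAt_alongField {u : E n → ℝ} {y : E n} (hu : ContDiffAt ℝ 2 u y) (a : E n)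
    (W : E n →L[ℝ] E n) :
    HasFDerivAt (alongField u a W)
      ((hessForm u y).flip (a + W y) + (fderiv ℝ u y).comp W) y := by
  have h : DifferentiableAt ℝ (fderiv ℝ u) y :=
    (ContDiffAt.fderiv_two (m := 1) hu).differentiableAt (by simp)
  have h2 := h.hasFDerivAt.clm_apply (W.hasFDerivAt.const_add a (x := y))
  refine h2.congr_fderiv ?_
  ext e
  simp [add_comm]

lemma contDiffAt_alongField {u : E n → ℝ} {y : E n} {m : ℕ} (hu : ContDiffAt ℝ (m + 1 : ℕ) u y)
    (a : E n) (W : E n →L[ℝ] E n) : ContDiffAt ℝ m (alongField u a W) y :=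
  (ContDiffAt.fderiv_two hu).clm_apply (contDiffAt_const.add W.contDiff.contDiffAt)

/-- Two kinds of transpositions are available: Schwarz's theorem for `Du`, and the derivative of the
symmetry of `D²u`. Three of them exchange the outer arguments. -/
lemma thirdDeriv_symm {u : E n → ℝ} {x : E n} (hu : ContDiffAt ℝ 3 u x) (v w z : E n) :
    fderiv ℝ (hessForm u) x v w z = fderiv ℝ (hessForm u) x z w v := by
  have h2 : ContDiffAt ℝ 2 (fderiv ℝ u) x := ContDiffAt.fderiv_two (m := 2) hu
  have hs : ∀ a b c, fderiv ℝ (hessForm u) x a b c = fderiv ℝ (hessForm u) x b a c := fun a b c =>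
    congrArg (fun L => L c) ((h2.isSymmSndFDerivAt (by simp)).eq a b)
  have hd : DifferentiableAt ℝ (hessForm u) x :=
    (ContDiffAt.fderiv_two (m := 1) h2).differentiableAt (by simp)
  have ht : ∀ a b c, fderiv ℝ (hessForm u) x a b c = fderiv ℝ (hessForm u) x a c b := by
    intro a b c
    have e : ∀ b c, fderiv ℝ (fun y => hessForm u y b c) x a = fderiv ℝ (hessForm u) x a b c := by
      intro b c
      have := ((hd.hasFDerivAt.clm_apply (hasFDerivAt_const b x)).clm_apply
        (hasFDerivAt_const c x)).fderiv
      rw [this]; simp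
    rw [← e, ← e]
    have hev : (fun y => hessForm u y b c) =ᶠ[𝓝 x] fun y => hessForm u y c b := by
      filter_upwards [(hu.of_le (m := 2) (by norm_cast)).eventually (by simp)] with y hy
      exact hessForm_symm hy b c
    rw [hev.fderiv_eq]
  rw [hs v w z, ht w v z, hs w z v]

lemma hessForm_alongField {u : E n → ℝ} {x : E n} (hu : ContDiffAt ℝ 3 u x) (a : E n)
    (W : E n →L[ℝ] E n) (q : E n) :
    hessForm (alongField u a W) x q q =
      fderiv ℝ (hessForm u) x (a + W x) q q + 2 * hessForm u x q (W q) := by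
  have h2 : ContDiffAt ℝ 2 (fderiv ℝ u) x := ContDiffAt.fderiv_two (m := 2) hu
  have hd1 : DifferentiableAt ℝ (fderiv ℝ u) x := h2.differentiableAt (by simp)
  have hd : DifferentiableAt ℝ (hessForm u) x :=
    (ContDiffAt.fderiv_two (m := 1) h2).differentiableAt (by simp)
  have hu2 := (hu.of_le (m := 2) (by norm_cast))
  rw [hessForm_apply (contDiffAt_alongField (m := 2) hu a W)]
  have hev : (fun y => fderiv ℝ (alongField u a W) y q) =ᶠ[𝓝 x]
      fun y => hessForm u y q (a + W y) + fderiv ℝ u y (W q) := by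
    filter_upwards [hu2.eventually (by simp)] with y hy
    rw [(hasFDerivAt_alongField hy a W).fderiv]
    simp
  rw [hev.fderiv_eq]
  have e1 := (hd.hasFDerivAt.clm_apply (hasFDerivAt_const q x)).clm_apply
    (W.hasFDerivAt.const_add a (x := x))
  have e2 := hd1.hasFDerivAt.clm_apply (hasFDerivAt_const (W q) x)
  rw [(e1.fun_add e2).fderiv, thirdDeriv_symm hu (a + W x) q q]
  simp
  ring

/-- `W` is skew-symmetric. -/
def IsSkew (W : E n →L[ℝ] E n) : Prop := ∀ v, inner ℝ v (W v) = 0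

/-- The linearized equation at a point. -/
theorem exists_linearizedEquation {k : ℕ} (hk : 2 ≤ k) (hkn : k ≤ n) {Ω : Set (E n)}
    (hΩ : IsOpen Ω) {u f : E n → ℝ} (hu : ∀ x ∈ Ω, ContDiffAt ℝ 3 u x)
    (had : ∀ x ∈ Ω, eigenvalues (hessian u x) ∈ gardingCone k)
    (heq : ∀ x ∈ Ω, sigma k (hessian u x) = f x) {x : E n} (hx : x ∈ Ω) :
    ∃ q g, IsLinearization k (hessForm u x) q g ∧ (hessForm u x).sig k = f x ∧
      ∀ (a : E n) (W : E n →L[ℝ] E n), IsSkew W →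
        ∑ i, g i * hessForm (alongField u a W) x (q i) (q i) = fderiv ℝ f x (a + W x) := by
  have hu2 : ∀ x ∈ Ω, ContDiffAt ℝ 2 u x := fun x hx => (hu x hx).of_le (by norm_cast)
  have hsig : ∀ x ∈ Ω, (hessForm u x).sig k = f x := fun x hx => by
    rw [(hessForm_symm (hu2 x hx)).sig_eq_sigma hkn, ← hessian_eq_toMat, heq x hx]
  have hc := had x hx
  rw [hessian_eq_toMat] at hc
  obtain ⟨q, g, hlin⟩ := (hessForm_symm (hu2 x hx)).exists_isLinearization hk hkn hc
  refine ⟨q, g, hlin, hsig x hx, fun a W hW => ?_⟩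
  have h3 := hu x hx
  have hd : DifferentiableAt ℝ (hessForm u) x :=
    (ContDiffAt.fderiv_two (m := 1) (ContDiffAt.fderiv_two (m := 2) h3)).differentiableAt (by simp)
  have hfd : ∀ e, fderiv ℝ f x e = ∑ i, g i * fderiv ℝ (hessForm u) x e (q i) (q i) := by
    intro e
    have hev : f =ᶠ[𝓝 x] fun y => Bil.sig k (hessForm u y) := by
      filter_upwards [hΩ.mem_nhds hx] with y hy
      exact (hsig y hy).symm
    have hs : HasFDerivAt (Bil.sig k) (fderiv ℝ (Bil.sig k) (hessForm u x)) (hessForm u x) :=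
      ((contDiff_sig k (m := 1)).differentiable (by simp) _).hasFDerivAt
    have h4 : HasFDerivAt (fun y => Bil.sig k (hessForm u y)) _ x := hs.comp x hd.hasFDerivAt
    rw [hev.fderiv_eq, h4.fderiv]
    exact hlin.fderiv_eq _
  rw [hfd]
  refine Finset.sum_congr rfl fun i _ => ?_
  rw [hessForm_alongField h3]
  -- Infinitesimal rotation invariance: `q i` is an eigenvector of `D²u`, so the term is a multiple
  -- of `⟨q i, W (q i)⟩`, which vanishes for skew `W`.
  have : hessForm u x (q i) (W (q i)) = 0 := by
    rw [← q.sum_repr' (W (q i)), map_sum]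
    refine Finset.sum_eq_zero fun j _ => ?_
    rw [map_smul, smul_eq_mul]
    by_cases hij : i = j
    · subst hij; rw [hW, zero_mul]
    · rw [hlin.off_diag i j hij, mul_zero]
  rw [this]; ring

end Calculus

end KHess

end

noncomputable section

set_option maxSynthPendingDepth 3

namespace KHess

open Set Filter Topology

/-! ### First-order calculus at boundary points. -/

section BoundaryCalculus

variable {n : ℕ} {Ω U : Set (E n)} {r : E n → ℝ} {x : E n}

lemma fderiv_apply_eq_inner_gradient (r : E n → ℝ) (x v : E n) :
    fderiv ℝ r x v = inner ℝ (gradient r x) v := by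
  rw [gradient, InnerProductSpace.toDual_symm_apply]

lemma IsDefiningFn.contDiffAt {m : ℕ} (h : IsDefiningFn m Ω x U r) {y : E n} (hy : y ∈ U) :
    ContDiffAt ℝ m r y := h.contDiffOn.contDiffAt (h.isOpen.mem_nhds hy)

lemma IsDefiningFn.nonneg_of_mem_closure {m : ℕ} (h : IsDefiningFn m Ω x U r) {y : E n}
    (hy : y ∈ U) (hyc : y ∈ closure Ω) : 0 ≤ r y := by
  by_cases hyΩ : y ∈ Ω
  · exact ((h.pos_iff y hy).1 hyΩ).le
  · exact ((h.zero_iff y hy).1 ⟨hyc, fun h' => hyΩ (interior_subset h')⟩).ge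

lemma IsDefiningFn.mono {m : ℕ} (h : IsDefiningFn m Ω x U r) {y : E n} (hy : y ∈ U) :
    IsDefiningFn m Ω y U r :=
  ⟨h.isOpen, hy, h.contDiffOn, h.lip, h.pos_iff, h.zero_iff, h.gradient_ne_zero⟩

/-- Strict differentiability of the defining function, in quantitative form. -/
lemma IsDefiningFn.exists_ball (h : IsDefiningFn 3 Ω x U r) {c : ℝ} (hc : 0 < c) :
    ∃ δ > 0, Metric.ball x δ ⊆ U ∧ ∀ y ∈ Metric.ball x δ, ∀ z ∈ Metric.ball x δ,
      |r z - r y - inner ℝ (gradient r x) (z - y)| ≤ c * ‖z - y‖ := by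
  have hs := (h.contDiffAt h.mem).hasStrictFDerivAt (by simp)
  have h1 := hs.isLittleO.def hc
  rw [nhds_prod_eq, Filter.eventually_prod_self_iff'] at h1
  obtain ⟨t, ht, h2⟩ := h1
  obtain ⟨δ, hδ, hball⟩ := Metric.mem_nhds_iff.1 (inter_mem ht (h.isOpen.mem_nhds h.mem))
  refine ⟨δ, hδ, fun y hy => (hball hy).2, fun y hy z hz => ?_⟩
  have := h2 z (hball hz).1 y (hball hy).1
  rw [fderiv_apply_eq_inner_gradient] at this
  simpa using this

/-- The mean value theorem on a segment whose endpoints may lie on the boundary while its interior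
stays in `Ω`. -/
lemma abs_sub_sub_le_of_segment {v : E n → ℝ} {V : E n → E n →L[ℝ] ℝ} {L : E n →L[ℝ] ℝ} {a b : E n}
    {ε : ℝ} (hc : ContinuousOn v (closure Ω)) (ha : a ∈ closure Ω) (hb : b ∈ closure Ω)
    (hseg : ∀ t ∈ Ioo (0 : ℝ) 1, a + t • (b - a) ∈ Ω)
    (hd : ∀ y ∈ Ω, HasFDerivAt v (V y) y)
    (hV : ∀ t ∈ Ioo (0 : ℝ) 1, ‖V (a + t • (b - a)) - L‖ ≤ ε) :
    |v b - v a - L (b - a)| ≤ ε * ‖b - a‖ := by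
  have hl : ∀ t : ℝ, HasDerivAt (fun t : ℝ => a + t • (b - a)) (b - a) t := fun t => by
    simpa using ((hasDerivAt_id t).smul_const (b - a)).const_add a
  have hmaps : MapsTo (fun t : ℝ => a + t • (b - a)) (Icc 0 1) (closure Ω) := by
    intro t ht
    rcases eq_or_lt_of_le ht.1 with rfl | h0
    · simpa using ha
    rcases eq_or_lt_of_le ht.2 with rfl | h1
    · simpa using hb
    exact subset_closure (hseg t ⟨h0, h1⟩)
  obtain ⟨t, ht, heq⟩ := exists_hasDerivAt_eq_slope (fun t : ℝ => v (a + t • (b - a)))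
    (fun t => V (a + t • (b - a)) (b - a)) one_pos
    (hc.comp (by fun_prop) hmaps)
    (fun t ht => (hd _ (hseg t ht)).comp_hasDerivAt t (hl t))
  simp only [one_smul, add_sub_cancel, zero_smul, add_zero, sub_zero, div_one] at heq
  rw [← heq, ← _root_.sub_apply, ← Real.norm_eq_abs]
  exact (ContinuousLinearMap.le_opNorm _ _).trans
    (mul_le_mul_of_nonneg_right (hV t ht) (norm_nonneg _))

/-- A function that is `C¹` up to the boundary is differentiable at boundary points. -/
theorem IsDefiningFn.hasFDerivWithinAt_closure (h : IsDefiningFn 3 Ω x U r)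
    (hx : x ∈ frontier Ω) {v : E n → ℝ} {V : E n → E n →L[ℝ] ℝ} (hc : ContinuousOn v (closure Ω))
    (hd : ∀ y ∈ Ω, HasFDerivAt v (V y) y) (hV : ContinuousWithinAt V (closure Ω) x) :
    HasFDerivWithinAt v (V x) (closure Ω) x := by
  set G := gradient r x with hG
  have hG0 : 0 < ‖G‖ := norm_pos_iff.2 (h.gradient_ne_zero x h.mem)
  have hr0 : r x = 0 := (h.zero_iff x h.mem).1 hx
  obtain ⟨δ, hδ, hδU, happ⟩ := h.exists_ball (c := ‖G‖ / 8) (by positivity)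
  set N := ‖G‖⁻¹ • G with hN
  have hN1 : ‖N‖ = 1 := by rw [hN, norm_smul, norm_inv, norm_norm, inv_mul_cancel₀ hG0.ne']
  have hGN : inner ℝ G N = ‖G‖ := by
    rw [hN, inner_smul_right, real_inner_self_eq_norm_sq]; field_simp
  rw [hasFDerivWithinAt_iff_isLittleO, Asymptotics.isLittleO_iff]
  intro ε hε
  have hev := Metric.continuousWithinAt_iff.1 hV (ε / 5) (by positivity)
  obtain ⟨δ', hδ', hV'⟩ := hev
  set ρ := min δ δ' / 4 with hρ
  have hρ0 : 0 < ρ := by positivity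
  have hρδ : 4 * ρ ≤ δ := by rw [hρ]; linarith [min_le_left δ δ']
  have hρδ' : 4 * ρ ≤ δ' := by rw [hρ]; linarith [min_le_right δ δ']
  filter_upwards [inter_mem_nhdsWithin (closure Ω) (Metric.ball_mem_nhds x hρ0)] with y hy
  obtain ⟨hyc, hyb⟩ := hy
  set d := ‖y - x‖ with hdd
  have hdρ : d < ρ := by rwa [Metric.mem_ball, dist_eq_norm] at hyb
  rcases (norm_nonneg (y - x)).eq_or_lt' with h0 | hdpos
  · have : y = x := sub_eq_zero.1 (norm_eq_zero.1 h0)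
    subst this; simp only [sub_self, map_zero, norm_zero]; exact mul_nonneg hε.le (norm_nonneg _)
  change 0 < d at hdpos
  have hball : ∀ z, ‖z - x‖ ≤ 3 * d → z ∈ Metric.ball x δ := fun z hz => by
    rw [Metric.mem_ball, dist_eq_norm]; linarith
  have hxb : x ∈ Metric.ball x δ := Metric.mem_ball_self hδ
  have hyδ : y ∈ Metric.ball x δ := hball y (by linarith)
  have hry : 0 ≤ r y := h.nonneg_of_mem_closure (hδU hyδ) hyc
  have hmemΩ : ∀ z ∈ Metric.ball x δ, 0 < r z → z ∈ Ω := fun z hz hz' =>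
    (h.pos_iff z (hδU hz)).2 hz'
  -- points above `y`
  have hup : ∀ s, 0 < s → s ≤ 2 * d → y + s • N ∈ Ω ∧ ‖y + s • N - x‖ ≤ 3 * d := by
    intro s hs hs2
    have hn : ‖y + s • N - x‖ ≤ 3 * d := by
      calc ‖y + s • N - x‖ = ‖(y - x) + s • N‖ := by congr 1; abel
        _ ≤ d + ‖s • N‖ := norm_add_le _ _
        _ = d + s := by rw [norm_smul, hN1, mul_one, Real.norm_of_nonneg hs.le]
        _ ≤ _ := by linarith
    refine ⟨hmemΩ _ (hball _ hn) ?_, hn⟩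
    have := (abs_le.1 (happ y hyδ _ (hball _ hn))).1
    rw [add_sub_cancel_left, inner_smul_right, hGN, norm_smul, hN1, Real.norm_of_nonneg hs.le] at this
    nlinarith [mul_pos hs hG0]
  -- The segment from `x` to `y` may leave `Ω`. The detour through `z`, well inside, uses two
  -- segments with interior in `Ω`; their lengths are at most `3 d` and `2 d`, which explains `ε /
  -- 5`.
  set z := y + (2 * d) • N with hz
  have hzΩ := hup (2 * d) (by positivity) le_rfl
  have hzx : ‖z - x‖ ≤ 3 * d := hzΩ.2
  have hGz : d * ‖G‖ ≤ inner ℝ G (z - x) := by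
    have e : z - x = (y - x) + (2 * d) • N := by rw [hz]; abel
    rw [e, inner_add_right, inner_smul_right, hGN]
    have := (abs_le.1 (abs_real_inner_le_norm G (y - x))).1
    change -(‖G‖ * d) ≤ _ at this
    linarith
  have hcone : ∀ t ∈ Ioo (0 : ℝ) 1, x + t • (z - x) ∈ Ω ∧ ‖x + t • (z - x) - x‖ ≤ 3 * d := by
    intro t ht
    have hn : ‖x + t • (z - x) - x‖ ≤ 3 * d := by
      rw [add_sub_cancel_left, norm_smul, Real.norm_of_nonneg ht.1.le]
      nlinarith [ht.2, norm_nonneg (z - x), ht.1]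
    refine ⟨hmemΩ _ (hball _ hn) ?_, hn⟩
    have := (abs_le.1 (happ x hxb _ (hball _ hn))).1
    rw [add_sub_cancel_left, inner_smul_right, norm_smul, Real.norm_of_nonneg ht.1.le, hr0] at this
    have h1 : ‖G‖ / 8 * (t * ‖z - x‖) ≤ t * (3 / 8 * (d * ‖G‖)) := by
      have := mul_le_mul_of_nonneg_left hzx (show 0 ≤ ‖G‖ / 8 * t by have := ht.1; positivity)
      nlinarith
    have h2 := mul_le_mul_of_nonneg_left hGz ht.1.le
    have h3 : 0 < t * (d * ‖G‖) := by have := ht.1; positivity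
    linarith
  have hVb : ∀ w ∈ Ω, ‖w - x‖ ≤ 3 * d → ‖V w - V x‖ ≤ ε / 5 := by
    intro w hw hwx
    have := hV' (subset_closure hw) (by rw [dist_eq_norm]; linarith)
    rw [dist_eq_norm] at this
    exact this.le
  have hxc : x ∈ closure Ω := frontier_subset_closure hx
  have s1 := abs_sub_sub_le_of_segment (L := V x) (ε := ε / 5) hc hxc (subset_closure hzΩ.1)
    (fun t ht => (hcone t ht).1) hd (fun t ht => hVb _ (hcone t ht).1 (hcone t ht).2)
  have hyz : ∀ t ∈ Ioo (0 : ℝ) 1, y + t • (z - y) ∈ Ω ∧ ‖y + t • (z - y) - x‖ ≤ 3 * d := by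
    intro t ht
    have e : t • (z - y) = (t * (2 * d)) • N := by rw [hz, add_sub_cancel_left, smul_smul]
    rw [e]
    have := ht.1
    have := ht.2
    exact hup _ (by positivity) (by nlinarith)
  have s2 := abs_sub_sub_le_of_segment (L := V x) (ε := ε / 5) hc hyc (subset_closure hzΩ.1)
    (fun t ht => (hyz t ht).1) hd (fun t ht => hVb _ (hyz t ht).1 (hyz t ht).2)
  have hzy : ‖z - y‖ = 2 * d := by
    rw [hz, add_sub_cancel_left, norm_smul, hN1, mul_one, Real.norm_of_nonneg (by positivity)]
  have e1 : v y - v x - V x (y - x) =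
      (v z - v x - V x (z - x)) - (v z - v y - V x (z - y)) := by
    simp only [map_sub]; ring
  rw [e1, Real.norm_eq_abs]
  refine (abs_sub _ _).trans ((add_le_add s1 s2).trans ?_)
  rw [hzy]
  have := mul_le_mul_of_nonneg_left hzx (show 0 ≤ ε / 5 by positivity)
  change _ ≤ ε * d
  linarith

lemma IsDefiningFn.eventually_add_smul_mem (h : IsDefiningFn 3 Ω x U r) (hx : x ∈ frontier Ω)
    {w : E n} (hw : 0 < inner ℝ (gradient r x) w) :
    ∀ᶠ t in 𝓝[>] (0 : ℝ), x + t • w ∈ Ω := by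
  have hr0 : r x = 0 := (h.zero_iff x h.mem).1 hx
  have hw0 : 0 < ‖w‖ := norm_pos_iff.2 (by rintro rfl; simp at hw)
  obtain ⟨δ, hδ, hδU, happ⟩ := h.exists_ball
    (c := inner ℝ (gradient r x) w / (2 * ‖w‖)) (by positivity)
  have hlim : Tendsto (fun t : ℝ => x + t • w) (𝓝[>] 0) (𝓝 x) := by
    have : Continuous fun t : ℝ => x + t • w := by fun_prop
    simpa using (this.tendsto 0).mono_left nhdsWithin_le_nhds
  filter_upwards [hlim.eventually (Metric.ball_mem_nhds x hδ), self_mem_nhdsWithin] with t ht ht0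
  have ht0' : (0 : ℝ) < t := ht0
  refine (h.pos_iff _ (hδU ht)).2 ?_
  have := (abs_le.1 (happ x (Metric.mem_ball_self hδ) _ ht)).1
  rw [add_sub_cancel_left, inner_smul_right, norm_smul, Real.norm_of_nonneg ht0'.le, hr0] at this
  have e : inner ℝ (gradient r x) w / (2 * ‖w‖) * (t * ‖w‖) =
    t * inner ℝ (gradient r x) w / 2 := by field_simp
  rw [e] at this
  have := mul_pos ht0' hw
  linarith

/-- The sign of the derivative in an inward direction at a boundary minimum. -/
lemma IsDefiningFn.fderivWithin_apply_nonneg (h : IsDefiningFn 3 Ω x U r) (hx : x ∈ frontier Ω)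
    {Ψ : E n → ℝ} {L : E n →L[ℝ] ℝ} (hΨ : HasFDerivWithinAt Ψ L (closure Ω) x) (h0 : Ψ x = 0)
    (hpos : ∀ᶠ y in 𝓝[Ω] x, 0 ≤ Ψ y) {w : E n} (hw : 0 < inner ℝ (gradient r x) w) :
    0 ≤ L w := by
  have hl : HasDerivWithinAt (fun t : ℝ => x + t • w) w (Ioi 0) 0 := by
    simpa using (((hasDerivAt_id (0 : ℝ)).smul_const w).const_add x).hasDerivWithinAt
  have hmem := h.eventually_add_smul_mem hx hw
  have hcont : Tendsto (fun t : ℝ => x + t • w) (𝓝[>] 0) (𝓝 x) := by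
    have : Continuous fun t : ℝ => x + t • w := by fun_prop
    simpa using (this.tendsto 0).mono_left nhdsWithin_le_nhds
  have hΩlim : Tendsto (fun t : ℝ => x + t • w) (𝓝[>] 0) (𝓝[Ω] x) :=
    tendsto_nhdsWithin_iff.2 ⟨hcont, hmem⟩
  obtain ⟨s, hs, hsub⟩ := mem_nhdsWithin_iff_exists_mem_nhds_inter.1 hmem
  have hl2 : HasDerivWithinAt (fun t : ℝ => x + t • w) w (s ∩ Ioi 0) 0 := hl.mono inter_subset_right
  have hΨ' : HasFDerivWithinAt Ψ L (closure Ω) (x + (0 : ℝ) • w) := by simpa using hΨ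
  have hcomp := hΨ'.comp_hasDerivWithinAt (0 : ℝ) hl2 fun t ht => subset_closure (hsub ht)
  rw [hasDerivWithinAt_iff_tendsto_slope' (fun h => lt_irrefl (0 : ℝ) h.2)] at hcomp
  have hnb : 𝓝[s ∩ Ioi 0] (0 : ℝ) = 𝓝[>] 0 := by
    exact nhdsWithin_inter_of_mem (mem_nhdsWithin_of_mem_nhds hs)
  rw [hnb] at hcomp
  refine ge_of_tendsto hcomp ?_
  filter_upwards [hΩlim.eventually hpos, self_mem_nhdsWithin] with t ht ht0
  have ht0' : (0 : ℝ) < t := ht0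
  simp only [slope_def_field, Function.comp_apply, zero_smul, add_zero, h0, sub_zero]
  positivity

/-- The interior normal direction does not depend on the defining function. -/
lemma IsDefiningFn.exists_gradient_eq_smul {U' : Set (E n)} {r' : E n → ℝ}
    (h : IsDefiningFn 3 Ω x U r) (h' : IsDefiningFn 3 Ω x U' r') (hx : x ∈ frontier Ω) :
    ∃ c : ℝ, 0 < c ∧ gradient r' x = c • gradient r x := by
  set G := gradient r x
  set G' := gradient r' x
  have hG0 : 0 < ‖G‖ := norm_pos_iff.2 (h.gradient_ne_zero x h.mem)
  have hr0 : r' x = 0 := (h'.zero_iff x h'.mem).1 hx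
  have hd : HasFDerivAt r' (fderiv ℝ r' x) x :=
    ((h'.contDiffAt h'.mem).differentiableAt (by simp)).hasFDerivAt
  -- As `r'` is nonnegative on `Ω`, the functional `⟨G', ·⟩` is nonnegative on the open half-space
  -- of inward directions of `r`. This forces `G'` to be a multiple of `G`.
  have key : ∀ w, 0 < inner ℝ G w → 0 ≤ inner ℝ G' w := by
    intro w hw
    rw [← fderiv_apply_eq_inner_gradient]
    refine h.fderivWithin_apply_nonneg hx hd.hasFDerivWithinAt hr0 ?_ hw
    filter_upwards [self_mem_nhdsWithin, mem_nhdsWithin_of_mem_nhds (h'.isOpen.mem_nhds h'.mem)]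
      with y hy hyU
    exact ((h'.pos_iff y hyU).1 hy).le
  set c := inner ℝ G G' / ‖G‖ ^ 2 with hc
  set P := G' - c • G with hP
  have hGP : inner ℝ G P = 0 := by
    rw [hP, inner_sub_right, inner_smul_right, real_inner_self_eq_norm_sq, hc]; field_simp; ring
  have hG'P : inner ℝ G' P = ‖P‖ ^ 2 := by
    have e : G' = P + c • G := by rw [hP]; abel
    conv_lhs => rw [e]
    rw [inner_add_left, inner_smul_left, hGP, real_inner_self_eq_norm_sq]; simp
  have hP0 : ‖P‖ ^ 2 ≤ 0 := by
    by_contra! hcon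
    by_cases hle : inner ℝ G' G ≤ 0
    · have := key (G - P) (by rw [inner_sub_right, hGP, real_inner_self_eq_norm_sq, sub_zero]; positivity)
      rw [inner_sub_right, hG'P] at this
      linarith
    · push Not at hle
      have := key ((‖P‖ ^ 2 / (2 * inner ℝ G' G)) • G - P) (by
        rw [inner_sub_right, hGP, inner_smul_right, real_inner_self_eq_norm_sq, sub_zero]
        exact mul_pos (div_pos hcon (by positivity)) (by positivity))
      rw [inner_sub_right, hG'P, inner_smul_right] at this
      have e : ‖P‖ ^ 2 / (2 * inner ℝ G' G) * inner ℝ G' G = ‖P‖ ^ 2 / 2 := by field_simp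
      rw [e] at this
      linarith
  have hPz : P = 0 := by
    have : ‖P‖ = 0 := by nlinarith [norm_nonneg P]
    exact norm_eq_zero.1 this
  have hG' : G' = c • G := sub_eq_zero.1 hPz
  refine ⟨c, ?_, hG'⟩
  have h1 := key G (by rw [real_inner_self_eq_norm_sq]; positivity)
  have hc0 : 0 ≤ c := by rw [hc, real_inner_comm]; positivity
  refine lt_of_le_of_ne hc0 fun h0 => h'.gradient_ne_zero x h'.mem ?_
  change G' = 0
  rw [hG', ← h0, zero_smul]

/-- A function vanishing to second order along the boundary has vanishing tangential
derivative. -/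
theorem IsDefiningFn.fderivWithin_apply_eq_zero (h : IsDefiningFn 3 Ω x U r)
    (hx : x ∈ frontier Ω) {v : E n → ℝ} {L : E n →L[ℝ] ℝ}
    (hv : HasFDerivWithinAt v L (closure Ω) x) {C : ℝ}
    (hC : ∀ᶠ y in 𝓝[frontier Ω] x, |v y| ≤ C * ‖y - x‖ ^ 2) {η : E n}
    (hη : inner ℝ (gradient r x) η = 0) : L η = 0 := by
  have hr0 : r x = 0 := (h.zero_iff x h.mem).1 hx
  have hs : HasStrictFDerivAt r (fderiv ℝ r x) x :=
    (h.contDiffAt h.mem).hasStrictFDerivAt (by simp)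
  have hrange : (fderiv ℝ r x).range = ⊤ := by
    refine LinearMap.range_eq_top.2 (LinearMap.surjective fun h0 => h.gradient_ne_zero x h.mem ?_)
    have : fderiv ℝ r x = 0 := by ext v; exact congrArg (fun L => L v) h0
    rw [gradient, this, map_zero]
  have hker : η ∈ (fderiv ℝ r x).ker := by
    rw [LinearMap.mem_ker]
    exact (fderiv_apply_eq_inner_gradient r x η).trans hη
  -- The implicit function theorem provides a curve inside `∂Ω` through `x` with velocity `η`; along
  -- it `v` is `O(t²)`.
  let φ := hs.implicitFunction r (fderiv ℝ r x) hrange (r x)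
  let e : (fderiv ℝ r x).ker := ⟨η, hker⟩
  let γ : ℝ → E n := fun t => φ (t • e)
  have hφ0 : φ 0 = x := hs.implicitFunction_apply_image hrange
  have hγ0 : γ 0 = x := by simp [γ, hφ0]
  have hlin : HasDerivAt (fun t : ℝ => t • e) e 0 := by
    simpa using (hasDerivAt_id (0 : ℝ)).smul_const e
  have hγ : HasDerivAt γ η 0 := by
    have h1 := (hs.to_implicitFunction hrange).hasFDerivAt
    have h2 : HasFDerivAt φ (fderiv ℝ r x).ker.subtypeL ((0 : ℝ) • e) := by simpa using h1
    exact h2.comp_hasDerivAt (0 : ℝ) hlin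
  have hγfr : ∀ᶠ t in 𝓝 (0 : ℝ), γ t ∈ frontier Ω := by
    have h1 := hs.map_implicitFunction_eq hrange
    have h2 : Tendsto (fun t : ℝ => (r x, t • e)) (𝓝 0) (𝓝 (r x, 0)) := by
      refine tendsto_const_nhds.prodMk_nhds ?_
      simpa using hlin.continuousAt.tendsto
    have h3 : Tendsto γ (𝓝 0) (𝓝 x) := by simpa [hγ0] using hγ.continuousAt.tendsto
    filter_upwards [h2.eventually h1, h3.eventually (h.isOpen.mem_nhds h.mem)] with t ht htU
    exact (h.zero_iff _ htU).2 (ht.trans hr0)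
  have hvx : v x = 0 := by
    have := hC.self_of_nhdsWithin hx
    simpa using this
  obtain ⟨s, hs', hsub⟩ := eventually_iff_exists_mem.1 hγfr
  have hv' : HasFDerivWithinAt v L (closure Ω) (γ 0) := by rwa [hγ0]
  have hcomp : HasDerivAt (v ∘ γ) (L η) 0 :=
    (hv'.comp_hasDerivWithinAt (0 : ℝ) (hγ.hasDerivWithinAt (s := s))
      fun t ht => frontier_subset_closure (hsub t ht)).hasDerivAt hs'
  refine hcomp.unique ?_
  have hbig : (v ∘ γ) =O[𝓝 0] fun t : ℝ => t ^ 2 := by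
    have h1 : (fun t => γ t - x) =O[𝓝 0] fun t : ℝ => t := by
      have := hγ.differentiableAt.isBigO_sub
      simpa [hγ0] using this
    have h2 := (h1.norm_left.pow 2)
    refine Asymptotics.IsBigO.trans (Asymptotics.IsBigO.of_bound C ?_) h2
    have h3 : Tendsto γ (𝓝 0) (𝓝[frontier Ω] x) := tendsto_nhdsWithin_iff.2
      ⟨by simpa [hγ0] using hγ.continuousAt.tendsto, hγfr⟩
    filter_upwards [h3.eventually hC] with t ht
    simpa using ht
  rw [hasDerivAt_iff_isLittleO]
  simp only [Function.comp_apply, hγ0, hvx, sub_zero, smul_zero]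
  refine hbig.trans_isLittleO ?_
  exact Asymptotics.isLittleO_pow_id one_lt_two

end BoundaryCalculus

end KHess

end

noncomputable section

set_option maxSynthPendingDepth 3

namespace KHess

open Set Filter Topology

/-! ### Extension of derivatives to the closure. -/

section Extension

variable {n : ℕ} {Ω : Set (E n)}

/-- `p` and `H` are the continuous extensions to `Ω̄` of `Du` and `D²u`. -/
structure IsC2Ext (Ω : Set (E n)) (u : E n → ℝ) (p : E n → E n →L[ℝ] ℝ) (H : E n → Bil n) :
    Prop where
  cont : ContinuousOn u (closure Ω)
  cont_p : ContinuousOn p (closure Ω)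
  cont_H : ContinuousOn H (closure Ω)
  eq_p : ∀ x ∈ Ω, p x = fderiv ℝ u x
  eq_H : ∀ x ∈ Ω, H x = hessForm u x

lemma MemC.exists_isC2Ext {m : ℕ} (hm : 2 ≤ m) {u : E n → ℝ} (hu : MemC m Ω u) :
    ∃ p H, IsC2Ext Ω u p H := by
  obtain ⟨F₁, hF₁, hF₁'⟩ := hu.2.2 1 (by omega)
  obtain ⟨F₂, hF₂, hF₂'⟩ := hu.2.2 2 hm
  let c₁ := (continuousMultilinearCurryFin1 ℝ (E n) ℝ)
  let c₂ := (continuousMultilinearCurryLeftEquiv ℝ (fun _ : Fin 2 => E n) ℝ)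
  refine ⟨fun x => c₁ (F₁ x),
    fun x => (c₁.toContinuousLinearEquiv : _ →L[ℝ] _).comp (c₂ (F₂ x)), hu.2.1,
    c₁.continuous.comp_continuousOn hF₁,
    continuousOn_const.clm_comp (c₂.continuous.comp_continuousOn hF₂), fun x hx => ?_,
    fun x hx => ?_⟩
  · ext v
    rw [hF₁' hx]
    simp [c₁]
  · ext v w
    rw [hF₂' hx]
    simp [c₁, c₂, iteratedFDeriv_two_apply]

lemma IsC2Ext.secondDeriv_eq {u : E n → ℝ} {p H} (h : IsC2Ext Ω u p H) (hu : MemC 2 Ω u)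
    {x : E n} (hx : x ∈ closure Ω) (v w : E n) : secondDeriv Ω u x v w = H x v w := by
  obtain ⟨F, hF, hF'⟩ := hu.2.2 2 le_rfl
  have hne : (𝓝[Ω] x).NeBot := mem_closure_iff_nhdsWithin_neBot.1 hx
  have hlim : Tendsto F (𝓝[Ω] x) (𝓝 (F x)) := (hF x hx).mono_left (nhdsWithin_mono _ subset_closure)
  have hlim2 : Tendsto (iteratedFDeriv ℝ 2 u) (𝓝[Ω] x) (𝓝 (F x)) :=
    hlim.congr' (by filter_upwards [self_mem_nhdsWithin] with y hy using hF' hy)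
  rw [secondDeriv, extendFrom_eq hx hlim2]
  have h1 : Tendsto (fun y => F y ![v, w]) (𝓝[Ω] x) (𝓝 (F x ![v, w])) :=
    ((ContinuousMultilinearMap.apply ℝ (fun _ : Fin 2 => E n) ℝ ![v, w]).continuous.tendsto
      (F x)).comp hlim
  have h2 : Tendsto (fun y => H y v w) (𝓝[Ω] x) (𝓝 (H x v w)) := by
    have h3 : Tendsto H (𝓝[Ω] x) (𝓝 (H x)) :=
      (h.cont_H x hx).mono_left (nhdsWithin_mono _ subset_closure)
    have h4 : Continuous fun B : Bil n => B v w := by fun_prop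
    exact (h4.tendsto _).comp h3
  refine tendsto_nhds_unique h1 (h2.congr' ?_)
  filter_upwards [self_mem_nhdsWithin] with y hy
  rw [hF' hy, h.eq_H y hy, iteratedFDeriv_two_apply]
  rfl

lemma norm_le_on_closure {F : Type*} [NormedAddCommGroup F] {G : E n → F} {C : ℝ}
    (hG : ContinuousOn G (closure Ω)) (h : ∀ x ∈ Ω, ‖G x‖ ≤ C) : ∀ x ∈ closure Ω, ‖G x‖ ≤ C :=
  fun _ hx => le_on_closure (s := Ω) h hG.norm continuousOn_const hx

end Extension

/-! ### Hessians of linear combinations and of squared distances. -/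

section HessianRules

variable {n : ℕ} {x : E n}

lemma fderiv_lincomb {u v : E n → ℝ} (hu : DifferentiableAt ℝ u x) (hv : DifferentiableAt ℝ v x)
    (a b : ℝ) : fderiv ℝ (fun y => a * u y + b * v y) x = a • fderiv ℝ u x + b • fderiv ℝ v x :=
  ((hu.hasFDerivAt.const_mul a).add (hv.hasFDerivAt.const_mul b)).fderiv

lemma hessForm_lincomb {u v : E n → ℝ} (hu : ContDiffAt ℝ 2 u x) (hv : ContDiffAt ℝ 2 v x)
    (a b : ℝ) : hessForm (fun y => a * u y + b * v y) x = a • hessForm u x + b • hessForm v x := by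
  have hev : fderiv ℝ (fun y => a * u y + b * v y) =ᶠ[𝓝 x]
      fun y => a • fderiv ℝ u y + b • fderiv ℝ v y := by
    filter_upwards [hu.eventually (by simp), hv.eventually (by simp)] with y h1 h2
    exact fderiv_lincomb (h1.differentiableAt (by simp)) (h2.differentiableAt (by simp)) a b
  have h1 := ((ContDiffAt.fderiv_two (m := 1) hu).differentiableAt (by simp)).hasFDerivAt
  have h2 := ((ContDiffAt.fderiv_two (m := 1) hv).differentiableAt (by simp)).hasFDerivAt
  rw [hessForm, hev.fderiv_eq]
  exact ((h1.const_smul a).add (h2.const_smul b)).fderiv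

lemma hessForm_congr {u v : E n → ℝ} (h : u =ᶠ[𝓝 x] v) : hessForm u x = hessForm v x :=
  h.fderiv.fderiv_eq

lemma contDiff_norm_sub_sq (P : E n) {m : WithTop ℕ∞} : ContDiff ℝ m fun y : E n => ‖y - P‖ ^ 2 :=
  (contDiff_id.sub contDiff_const).norm_sq ℝ

lemma fderiv_norm_sub_sq (P y : E n) :
    fderiv ℝ (fun y : E n => ‖y - P‖ ^ 2) y = (2 : ℝ) • innerSL ℝ (y - P) := by
  have h := ((hasFDerivAt_id y).sub_const P).norm_sq
  rw [show (fun y : E n => ‖y - P‖ ^ 2) = fun y => ‖id y - P‖ ^ 2 from rfl, h.fderiv]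
  ext v
  simp

/-- The Euclidean inner product as a bilinear form. -/
def Bil.id (n : ℕ) : Bil n := innerSL ℝ

@[simp] lemma Bil.id_apply (v w : E n) : Bil.id n v w = inner ℝ v w := rfl

lemma hessForm_norm_sub_sq (P : E n) :
    hessForm (fun y : E n => ‖y - P‖ ^ 2) x = (2 : ℝ) • Bil.id n := by
  have : fderiv ℝ (fun y : E n => ‖y - P‖ ^ 2) = fun y => (2 : ℝ) • innerSL ℝ (y - P) :=
    funext fun y => fderiv_norm_sub_sq P y
  rw [hessForm, this]
  have h : HasFDerivAt (fun y : E n => (innerSL ℝ) (y - P)) (Bil.id n) x := by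
    have := (Bil.id n).hasFDerivAt (x := x - P)
    exact this.comp x ((hasFDerivAt_id x).sub_const P)
  exact (h.const_smul (2 : ℝ)).fderiv

lemma hessForm_const (c : ℝ) : hessForm (fun _ : E n => c) x = 0 := by
  have : fderiv ℝ (fun _ : E n => c) = fun _ => 0 := by ext; simp
  rw [hessForm, this]
  simp

end HessianRules

/-! ### Sup bound and reduction of the gradient bound to the boundary. -/

section Data

variable {n k : ℕ} {Ω : Set (E n)} {M : ℝ} {f u Φ : E n → ℝ}

/-- The data of the Dirichlet problem, with all the given bounds combined into `M`. -/
structure IsDatum (k : ℕ) (Ω : Set (E n)) (M : ℝ) (f u Φ : E n → ℝ) : Prop where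
  memC_u : MemC 3 Ω u
  memC_Φ : MemC 3 Ω Φ
  admissible : ∀ x ∈ Ω, eigenvalues (hessian u x) ∈ gardingCone k
  equation : ∀ x ∈ Ω, sigma k (hessian u x) = f x
  boundary : ∀ x ∈ frontier Ω, u x = Φ x
  one_le : 1 ≤ M
  Φ_le : ∀ x ∈ Ω, |Φ x| ≤ M
  fderiv_Φ_le : ∀ x ∈ Ω, ‖fderiv ℝ Φ x‖ ≤ M
  hessForm_Φ_le : ∀ x ∈ Ω, ‖hessForm Φ x‖ ≤ M
  third_Φ_le : ∀ x ∈ Ω, ‖fderiv ℝ (hessForm Φ) x‖ ≤ M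
  f_pos : ∀ x ∈ Ω, 0 < f x
  f_le : ∀ x ∈ Ω, f x ≤ M
  fderiv_f_le : ∀ x ∈ Ω, ‖fderiv ℝ f x‖ ^ (k - 1) ≤ M * f x ^ (k - 2)

lemma MemC.contDiffAt {m : ℕ} (hΩ : IsOpen Ω) (hu : MemC m Ω u) {x : E n} (hx : x ∈ Ω) :
    ContDiffAt ℝ m u x := hu.1.contDiffAt (hΩ.mem_nhds hx)

lemma IsLinearization.abs_sum_le {A : Bil n} {q g} (h : IsLinearization k A q g) {B : Bil n}
    {C : ℝ} (hB : ‖B‖ ≤ C) : |∑ i, g i * B (q i) (q i)| ≤ C * ∑ i, g i := by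
  rw [Finset.mul_sum]
  refine (Finset.abs_sum_le_sum_abs _ _).trans (Finset.sum_le_sum fun i _ => ?_)
  rw [abs_mul, abs_of_pos (h.pos i), mul_comm]
  refine mul_le_mul_of_nonneg_right ?_ (h.pos i).le
  have := B.le_opNorm₂ (q i) (q i)
  rw [q.orthonormal.1 i, mul_one, mul_one] at this
  exact this.trans hB

lemma IsLinearization.sum_id {A : Bil n} {q g} (_ : IsLinearization k A q g) :
    ∑ i, g i * Bil.id n (q i) (q i) = ∑ i, g i := by
  refine Finset.sum_congr rfl fun i _ => ?_
  rw [Bil.id_apply, real_inner_self_eq_norm_sq, q.orthonormal.1 i]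
  norm_num

lemma IsLinearization.trace_pos {A : Bil n} {q g} (h : IsLinearization k A q g) (hn : 0 < n) :
    0 < ∑ i, g i :=
  Finset.sum_pos (fun i _ => h.pos i) ⟨⟨0, hn⟩, Finset.mem_univ _⟩

/-- The linearized equation, with the bounds of its right-hand sides by the trace. -/
theorem IsDatum.exists_linearization (h : IsDatum k Ω M f u Φ) (hk : 2 ≤ k) (hkn : k ≤ n)
    (hΩ : IsOpen Ω) {x : E n} (hx : x ∈ Ω) :
    ∃ q g, IsLinearization k (hessForm u x) q g ∧
      0 < ∑ i, g i * hessForm u x (q i) (q i) ∧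
      ∑ i, g i * hessForm u x (q i) (q i) ≤ k * M * ∑ i, g i ∧
      ∀ (a : E n) (W : E n →L[ℝ] E n), IsSkew W → 1 ≤ ‖hessForm u x‖ →
        |∑ i, g i * hessForm (alongField u a W) x (q i) (q i)| ≤ M * ‖a + W x‖ * ∑ i, g i := by
  obtain ⟨q, g, hlin, hsig, hf⟩ := exists_linearizedEquation hk hkn hΩ
    (fun y hy => h.memC_u.contDiffAt hΩ hy) h.admissible h.equation hx
  have hT := hlin.trace_pos (by omega)
  set T := ∑ i, g i with hTdef
  have hM := h.one_le
  have hf0 := h.f_pos x hx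
  -- Roots may be taken without spoiling the constant because `M ≥ 1`.
  have hpow : ∀ {m : ℕ} {a : ℝ}, m ≠ 0 → 0 ≤ a → a ^ m ≤ M * T ^ m → a ≤ M * T := by
    intro m a hm ha hle
    refine (pow_le_pow_iff_left₀ ha (by positivity) hm).1 (hle.trans ?_)
    rw [mul_pow]
    exact mul_le_mul_of_nonneg_right (le_self_pow₀ hM hm) (by positivity)
  have hfT : f x ≤ M * T := by
    refine hpow (m := k) (by omega) hf0.le ?_
    have h1 := hlin.trace_ge
    rw [hsig] at h1
    calc f x ^ k = f x * f x ^ (k - 1) := by rw [← pow_succ']; congr 1; omega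
      _ ≤ M * T ^ k := mul_le_mul (h.f_le x hx) h1 (by positivity) (by positivity)
  refine ⟨q, g, hlin, ?_, ?_, fun a W hW hH => ?_⟩
  · rw [hlin.euler, hsig]
    have : (0 : ℝ) < k := by exact_mod_cast (by omega : 0 < k)
    positivity
  · rw [hlin.euler, hsig, mul_assoc]
    exact mul_le_mul_of_nonneg_left hfT (by positivity)
  · rw [hf a W hW]
    -- The chain is `|Df|^(k-1) ≤ M f^(k-2) ≤ M ‖D²u‖ f^(k-2) ≤ M T^(k-1)`; the middle step is where
    -- a Hessian of norm at least `1` is required.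
    have hdf : ‖fderiv ℝ f x‖ ≤ M * T := by
      refine hpow (m := k - 1) (by omega) (norm_nonneg _) ((h.fderiv_f_le x hx).trans ?_)
      refine mul_le_mul_of_nonneg_left ?_ (by positivity)
      have h2 := hlin.trace_ge_norm
      rw [hsig] at h2
      exact (le_mul_of_one_le_left (by positivity) hH).trans h2
    calc |fderiv ℝ f x (a + W x)| ≤ ‖fderiv ℝ f x‖ * ‖a + W x‖ :=
          (fderiv ℝ f x).le_opNorm _
      _ ≤ M * T * ‖a + W x‖ := mul_le_mul_of_nonneg_right hdf (norm_nonneg _)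
      _ = _ := by ring

/-- The bound for `|u|`. -/
theorem exists_abs_le (hk : 2 ≤ k) (hkn : k ≤ n) (hΩ : IsOpen Ω) (hb : Bornology.IsBounded Ω)
    (M : ℝ) : ∃ C, ∀ f u Φ, IsDatum k Ω M f u Φ → ∀ x ∈ closure Ω, |u x| ≤ C := by
  obtain ⟨R, hR⟩ := hb.closure.subset_closedBall (0 : E n)
  refine ⟨M + k * M * R ^ 2, fun f u Φ h => ?_⟩
  have hM : 0 < M := lt_of_lt_of_le one_pos h.one_le
  have hk0 : (0 : ℝ) < k := by exact_mod_cast (by omega : 0 < k)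
  have hΦ : ∀ x ∈ closure Ω, |Φ x| ≤ M := norm_le_on_closure h.memC_Φ.2.1 h.Φ_le
  have hu2 : ∀ x ∈ Ω, ContDiffAt ℝ 2 u x :=
    fun x hx => (h.memC_u.contDiffAt hΩ hx).of_le (by norm_cast)
  have hnorm : ∀ x ∈ closure Ω, ‖x - 0‖ ^ 2 ≤ R ^ 2 := fun x hx => by
    have := hR hx
    rw [mem_closedBall_zero_iff] at this
    rw [sub_zero]
    exact pow_le_pow_left₀ (norm_nonneg _) this 2
  have hup : ∀ x ∈ closure Ω, 0 ≤ (-1) * u x + M * 1 := by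
    refine nonneg_of_exists_hessForm_neg hΩ hb
      ((continuousOn_const.mul h.memC_u.2.1).add continuousOn_const)
      (fun x hx => (contDiffAt_const.mul (hu2 x hx)).add contDiffAt_const) (fun x hx => ?_)
      (fun x hx _ => ?_)
    · rw [h.boundary x hx]
      linarith [(abs_le.1 (hΦ x (frontier_subset_closure hx))).2]
    · obtain ⟨q, g, hlin, h1, -, -⟩ := h.exists_linearization hk hkn hΩ hx
      refine exists_hessForm_neg_of_sum_neg (q := q) hlin.pos ?_
      rw [hessForm_lincomb (v := fun _ => 1) (hu2 x hx) contDiffAt_const, hessForm_const]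
      simpa using h1
  -- The quadratic contributes `-2 k M T` to the linearized operator and so beats `L u ≤ k M T`.
  have hlow : ∀ x ∈ closure Ω, 0 ≤ 1 * (1 * u x + (-(k * M)) * ‖x - 0‖ ^ 2) +
      (M + k * M * R ^ 2) * 1 := by
    have hc2 : ∀ x ∈ Ω, ContDiffAt ℝ 2 (fun x => 1 * u x + (-(k * M)) * ‖x - 0‖ ^ 2) x :=
      fun x hx => (contDiffAt_const.mul (hu2 x hx)).add
        (contDiffAt_const.mul (contDiff_norm_sub_sq 0).contDiffAt)
    refine nonneg_of_exists_hessForm_neg hΩ hb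
      ((continuousOn_const.mul ((continuousOn_const.mul h.memC_u.2.1).add
        (continuousOn_const.mul (contDiff_norm_sub_sq (m := 0) 0).continuous.continuousOn))).add
          continuousOn_const)
      (fun x hx => (contDiffAt_const.mul (hc2 x hx)).add contDiffAt_const) (fun x hx => ?_)
      (fun x hx _ => ?_)
    · rw [h.boundary x hx]
      have h1 := hnorm x (frontier_subset_closure hx)
      have h2 := (abs_le.1 (hΦ x (frontier_subset_closure hx))).1
      have h3 := mul_le_mul_of_nonneg_left h1 (mul_pos hk0 hM).le
      linarith
    · obtain ⟨q, g, hlin, -, h1, -⟩ := h.exists_linearization hk hkn hΩ hx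
      have hT := hlin.trace_pos (by omega)
      refine exists_hessForm_neg_of_sum_neg (q := q) hlin.pos ?_
      rw [hessForm_lincomb (v := fun _ => 1) (hc2 x hx) contDiffAt_const, hessForm_const,
        hessForm_lincomb (hu2 x hx) (contDiff_norm_sub_sq 0).contDiffAt, hessForm_norm_sub_sq]
      have e : ∑ i, g i * ((1 : ℝ) • ((1 : ℝ) • hessForm u x + (-(k * M)) • (2 : ℝ) • Bil.id n) +
          (M + k * M * R ^ 2) • (0 : Bil n)) (q i) (q i) =
          ∑ i, g i * hessForm u x (q i) (q i) - 2 * (k * M) * ∑ i, g i := by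
        rw [← hlin.sum_id, Finset.mul_sum, ← Finset.sum_sub_distrib]
        refine Finset.sum_congr rfl fun i _ => ?_
        simp only [one_smul, smul_zero, add_zero, _root_.add_apply, _root_.smul_apply, smul_eq_mul]
        ring
      rw [e]
      have := mul_pos (mul_pos hk0 hM) hT
      linarith
  intro x hx
  have h1 := hup x hx
  have h2 := hlow x hx
  have h3 : 0 ≤ k * M * ‖x - 0‖ ^ 2 := by positivity
  have h4 : 0 ≤ k * M * R ^ 2 := by positivity
  rw [abs_le]
  constructor <;> linarith

/-- The interior gradient bound, in terms of the gradient on the boundary. -/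
theorem exists_gradient_le (hk : 2 ≤ k) (hkn : k ≤ n) (hΩ : IsOpen Ω)
    (hb : Bornology.IsBounded Ω) (M C₁ : ℝ) :
    ∃ C, ∀ f u Φ, IsDatum k Ω M f u Φ → ∀ p H, IsC2Ext Ω u p H →
      (∀ x ∈ frontier Ω, ‖p x‖ ≤ C₁) → ∀ x ∈ closure Ω, ‖p x‖ ≤ C := by
  obtain ⟨R, hR0, hR⟩ := hb.closure.subset_closedBall_lt 0 (0 : E n)
  obtain ⟨e₀, he₀⟩ : ∃ e : E n, ‖e‖ = 1 := ⟨EuclideanSpace.single ⟨0, by omega⟩ 1, by simp⟩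
  -- The pole lies at distance at least `1` from the domain, so that the gradient of `|x - P|²` has
  -- norm at least `2` there.
  set P : E n := (R + 1) • e₀ with hP
  have hPn : ‖P‖ = R + 1 := by rw [hP, norm_smul, he₀, mul_one, Real.norm_of_nonneg (by positivity)]
  have hlow : ∀ x ∈ closure Ω, 1 ≤ ‖x - P‖ := fun x hx => by
    have h1 := hR hx
    rw [mem_closedBall_zero_iff] at h1
    have h2 := norm_sub_norm_le P x
    rw [norm_sub_rev] at h2
    linarith
  have hupp : ∀ x ∈ closure Ω, ‖x - P‖ ^ 2 ≤ (2 * R + 1) ^ 2 := fun x hx => by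
    have h1 := hR hx
    rw [mem_closedBall_zero_iff] at h1
    have h2 := norm_sub_le x P
    exact pow_le_pow_left₀ (norm_nonneg _) (by linarith) 2
  refine ⟨|C₁| + M * (2 * R + 1) ^ 2, fun f u Φ h p H hp hC₁ => ?_⟩
  have hM : 0 < M := lt_of_lt_of_le one_pos h.one_le
  have hu3 : ∀ x ∈ Ω, ContDiffAt ℝ 3 u x := fun x hx => h.memC_u.contDiffAt hΩ hx
  have key : ∀ (s : ℝ) (e : E n), |s| = 1 → ‖e‖ = 1 → ∀ x ∈ closure Ω,
      0 ≤ 1 * (s * p x e + (-M) * ‖x - P‖ ^ 2) + (|C₁| + M * (2 * R + 1) ^ 2) * 1 := by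
    intro s e hs he
    have hpe : ∀ x ∈ Ω, (fun y => p y e) =ᶠ[𝓝 x] alongField u e 0 := fun x hx => by
      filter_upwards [hΩ.mem_nhds hx] with y hy
      rw [hp.eq_p y hy]; simp [alongField]
    have hpc : ∀ x ∈ Ω, ContDiffAt ℝ 2 (fun y => p y e) x := fun x hx =>
      (contDiffAt_alongField (m := 2) (hu3 x hx) e 0).congr_of_eventuallyEq (hpe x hx)
    have hc2 : ∀ x ∈ Ω, ContDiffAt ℝ 2 (fun x => s * p x e + (-M) * ‖x - P‖ ^ 2) x :=
      fun x hx => (contDiffAt_const.mul (hpc x hx)).add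
        (contDiffAt_const.mul (contDiff_norm_sub_sq P).contDiffAt)
    refine nonneg_of_exists_hessForm_neg hΩ hb
      ((continuousOn_const.mul ((continuousOn_const.mul (hp.cont_p.clm_apply
        continuousOn_const)).add (continuousOn_const.mul
          (contDiff_norm_sub_sq (m := 0) P).continuous.continuousOn))).add continuousOn_const)
      (fun x hx => (contDiffAt_const.mul (hc2 x hx)).add contDiffAt_const) (fun x hx => ?_)
      (fun x hx hcrit => ?_)
    · have h1 := hupp x (frontier_subset_closure hx)
      have h2 : |s * p x e| ≤ |C₁| := by
        rw [abs_mul, hs, one_mul]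
        refine ((p x).le_opNorm e).trans ?_
        rw [he, mul_one]
        exact (hC₁ x hx).trans (le_abs_self _)
      have h3 := mul_le_mul_of_nonneg_left h1 hM.le
      linarith [(abs_le.1 h2).1]
    · obtain ⟨q, g, hlin, -, -, h1⟩ := h.exists_linearization hk hkn hΩ hx
      have hT := hlin.trace_pos (by omega)
      have hu2 := (hu3 x hx).of_le (m := 2) (by norm_cast)
      rw [fderiv_lincomb (v := fun _ => 1) ((hc2 x hx).differentiableAt (by simp))
        (differentiableAt_const _), fderiv_lincomb ((hpc x hx).differentiableAt (by simp))
        ((contDiff_norm_sub_sq (m := 1) P).contDiffAt.differentiableAt (by simp)),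
        fderiv_norm_sub_sq, (hpe x hx).fderiv_eq, (hasFDerivAt_alongField hu2 e 0).fderiv] at hcrit
      -- At a critical point `D²u(·, e)` equals `± 2 M (x - P)`, so the Hessian has norm at least `2
      -- M ≥ 1` and the bound for `|Df|` applies.
      have hH : 1 ≤ ‖hessForm u x‖ := by
        have h2 := congrArg (fun L => L (x - P)) hcrit
        simp only [one_smul, fderiv_fun_const, Pi.zero_apply, smul_zero, add_zero,
          ContinuousLinearMap.comp_zero, _root_.add_apply, _root_.smul_apply,
          ContinuousLinearMap.flip_apply, _root_.zero_apply, innerSL_apply_apply,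
          real_inner_self_eq_norm_sq, smul_eq_mul] at h2
        have h3 : M * (2 * ‖x - P‖ ^ 2) ≤ ‖hessForm u x‖ * ‖x - P‖ := by
          have h4 := (hessForm u x).le_opNorm₂ (x - P) e
          rw [he, mul_one] at h4
          have h5 : s * hessForm u x (x - P) e = M * (2 * ‖x - P‖ ^ 2) := by linarith
          rw [← h5]
          refine (le_abs_self _).trans ?_
          rw [abs_mul, hs, one_mul]
          exact h4
        have h6 := hlow x (subset_closure hx)
        have h7 : M * (2 * ‖x - P‖) ≤ ‖hessForm u x‖ := by
          have : 0 < ‖x - P‖ := by linarith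
          refine le_of_mul_le_mul_right ?_ this
          calc _ = M * (2 * ‖x - P‖ ^ 2) := by ring
            _ ≤ _ := h3
        have := h.one_le
        nlinarith
      refine exists_hessForm_neg_of_sum_neg (q := q) hlin.pos ?_
      rw [hessForm_lincomb (v := fun _ => 1) (hc2 x hx) contDiffAt_const, hessForm_const,
        hessForm_lincomb (hpc x hx) (contDiff_norm_sub_sq P).contDiffAt, hessForm_norm_sub_sq,
        hessForm_congr (hpe x hx)]
      have h8 := h1 e 0 (fun v => by simp) hH
      simp only [_root_.zero_apply, add_zero, he, mul_one] at h8
      have he1 : ∑ i, g i * ((1 : ℝ) • (s • hessForm (alongField u e 0) x +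
          (-M) • (2 : ℝ) • Bil.id n) +
          (|C₁| + M * (2 * R + 1) ^ 2) • (0 : Bil n)) (q i) (q i) =
          s * ∑ i, g i * hessForm (alongField u e 0) x (q i) (q i) - 2 * M * ∑ i, g i := by
        rw [← hlin.sum_id, Finset.mul_sum, Finset.mul_sum, ← Finset.sum_sub_distrib]
        refine Finset.sum_congr rfl fun i _ => ?_
        simp only [one_smul, smul_zero, add_zero, _root_.add_apply, _root_.smul_apply, smul_eq_mul]
        ring
      rw [he1]
      have h9 := mul_pos hM hT
      have h10 := (le_abs_self (s * ∑ i, g i * hessForm (alongField u e 0) x (q i) (q i)))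
      rw [abs_mul, hs, one_mul] at h10
      linarith
  intro x hx
  refine ContinuousLinearMap.opNorm_le_of_unit_norm (by positivity) fun e he => ?_
  have h1 := key 1 e (by simp) he x hx
  have h2 := key (-1) e (by simp) he x hx
  have h3 : 0 ≤ M * ‖x - P‖ ^ 2 := by positivity
  rw [Real.norm_eq_abs, abs_le]
  constructor <;> linarith

end Data

end KHess

end

noncomputable section

set_option maxSynthPendingDepth 3

namespace KHess

open Set Filter Topology

/-! ### Barriers at the boundary and the comparison argument. -/

section Barrier

variable {n k : ℕ} {Ω U : Set (E n)} {r : E n → ℝ} {x₀ : E n} {ρ K ε c B : ℝ}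

/-- Minus the Hessian of the barrier `r - (K/2) r² + ε |· - x'|²`, up to a multiple of the
identity. -/
def barrierForm (r : E n → ℝ) (K ε : ℝ) (y : E n) : Bil n :=
  -((1 - K * r y) • hessForm r y) + K • Bil.tensor (gradient r y) (gradient r y) -
    (3 * ε) • Bil.id n

/-- The barrier at the boundary point `x'`. -/
def barrier (r : E n → ℝ) (K ε : ℝ) (x' y : E n) : ℝ :=
  r y - K / 2 * r y ^ 2 + ε * ‖y - x'‖ ^ 2

/-- All the local information on `∂Ω` near `x₀` that the boundary estimates use. -/
structure LocalBarrier (k : ℕ) (Ω : Set (E n)) (x₀ : E n) (U : Set (E n)) (r : E n → ℝ)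
    (ρ K ε c B : ℝ) : Prop where
  defn : IsDefiningFn 3 Ω x₀ U r
  ρ_pos : 0 < ρ
  ε_pos : 0 < ε
  c_pos : 0 < c
  sub : Metric.closedBall x₀ ρ ⊆ U
  K_mul_le : ∀ y ∈ Metric.closedBall x₀ ρ, K * r y ≤ 1 / 2
  cone : ∀ y ∈ Metric.closedBall x₀ ρ, ∀ j ≤ k, 0 < Bil.sig j (barrierForm r K ε y)
  grad_ge : ∀ y ∈ Metric.closedBall x₀ ρ, c ≤ ‖gradient r y‖ / 2 - 4 * ε * ρ
  grad_le : ∀ y ∈ Metric.closedBall x₀ ρ, ‖gradient r y‖ ≤ B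
  hess_le : ∀ y ∈ Metric.closedBall x₀ ρ, ‖hessForm r y‖ ≤ B
  taylor₀ : ∀ y ∈ Metric.closedBall x₀ ρ, ∀ z ∈ Metric.closedBall x₀ ρ,
    |r z - r y - fderiv ℝ r y (z - y)| ≤ B * ‖z - y‖ ^ 2
  lip : ∀ y ∈ Metric.closedBall x₀ ρ, ∀ z ∈ Metric.closedBall x₀ ρ,
    ‖fderiv ℝ r z - fderiv ℝ r y‖ ≤ B * ‖z - y‖
  taylor₁ : ∀ y ∈ Metric.closedBall x₀ ρ, ∀ z ∈ Metric.closedBall x₀ ρ,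
    ‖fderiv ℝ r z - fderiv ℝ r y - hessForm r y (z - y)‖ ≤ B * ‖z - y‖ ^ 2

lemma norm_taylor_le {F : Type*} [NormedAddCommGroup F] [NormedSpace ℝ F] {G : E n → F}
    {s : Set (E n)} (hs : Convex ℝ s) {L : ℝ} (hL : 0 ≤ L) (hd : ∀ a ∈ s, DifferentiableAt ℝ G a)
    (hlip : ∀ a ∈ s, ∀ b ∈ s, ‖fderiv ℝ G b - fderiv ℝ G a‖ ≤ L * ‖b - a‖) {y z : E n}
    (hy : y ∈ s) (hz : z ∈ s) : ‖G z - G y - fderiv ℝ G y (z - y)‖ ≤ L * ‖z - y‖ ^ 2 := by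
  have hsub : segment ℝ y z ⊆ s := hs.segment_subset hy hz
  have := (convex_segment y z).norm_image_sub_le_of_norm_fderiv_le' (𝕜 := ℝ) (f := G)
    (φ := fderiv ℝ G y) (C := L * ‖z - y‖) (fun a ha => hd a (hsub ha)) (fun a ha => ?_)
    (left_mem_segment ℝ y z) (right_mem_segment ℝ y z)
  · rw [sq, ← mul_assoc]; exact this
  · refine (hlip y hy a (hsub ha)).trans (mul_le_mul_of_nonneg_left ?_ hL)
    obtain ⟨t, ht, rfl⟩ := (segment_eq_image' ℝ y z ▸ ha : a ∈ _ '' _)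
    rw [add_sub_cancel_left, norm_smul, Real.norm_of_nonneg ht.1]
    exact mul_le_of_le_one_left (norm_nonneg _) ht.2

/-- Joint continuity in `ε` and the point lets the open cone condition, known at `ε = 0` and `x₀`,
persist for small `ε > 0` near `x₀`. -/
lemma continuousAt_barrierForm (h : ContDiffAt ℝ 3 r x₀) (K : ℝ) (a : ℝ) :
    ContinuousAt (fun z : ℝ × E n => barrierForm r K z.1 z.2) (a, x₀) := by
  have h2 : ContDiffAt ℝ 2 (fderiv ℝ r) x₀ := ContDiffAt.fderiv_two (m := 2) h
  have c0 : ContinuousAt (fun z : ℝ × E n => r z.2) (a, x₀) :=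
    ContinuousAt.comp (f := Prod.snd) (x := (a, x₀)) h.continuousAt continuousAt_snd
  have c1 : ContinuousAt (fun z : ℝ × E n => gradient r z.2) (a, x₀) := by
    have : ContinuousAt (gradient r) x₀ :=
      (InnerProductSpace.toDual ℝ (E n)).symm.continuous.continuousAt.comp h2.continuousAt
    exact ContinuousAt.comp (f := Prod.snd) (x := (a, x₀)) this continuousAt_snd
  have c2 : ContinuousAt (fun z : ℝ × E n => hessForm r z.2) (a, x₀) :=
    ContinuousAt.comp (f := Prod.snd) (x := (a, x₀))
      (ContDiffAt.fderiv_two (m := 1) h2).continuousAt continuousAt_snd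
  have ct : Continuous fun z : E n => Bil.tensor z z := by
    have : (fun z : E n => Bil.tensor z z) = fun z =>
      ContinuousLinearMap.smulRightL ℝ (E n) (E n →L[ℝ] ℝ) (innerSL ℝ z) (innerSL ℝ z) := by
      ext z v w; simp [Bil.tensor]
    rw [this]
    exact ((ContinuousLinearMap.smulRightL ℝ (E n) (E n →L[ℝ] ℝ)).continuous.comp
      (innerSL ℝ).continuous).clm_apply (innerSL ℝ).continuous
  have c3 : ContinuousAt (fun z : ℝ × E n => Bil.tensor (gradient r z.2) (gradient r z.2))
      (a, x₀) := ContinuousAt.comp (g := fun z : E n => Bil.tensor z z) ct.continuousAt c1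
  have c4 : ContinuousAt (fun z : ℝ × E n => z.1) (a, x₀) := continuousAt_fst
  unfold barrierForm
  exact ((((continuousAt_const.sub (continuousAt_const.mul c0)).smul c2).neg).add
    (c3.const_smul K)).sub ((continuousAt_const.mul c4).smul continuousAt_const)

/-- Barriers exist near every boundary point of a strictly `(k-1)`-convex domain. -/
theorem exists_localBarrier (hkn : k ≤ n) (hC : HasCLipBoundary 3 Ω)
    (hΩk : StrictlyConvexBdry (k - 1) Ω) (hx₀ : x₀ ∈ frontier Ω) :
    ∃ U r ρ K ε c B, LocalBarrier k Ω x₀ U r ρ K ε c B := by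
  obtain ⟨U, r, hr⟩ := hC x₀ hx₀
  obtain ⟨δ, hδ, hκ⟩ := hΩk
  have hcd := hr.contDiffAt hr.mem
  have hr3 : ContDiffAt ℝ 3 r x₀ := hcd
  have h2 : ContDiffAt ℝ 2 (fderiv ℝ r) x₀ := ContDiffAt.fderiv_two (m := 2) hr3
  have h1 : ContDiffAt ℝ 1 (hessForm r) x₀ := ContDiffAt.fderiv_two (m := 1) h2
  have hr0 : r x₀ = 0 := (hr.zero_iff x₀ hr.mem).1 hx₀
  set G := ‖gradient r x₀‖ with hG
  have hG0 : 0 < G := norm_pos_iff.2 (hr.gradient_ne_zero x₀ hr.mem)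
  obtain ⟨K, hK⟩ := (eventually_sig_neg_hess_add_pos hkn (hr.gradient_ne_zero x₀ hr.mem)
    (hessForm_symm (hr3.of_le (by norm_cast)))
    fun j h1 h2 => hδ.trans_le (hκ x₀ hx₀ U r hr j h1 h2)).exists
  have hcone : ∀ᶠ z : ℝ × E n in 𝓝 (0, x₀), ∀ j ∈ Finset.range (k + 1),
      0 < Bil.sig j (barrierForm r K z.1 z.2) := by
    rw [Filter.eventually_all_finset]
    intro j hj
    have hc := ContinuousAt.comp (g := Bil.sig j)
      (contDiff_sig (n := n) j (m := 0)).continuous.continuousAt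
      (continuousAt_barrierForm hr3 K 0)
    refine hc.eventually (lt_mem_nhds ?_)
    have e : barrierForm r K 0 x₀ = -fderiv ℝ (fderiv ℝ r) x₀ +
        K • Bil.tensor (gradient r x₀) (gradient r x₀) := by
      simp [barrierForm, hr0]
    simp only [Function.comp_apply, e]
    exact hK j (by rw [Finset.mem_range] at hj; omega)
  rw [nhds_prod_eq, Filter.eventually_prod_iff] at hcone
  obtain ⟨pa, hpa, pb, hpb, hcone⟩ := hcone
  obtain ⟨ε, ⟨hε, hε1⟩, hε0⟩ : ∃ ε : ℝ, (pa ε ∧ ε ≤ 1) ∧ 0 < ε := by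
    have h1 : ∀ᶠ ε : ℝ in 𝓝[>] 0, pa ε ∧ ε ≤ 1 :=
      ((hpa.and (eventually_le_nhds (by norm_num : (0 : ℝ) < 1)))).filter_mono nhdsWithin_le_nhds
    exact (h1.and self_mem_nhdsWithin).exists
  obtain ⟨L, t, ht, hL⟩ := h1.exists_lipschitzOnWith
  have hgc : ContinuousAt (fun y => ‖gradient r y‖) x₀ :=
    ((InnerProductSpace.toDual ℝ (E n)).symm.continuous.continuousAt.comp h2.continuousAt).norm
  have ev1 : ∀ᶠ y in 𝓝 x₀, 3 / 4 * G < ‖gradient r y‖ := hgc.eventually (lt_mem_nhds (by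
    change 3 / 4 * G < G; linarith))
  have ev2 : ∀ᶠ y in 𝓝 x₀, ‖gradient r y‖ < G + 1 := hgc.eventually (gt_mem_nhds (by
    change G < G + 1; linarith))
  have ev3 : ∀ᶠ y in 𝓝 x₀, ‖hessForm r y‖ < ‖hessForm r x₀‖ + 1 :=
    h1.continuousAt.norm.eventually (gt_mem_nhds (by linarith))
  have ev4 : ∀ᶠ y in 𝓝 x₀, K * r y < 1 / 2 :=
    (continuousAt_const.mul hr3.continuousAt).eventually (gt_mem_nhds (by
      simp only [Pi.mul_apply, hr0]; norm_num))
  have evU : ∀ᶠ y in 𝓝 x₀, y ∈ U := hr.isOpen.mem_nhds hr.mem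
  have evt : ∀ᶠ y in 𝓝 x₀, y ∈ t := ht
  have evall := ((((ev1.and ev2).and ev3).and ev4).and hpb).and (evU.and evt)
  obtain ⟨ρ₀, hρ₀, hball⟩ := Metric.nhds_basis_closedBall.mem_iff.1 evall
  -- With `|∇r| ≥ 3 G / 4` and `ε ≤ 1`, this radius gives `|∇r| / 2 - 4 ε ρ ≥ 3 G / 8 - G / 4 = G /
  -- 8`, the value used for `c`.
  set ρ := min ρ₀ (G / 16) with hρ
  have hρ0 : 0 < ρ := by positivity
  have hsub : ∀ y ∈ Metric.closedBall x₀ ρ, _ := fun y hy =>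
    hball (Metric.closedBall_subset_closedBall (min_le_left _ _) hy)
  set B := max (max (G + 1) (‖hessForm r x₀‖ + 1)) L with hB
  have hB1 : G + 1 ≤ B := (le_max_left _ _).trans (le_max_left _ _)
  have hB2 : ‖hessForm r x₀‖ + 1 ≤ B := (le_max_right _ _).trans (le_max_left _ _)
  have hB3 : (L : ℝ) ≤ B := le_max_right _ _
  have hB0 : 0 ≤ B := by linarith
  have hcv := convex_closedBall x₀ ρ
  have hdiff : ∀ y ∈ Metric.closedBall x₀ ρ, ContDiffAt ℝ 3 r y := fun y hy =>
    hr.contDiffAt (hsub y hy).2.1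
  have hhess : ∀ y ∈ Metric.closedBall x₀ ρ, ‖hessForm r y‖ ≤ B := fun y hy =>
    (hsub y hy).1.1.1.2.le.trans hB2
  have hlip2 : ∀ a ∈ Metric.closedBall x₀ ρ, ∀ b ∈ Metric.closedBall x₀ ρ,
      ‖hessForm r b - hessForm r a‖ ≤ B * ‖b - a‖ := fun a ha b hb =>
    (hL.norm_sub_le (hsub b hb).2.2 (hsub a ha).2.2).trans
      (mul_le_mul_of_nonneg_right hB3 (norm_nonneg _))
  have hd1 : ∀ a ∈ Metric.closedBall x₀ ρ, DifferentiableAt ℝ (fderiv ℝ r) a := fun a ha =>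
    (ContDiffAt.fderiv_two (m := 2) (hdiff a ha)).differentiableAt (by simp)
  have hlip1 : ∀ a ∈ Metric.closedBall x₀ ρ, ∀ b ∈ Metric.closedBall x₀ ρ,
      ‖fderiv ℝ r b - fderiv ℝ r a‖ ≤ B * ‖b - a‖ := fun a ha b hb =>
    hcv.norm_image_sub_le_of_norm_fderiv_le hd1 hhess ha hb
  refine ⟨U, r, ρ, K, ε, G / 8, B, hr, hρ0, hε0, by positivity, fun y hy => (hsub y hy).2.1,
    fun y hy => (hsub y hy).1.1.2.le, fun y hy j hj => ?_, fun y hy => ?_,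
    fun y hy => (hsub y hy).1.1.1.1.2.le.trans hB1, hhess, fun y hy z hz => ?_, hlip1,
    fun y hy z hz => norm_taylor_le hcv hB0 hd1 hlip2 hy hz⟩
  · exact hcone hε (hsub y hy).1.2 j (Finset.mem_range.2 (by omega))
  · have e1 := (hsub y hy).1.1.1.1.1
    have e2 : ρ ≤ G / 16 := min_le_right _ _
    have e3 : ε * ρ ≤ 1 * (G / 16) := mul_le_mul hε1 e2 hρ0.le zero_le_one
    linarith
  · rw [← Real.norm_eq_abs]
    exact norm_taylor_le hcv hB0 (fun a ha => (hdiff a ha).differentiableAt (by simp)) hlip1 hy hz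

lemma hasFDerivAt_barrier {y : E n} (h : DifferentiableAt ℝ r y) (K ε : ℝ) (x' : E n) :
    HasFDerivAt (barrier r K ε x')
      ((1 - K * r y) • fderiv ℝ r y + (2 * ε) • innerSL ℝ (y - x')) y := by
  have h1 := h.hasFDerivAt
  have h2 : HasFDerivAt (fun y : E n => ‖y - x'‖ ^ 2) ((2 : ℝ) • innerSL ℝ (y - x')) y := by
    rw [← fderiv_norm_sub_sq]
    exact ((contDiff_norm_sub_sq (m := 1) x').differentiable (by simp) y).hasFDerivAt
  have h3 := (h1.sub ((h1.pow 2).const_mul (K / 2))).add (h2.const_mul ε)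
  refine HasFDerivAt.congr_fderiv (f := barrier r K ε x') h3 ?_
  ext v
  simp
  ring

lemma contDiffAt_barrier {y : E n} {m : WithTop ℕ∞} (h : ContDiffAt ℝ m r y) (K ε : ℝ) (x' : E n) :
    ContDiffAt ℝ m (barrier r K ε x') y :=
  (h.sub (contDiffAt_const.mul (h.pow 2))).add
    (contDiffAt_const.mul (contDiff_norm_sub_sq x').contDiffAt)

/-- The form in the cone already has `3 ε` times the identity subtracted, whereas the squared
distance adds only `2 ε`. The surplus `-ε` is the strict margin `-ε T` under the linearized
operator. -/
lemma hessForm_barrier {y : E n} (h : ContDiffAt ℝ 2 r y) (K ε : ℝ) (x' : E n) :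
    hessForm (barrier r K ε x') y = -barrierForm r K ε y - ε • Bil.id n := by
  have hev : fderiv ℝ (barrier r K ε x') =ᶠ[𝓝 y] fun y =>
      (1 - K * r y) • fderiv ℝ r y + (2 * ε) • innerSL ℝ (y - x') := by
    filter_upwards [h.eventually (by simp)] with z hz
    exact (hasFDerivAt_barrier (hz.differentiableAt (by simp)) K ε x').fderiv
  have h1 := (h.differentiableAt (by simp)).hasFDerivAt
  have h2 := ((ContDiffAt.fderiv_two (m := 1) h).differentiableAt (by simp)).hasFDerivAt
  have h3 : HasFDerivAt (fun y : E n => (innerSL ℝ) (y - x')) (Bil.id n) y := by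
    have := (Bil.id n).hasFDerivAt (x := y - x')
    exact this.comp y ((hasFDerivAt_id y).sub_const x')
  have h4 := (((h1.const_mul K).const_sub 1).smul h2).add (h3.const_smul (2 * ε))
  have h5 : HasFDerivAt (fun y => (1 - K * r y) • fderiv ℝ r y + (2 * ε) • innerSL ℝ (y - x')) _ y :=
    h4
  rw [hessForm, hev.fderiv_eq, h5.fderiv]
  ext v w
  simp [barrierForm]
  ring


/-- Comparison with the barrier: a function vanishing to second order on `∂Ω` at `x'` has bounded
normal derivative and vanishing tangential derivative there. -/
theorem LocalBarrier.compare (h : LocalBarrier k Ω x₀ U r ρ K ε c B) (hkn : k ≤ n)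
    (hΩ : IsOpen Ω)
    (hb : Bornology.IsBounded Ω) {x' : E n} (hx' : x' ∈ frontier Ω)
    (hx'b : x' ∈ Metric.ball x₀ (ρ / 2)) {A : ℝ} (hA : 0 < A) {v : E n → ℝ} {V : E n →L[ℝ] ℝ}
    (hvc : ContinuousOn v (closure Ω)) (hv2 : ∀ y ∈ Ω, ContDiffAt ℝ 2 v y)
    (hsph : ∀ y ∈ closure Ω, y ∈ Metric.closedBall x₀ ρ → |v y| ≤ A * ε * (ρ / 2) ^ 2)
    (hfr : ∀ y ∈ frontier Ω, y ∈ Metric.closedBall x₀ ρ → |v y| ≤ A * ε * ‖y - x'‖ ^ 2)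
    (hint : ∀ y ∈ Ω, y ∈ Metric.ball x₀ ρ → A * c ≤ ‖fderiv ℝ v y‖ →
      ∃ (A' : Bil n) (q : _) (g : _), IsLinearization k A' q g ∧
        |∑ i, g i * hessForm v y (q i) (q i)| < A * ε * ∑ i, g i)
    (hV : HasFDerivWithinAt v V (closure Ω) x') :
    ‖V‖ ≤ A * B := by
  have hρ := h.ρ_pos
  have hε := h.ε_pos
  have hx'cb : x' ∈ Metric.closedBall x₀ ρ :=
    Metric.ball_subset_closedBall (Metric.ball_subset_ball (by linarith) hx'b)
  have hx'ball : x' ∈ Metric.ball x₀ ρ := Metric.ball_subset_ball (by linarith) hx'b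
  have hdef := h.defn.mono (h.sub hx'cb)
  have hr0 : r x' = 0 := (hdef.zero_iff x' hdef.mem).1 hx'
  have hvx : v x' = 0 := by simpa using hfr x' hx' hx'cb
  have hrcd : ∀ y ∈ Metric.closedBall x₀ ρ, ContDiffAt ℝ 3 r y := fun y hy =>
    h.defn.contDiffAt (h.sub hy)
  set D := Ω ∩ Metric.ball x₀ ρ with hD
  have hclD : closure D ⊆ closure Ω ∩ Metric.closedBall x₀ ρ :=
    (closure_inter_subset_inter_closure _ _).trans
      (inter_subset_inter_right _ Metric.closure_ball_subset_closedBall)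
  have hDo : IsOpen D := hΩ.inter Metric.isOpen_ball
  have hbar_ge : ∀ y ∈ closure Ω, y ∈ Metric.closedBall x₀ ρ →
      ε * ‖y - x'‖ ^ 2 ≤ barrier r K ε x' y := by
    intro y hyc hy
    have h1 := h.defn.nonneg_of_mem_closure (h.sub hy) hyc
    have h2 := mul_le_mul_of_nonneg_right (h.K_mul_le y hy) h1
    rw [barrier]
    nlinarith
  -- The sign `s` gives the upper and the lower barrier at once.
  have key : ∀ s : ℝ, |s| = 1 → ∀ y ∈ closure D, 0 ≤ A * barrier r K ε x' y + s * v y := by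
    intro s hs
    have hbv : ∀ y ∈ Ω, y ∈ Metric.closedBall x₀ ρ →
        ContDiffAt ℝ 2 (barrier r K ε x') y := fun y _ hy =>
      contDiffAt_barrier ((hrcd y hy).of_le (by norm_cast)) K ε x'
    refine nonneg_of_exists_hessForm_neg hDo (hb.subset inter_subset_left) ?_ ?_ ?_ ?_
    · refine (continuousOn_const.mul fun y hy => ?_).add
        (continuousOn_const.mul (hvc.mono fun y hy => (hclD hy).1))
      exact (contDiffAt_barrier (hrcd y (hclD hy).2) K ε x').continuousAt.continuousWithinAt
    · intro y hy
      have hycb := Metric.ball_subset_closedBall hy.2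
      exact (contDiffAt_const.mul (hbv y hy.1 hycb)).add (contDiffAt_const.mul (hv2 y hy.1))
    · intro y hy
      have hyc := hclD (frontier_subset_closure hy)
      have h1 := hbar_ge y hyc.1 hyc.2
      have h2 : ∀ {a : ℝ}, |v y| ≤ A * ε * a → a ≤ ‖y - x'‖ ^ 2 →
          0 ≤ A * barrier r K ε x' y + s * v y := by
        intro a h3 h4
        have h5 : |s * v y| ≤ A * ε * a := by rwa [abs_mul, hs, one_mul]
        have h6 := mul_le_mul_of_nonneg_left h1 hA.le
        have h7 := mul_le_mul_of_nonneg_left h4 (mul_pos hA hε).le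
        linarith [(abs_le.1 h5).1]
      -- A frontier point inside `Ω` lies on the sphere around `x₀`, hence at distance at least `ρ /
      -- 2` from `x'`; the other frontier points lie on `∂Ω`.
      by_cases hyΩ : y ∈ Ω
      · refine h2 (hsph y hyc.1 hyc.2) (pow_le_pow_left₀ (by positivity) ?_ 2)
        have hynD : y ∉ D := fun hyD => hy.2 (hDo.interior_eq.symm ▸ hyD)
        have h3 : ρ ≤ dist y x₀ := by
          by_contra! hlt
          exact hynD ⟨hyΩ, hlt⟩
        have h4 := dist_triangle y x' x₀
        rw [dist_eq_norm y x'] at h4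
        have h5 : dist x' x₀ < ρ / 2 := hx'b
        linarith
      · exact h2 (hfr y ⟨hyc.1, fun hi => hyΩ (interior_subset hi)⟩ hyc.2) le_rfl
    · intro y hy hcrit
      have hycb := Metric.ball_subset_closedBall hy.2
      have hr2 : ContDiffAt ℝ 2 r y := (hrcd y hycb).of_le (by norm_cast)
      have hs0 : s * s = 1 := by rw [← abs_mul_abs_self, hs, one_mul]
      rw [fderiv_lincomb ((hbv y hy.1 hycb).differentiableAt (by simp))
        ((hv2 y hy.1).differentiableAt (by simp)),
        (hasFDerivAt_barrier (hr2.differentiableAt (by simp)) K ε x').fderiv] at hcrit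
      -- At a critical point the gradient of `v` balances `A` times that of the barrier, whose norm
      -- is at least `c`.
      have hgrad : A * c ≤ ‖fderiv ℝ v y‖ := by
        have h1 : ‖fderiv ℝ v y‖ = A * ‖(1 - K * r y) • fderiv ℝ r y +
            (2 * ε) • innerSL ℝ (y - x')‖ := by
          have h2 := eq_neg_of_add_eq_zero_right hcrit
          have h3 := congrArg norm h2
          rwa [norm_neg, norm_smul, norm_smul, Real.norm_eq_abs, hs, one_mul, Real.norm_of_nonneg
            hA.le] at h3
        rw [h1]
        refine mul_le_mul_of_nonneg_left ((h.grad_ge y hycb).trans ?_) hA.le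
        have hG : ‖fderiv ℝ r y‖ = ‖gradient r y‖ := by
          rw [gradient, LinearIsometryEquiv.norm_map]
        have h4 : ‖gradient r y‖ / 2 ≤ ‖(1 - K * r y) • fderiv ℝ r y‖ := by
          have h5 := h.K_mul_le y hycb
          rw [norm_smul, Real.norm_of_nonneg (by linarith), hG]
          nlinarith [norm_nonneg (gradient r y)]
        have h6 : ‖(2 * ε) • innerSL ℝ (y - x')‖ ≤ 4 * ε * ρ := by
          rw [norm_smul, Real.norm_of_nonneg (by positivity), innerSL_apply_norm, ← dist_eq_norm]
          have h7 := dist_triangle_right y x' x₀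
          rw [Metric.mem_closedBall] at hycb hx'cb
          nlinarith
        have h8 := norm_sub_le_norm_add ((1 - K * r y) • fderiv ℝ r y)
          ((2 * ε) • innerSL ℝ (y - x'))
        linarith
      obtain ⟨A', q, g, hlin, hlt⟩ := hint y hy.1 hy.2 hgrad
      refine exists_hessForm_neg_of_sum_neg (q := q) hlin.pos ?_
      rw [hessForm_lincomb (hbv y hy.1 hycb) (hv2 y hy.1), hessForm_barrier hr2]
      have hCs : (barrierForm r K ε y).Symm := fun a b => by
        simp only [barrierForm, _root_.add_apply, _root_.sub_apply, _root_.neg_apply,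
          _root_.smul_apply, Bil.tensor_apply, Bil.id_apply, hessForm_symm hr2 a b,
          real_inner_comm a b, smul_eq_mul]
        ring
      have hg := hlin.garding _ hCs ((hCs.mem_gardingCone hkn).2 (h.cone y hycb))
      have hT := hlin.sum_id
      have e : ∑ i, g i * (A • (-barrierForm r K ε y - ε • Bil.id n) + s • hessForm v y)
          (q i) (q i) = -A * ∑ i, g i * barrierForm r K ε y (q i) (q i) -
            A * ε * ∑ i, g i + s * ∑ i, g i * hessForm v y (q i) (q i) := by
        rw [← hT, Finset.mul_sum, Finset.mul_sum, Finset.mul_sum, ← Finset.sum_sub_distrib,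
          ← Finset.sum_add_distrib]
        refine Finset.sum_congr rfl fun i _ => ?_
        simp only [_root_.add_apply, _root_.sub_apply, _root_.neg_apply, _root_.smul_apply,
          smul_eq_mul]
        ring
      rw [e]
      have h1 := mul_nonneg hA.le hg
      have h2 := le_abs_self (s * ∑ i, g i * hessForm v y (q i) (q i))
      rw [abs_mul, hs, one_mul] at h2
      linarith
  have htan : ∀ η, inner ℝ (gradient r x') η = 0 → V η = 0 := fun η hη => by
    refine hdef.fderivWithin_apply_eq_zero hx' hV (C := A * ε) ?_ hη
    filter_upwards [self_mem_nhdsWithin, mem_nhdsWithin_of_mem_nhds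
      (Metric.isOpen_ball.mem_nhds hx'ball)] with y hy hyb
    exact hfr y hy (Metric.ball_subset_closedBall hyb)
  have hbarx : barrier r K ε x' x' = 0 := by simp [barrier, hr0]
  have hbarL : HasFDerivAt (barrier r K ε x') (fderiv ℝ r x') x' := by
    have := hasFDerivAt_barrier ((hrcd x' hx'cb).differentiableAt (by simp)) K ε x'
    simpa [hr0] using this
  -- `A * barrier ± v` is nonnegative near `x'` in `Ω` and vanishes at `x'`, so its inward
  -- derivatives are nonnegative.
  have hsgn : ∀ s : ℝ, |s| = 1 → ∀ w, 0 < inner ℝ (gradient r x') w →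
      0 ≤ A * inner ℝ (gradient r x') w + s * V w := by
    intro s hs w hw
    have h1 := hdef.fderivWithin_apply_nonneg hx'
      (Ψ := fun y => A * barrier r K ε x' y + s * v y)
      ((hbarL.hasFDerivWithinAt.const_mul A).add (hV.const_mul s)) (by simp [hbarx, hvx]) ?_ hw
    · simpa only [_root_.add_apply, _root_.smul_apply, smul_eq_mul,
        fderiv_apply_eq_inner_gradient] using h1
    · filter_upwards [self_mem_nhdsWithin, mem_nhdsWithin_of_mem_nhds
        (Metric.isOpen_ball.mem_nhds hx'ball)] with y hy hyb
      exact key s hs y (subset_closure ⟨hy, hyb⟩)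
  set G := gradient r x' with hG
  have hG0 : 0 < ‖G‖ := norm_pos_iff.2 (hdef.gradient_ne_zero x' hdef.mem)
  have hVG : |V G| ≤ A * ‖G‖ ^ 2 := by
    have hGG : 0 < inner ℝ G G := by rw [real_inner_self_eq_norm_sq]; positivity
    have h1 := hsgn 1 (by simp) G hGG
    have h2 := hsgn (-1) (by simp) G hGG
    rw [real_inner_self_eq_norm_sq] at h1 h2
    rw [abs_le]; constructor <;> linarith
  have hGB := h.grad_le x' hx'cb
  refine ContinuousLinearMap.opNorm_le_bound _ (mul_nonneg hA.le (hG0.le.trans hGB)) fun e => ?_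
  have h1 : V (e - (inner ℝ G e / ‖G‖ ^ 2) • G) = 0 := htan _ (by
    rw [inner_sub_right, inner_smul_right, real_inner_self_eq_norm_sq]; field_simp; ring)
  rw [map_sub, map_smul, sub_eq_zero, smul_eq_mul] at h1
  rw [h1, Real.norm_eq_abs, abs_mul, abs_div, abs_of_pos (by positivity : 0 < ‖G‖ ^ 2)]
  calc |inner ℝ G e| / ‖G‖ ^ 2 * |V G| ≤ |inner ℝ G e| / ‖G‖ ^ 2 * (A * ‖G‖ ^ 2) :=
        mul_le_mul_of_nonneg_left hVG (by positivity)
    _ = A * |inner ℝ G e| := by field_simp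
    _ ≤ A * (‖G‖ * ‖e‖) := mul_le_mul_of_nonneg_left (abs_real_inner_le_norm _ _) hA.le
    _ ≤ A * (B * ‖e‖) := mul_le_mul_of_nonneg_left
        (mul_le_mul_of_nonneg_right hGB (norm_nonneg _)) hA.le
    _ = A * B * ‖e‖ := by ring

end Barrier

end KHess

end

noncomputable section

set_option maxSynthPendingDepth 3

namespace KHess

open Set Filter Topology

/-! ### Boundary gradient and tangential second-derivative estimates. -/

section BoundaryEstimates

variable {n k : ℕ} {Ω U : Set (E n)} {r : E n → ℝ} {x₀ : E n} {ρ K ε c B : ℝ}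

lemma eventually_le_mul {c : ℝ} (hc : 0 < c) (a : ℝ) : ∀ᶠ A : ℝ in atTop, a < A * c :=
  (tendsto_id.atTop_mul_const hc).eventually_gt_atTop a

/-- The gradient bound on the boundary, near `x₀`. -/
theorem LocalBarrier.exists_gradient_le (h : LocalBarrier k Ω x₀ U r ρ K ε c B) (hk : 2 ≤ k)
    (hkn : k ≤ n) (hΩ : IsOpen Ω) (hb : Bornology.IsBounded Ω) (M C₀ : ℝ) :
    ∃ C, ∀ f u Φ, IsDatum k Ω M f u Φ → (∀ x ∈ closure Ω, |u x| ≤ C₀) →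
      ∀ p H, IsC2Ext Ω u p H → ∀ x' ∈ frontier Ω, x' ∈ Metric.ball x₀ (ρ / 2) → ‖p x'‖ ≤ C := by
  have hρ := h.ρ_pos
  have hε := h.ε_pos
  -- `A` must dominate `|u - Φ|` on the spherical part and `|L (u - Φ)|` against `A ε T`. No
  -- largeness of the gradient is needed, as `0 < L u ≤ k M T` holds everywhere.
  obtain ⟨A, hA0, hA1, hA2⟩ := ((eventually_gt_atTop (0 : ℝ)).and
    ((eventually_le_mul (show 0 < ε * (ρ / 2) ^ 2 by positivity) (C₀ + M)).and
      (eventually_le_mul hε (k * M + M)))).exists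
  refine ⟨A * B + M, fun f u Φ hd hC₀ p H hp x' hx' hx'b => ?_⟩
  obtain ⟨pΦ, HΦ, hpΦ⟩ := hd.memC_Φ.exists_isC2Ext (by norm_num)
  have hΦle : ∀ x ∈ closure Ω, |Φ x| ≤ M := norm_le_on_closure hd.memC_Φ.2.1 hd.Φ_le
  have hpΦle : ∀ x ∈ closure Ω, ‖pΦ x‖ ≤ M := norm_le_on_closure hpΦ.cont_p fun x hx => by
    rw [hpΦ.eq_p x hx]; exact hd.fderiv_Φ_le x hx
  have hu2 : ∀ x ∈ Ω, ContDiffAt ℝ 2 u x :=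
    fun x hx => (hd.memC_u.contDiffAt hΩ hx).of_le (by norm_cast)
  have hΦ2 : ∀ x ∈ Ω, ContDiffAt ℝ 2 Φ x :=
    fun x hx => (hd.memC_Φ.contDiffAt hΩ hx).of_le (by norm_cast)
  have hx'cb : x' ∈ Metric.closedBall x₀ ρ :=
    Metric.ball_subset_closedBall (Metric.ball_subset_ball (by linarith) hx'b)
  have hdef := h.defn.mono (h.sub hx'cb)
  have hvc : ContinuousOn (fun y => 1 * u y + (-1) * Φ y) (closure Ω) :=
    (continuousOn_const.mul hp.cont).add (continuousOn_const.mul hpΦ.cont)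
  have hV := hdef.hasFDerivWithinAt_closure hx' hvc
    (V := fun y => (1 : ℝ) • p y + (-1 : ℝ) • pΦ y) (fun y hy => by
      rw [hp.eq_p y hy, hpΦ.eq_p y hy]
      exact (((hu2 y hy).differentiableAt (by simp)).hasFDerivAt.const_mul 1).add
        (((hΦ2 y hy).differentiableAt (by simp)).hasFDerivAt.const_mul (-1)))
    (((hp.cont_p.const_smul (1 : ℝ)).add (hpΦ.cont_p.const_smul (-1 : ℝ))) x'
      (frontier_subset_closure hx'))
  have hfin := h.compare hkn hΩ hb hx' hx'b hA0 hvc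
    (fun y hy => (contDiffAt_const.mul (hu2 y hy)).add (contDiffAt_const.mul (hΦ2 y hy)))
    (fun y hy _ => ?_) (fun y hy _ => ?_) (fun y hy _ _ => ?_) hV
  · have e : p x' = ((1 : ℝ) • p x' + (-1 : ℝ) • pΦ x') + pΦ x' := by
      rw [one_smul, neg_smul, one_smul]; abel
    rw [e]
    exact (norm_add_le _ _).trans (add_le_add hfin (hpΦle x' (frontier_subset_closure hx')))
  · have h1 := abs_le.1 (hC₀ y hy)
    have h2 := abs_le.1 (hΦle y hy)
    rw [mul_assoc, abs_le]
    constructor <;> linarith [h1.1, h1.2, h2.1, h2.2]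
  · rw [hd.boundary y hy]
    have : (1 : ℝ) * Φ y + (-1) * Φ y = 0 := by ring
    rw [this, abs_zero]
    positivity
  · obtain ⟨q, g, hlin, h1, h2, -⟩ := hd.exists_linearization hk hkn hΩ hy
    refine ⟨_, q, g, hlin, ?_⟩
    have hT := hlin.trace_pos (by omega)
    rw [hessForm_lincomb (hu2 y hy) (hΦ2 y hy)]
    have h3 := hlin.abs_sum_le (hd.hessForm_Φ_le y hy)
    have e : ∑ i, g i * ((1 : ℝ) • hessForm u y + (-1 : ℝ) • hessForm Φ y) (q i) (q i) =
        ∑ i, g i * hessForm u y (q i) (q i) - ∑ i, g i * hessForm Φ y (q i) (q i) := by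
      rw [← Finset.sum_sub_distrib]
      refine Finset.sum_congr rfl fun i _ => ?_
      simp only [_root_.add_apply, _root_.smul_apply, smul_eq_mul]
      ring
    rw [e]
    have h4 := mul_lt_mul_of_pos_right hA2 hT
    have h5 := abs_le.1 h3
    rw [abs_lt]
    constructor <;> linarith [h5.1, h5.2]

/-- The rotation field that makes `η + W (· - x')` tangential to second order. -/
lemma LocalBarrier.exists_rotation (h : LocalBarrier k Ω x₀ U r ρ K ε c B) {x' : E n}
    (hx' : x' ∈ frontier Ω) (hx'b : x' ∈ Metric.closedBall x₀ ρ) {η : E n} (hη : ‖η‖ = 1)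
    (hηr : inner ℝ (gradient r x') η = 0) :
    ∃ W : E n →L[ℝ] E n, IsSkew W ∧ (∀ z, ‖W z‖ ≤ B / c * ‖z‖) ∧
      ∀ y ∈ frontier Ω, y ∈ Metric.closedBall x₀ ρ →
        |fderiv ℝ r y (η + W (y - x'))| ≤ (B + 2 * (B * (B / c))) * ‖y - x'‖ ^ 2 := by
  have hc := h.c_pos
  have hε := h.ε_pos
  have hρ := h.ρ_pos
  set G := gradient r x' with hG
  have hG2c : 2 * c ≤ ‖G‖ := by
    have := h.grad_ge x' hx'b
    have h2 : 0 < 4 * ε * ρ := by positivity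
    linarith
  have hG0 : 0 < ‖G‖ := by linarith
  have hB0 : 0 ≤ B := (norm_nonneg _).trans (h.hess_le x' hx'b)
  obtain ⟨N, hN⟩ : ∃ N, N = ‖G‖⁻¹ • G := ⟨_, rfl⟩
  have hN1 : ‖N‖ = 1 := by rw [hN, norm_smul, norm_inv, norm_norm, inv_mul_cancel₀ hG0.ne']
  -- `q` is chosen so that `Dr(x')(W z)` cancels `D²r(x')(η, z)`, the first-order change of `Dr(η)`.
  -- What remains is a multiple of `Dr(x') z`, which is `O(|z|²)` between two boundary points.
  obtain ⟨q, hq⟩ : ∃ q, q = -(‖G‖⁻¹ • (InnerProductSpace.toDual ℝ (E n)).symm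
      (hessForm r x' η)) := ⟨_, rfl⟩
  have hqz : ∀ z, ‖G‖ * inner ℝ q z = -hessForm r x' η z := by
    intro z
    rw [hq, inner_neg_left, inner_smul_left, InnerProductSpace.toDual_symm_apply, map_inv₀,
      conj_trivial]
    field_simp
  have hqn : ‖q‖ ≤ B / c / 2 := by
    rw [hq, norm_neg, norm_smul, norm_inv, norm_norm, LinearIsometryEquiv.norm_map]
    have h1 : ‖hessForm r x' η‖ ≤ B := by
      have := (hessForm r x').le_opNorm η
      rw [hη, mul_one] at this
      exact this.trans (h.hess_le x' hx'b)
    calc ‖G‖⁻¹ * ‖hessForm r x' η‖ ≤ (2 * c)⁻¹ * B :=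
          mul_le_mul (inv_anti₀ (by positivity) hG2c) h1 (norm_nonneg _) (by positivity)
      _ = _ := by field_simp
  set W : E n →L[ℝ] E n := (innerSL ℝ q).smulRight N - (innerSL ℝ N).smulRight q with hW
  have hWz : ∀ z, W z = inner ℝ q z • N - inner ℝ N z • q := fun z => by simp [hW]
  have hWn : ∀ z, ‖W z‖ ≤ B / c * ‖z‖ := by
    intro z
    rw [hWz]
    refine (norm_sub_le _ _).trans ?_
    rw [norm_smul, norm_smul, hN1, mul_one]
    have h1 := norm_inner_le_norm (𝕜 := ℝ) q z
    have h2 := norm_inner_le_norm (𝕜 := ℝ) N z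
    rw [hN1, one_mul] at h2
    have h3 := mul_le_mul h2 hqn (norm_nonneg _) (norm_nonneg _)
    have h4 := mul_le_mul_of_nonneg_right hqn (norm_nonneg z)
    linarith
  refine ⟨W, fun v => ?_, hWn, fun y hy hyb => ?_⟩
  · rw [hWz, inner_sub_right, inner_smul_right, inner_smul_right, real_inner_comm v N,
      real_inner_comm v q]
    ring
  · set z := y - x' with hz
    have hr2 : ContDiffAt ℝ 2 r x' := (h.defn.contDiffAt (h.sub hx'b)).of_le (by norm_cast)
    have hry : r y = 0 := (h.defn.zero_iff y (h.sub hyb)).1 hy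
    have hrx : r x' = 0 := (h.defn.zero_iff x' (h.sub hx'b)).1 hx'
    have t0 := h.taylor₀ x' hx'b y hyb
    have t1 := h.taylor₁ x' hx'b y hyb
    have t2 := h.lip x' hx'b y hyb
    rw [← hz] at t0 t1 t2
    rw [hry, hrx, sub_self, zero_sub, abs_neg] at t0
    have hDη : fderiv ℝ r x' η = 0 := (fderiv_apply_eq_inner_gradient r x' η).trans hηr
    have e1 : fderiv ℝ r x' (W z) = -hessForm r x' η z - fderiv ℝ r x' z * inner ℝ N q := by
      rw [fderiv_apply_eq_inner_gradient, fderiv_apply_eq_inner_gradient, ← hG, hWz,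
        inner_sub_right, inner_smul_right, inner_smul_right, ← hqz]
      have hGN : G = ‖G‖ • N := by rw [hN, smul_smul, mul_inv_cancel₀ hG0.ne', one_smul]
      have i1 : inner ℝ G N = ‖G‖ := by
        rw [hN, inner_smul_right, real_inner_self_eq_norm_sq]; field_simp
      have i2 : ∀ a, inner ℝ G a = ‖G‖ * inner ℝ N a := fun a => by
        conv_lhs => rw [hGN]
        rw [inner_smul_left, conj_trivial]
      rw [i1, i2 q, i2 z]
      ring
    have e2 : fderiv ℝ r y (η + W z) =
        (fderiv ℝ r y - fderiv ℝ r x' - hessForm r x' z) η +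
          (fderiv ℝ r y - fderiv ℝ r x') (W z) - fderiv ℝ r x' z * inner ℝ N q := by
      simp only [_root_.sub_apply, map_add, hDη, e1, hessForm_symm hr2 η z]
      ring
    have a1 : |(fderiv ℝ r y - fderiv ℝ r x' - hessForm r x' z) η| ≤ B * ‖z‖ ^ 2 := by
      refine ((fderiv ℝ r y - fderiv ℝ r x' - hessForm r x' z).le_opNorm η).trans ?_
      rw [hη, mul_one]; exact t1
    have a2 : |(fderiv ℝ r y - fderiv ℝ r x') (W z)| ≤ B * ‖z‖ * (B / c * ‖z‖) :=
      ((fderiv ℝ r y - fderiv ℝ r x').le_opNorm (W z)).trans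
        (mul_le_mul t2 (hWn z) (norm_nonneg _) (by positivity))
    have a3 : |fderiv ℝ r x' z * inner ℝ N q| ≤ B * ‖z‖ ^ 2 * (B / c / 2) := by
      rw [abs_mul]
      refine mul_le_mul t0 ?_ (abs_nonneg _) (by positivity)
      have := abs_real_inner_le_norm N q
      rw [hN1, one_mul] at this
      exact this.trans hqn
    rw [e2]
    have a4 : 0 ≤ B * ‖z‖ ^ 2 * (B / c / 2) := by positivity
    refine (abs_sub _ _).trans ((add_le_add (abs_add_le _ _) le_rfl).trans ?_)
    calc _ ≤ B * ‖z‖ ^ 2 + B * ‖z‖ * (B / c * ‖z‖) + B * ‖z‖ ^ 2 * (B / c / 2) := by linarith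
      _ ≤ B * ‖z‖ ^ 2 + B * ‖z‖ * (B / c * ‖z‖) + 2 * (B * ‖z‖ ^ 2 * (B / c / 2)) := by linarith
      _ = _ := by ring

/-- The bound for the second derivatives `u_{eη}` with `η` tangential, near `x₀`. -/
theorem LocalBarrier.exists_hess_le (h : LocalBarrier k Ω x₀ U r ρ K ε c B) (hk : 2 ≤ k)
    (hkn : k ≤ n) (hΩ : IsOpen Ω) (hb : Bornology.IsBounded Ω) (M C₁ : ℝ) (hC₁ : 0 ≤ C₁) :
    ∃ C, ∀ f u Φ, IsDatum k Ω M f u Φ → ∀ p H, IsC2Ext Ω u p H →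
      (∀ x ∈ closure Ω, ‖p x‖ ≤ C₁) → ∀ x' ∈ frontier Ω, x' ∈ Metric.ball x₀ (ρ / 2) →
        ∀ η : E n, ‖η‖ = 1 → inner ℝ (gradient r x') η = 0 → ∀ e : E n, ‖e‖ = 1 →
          |H x' e η| ≤ C := by
  have hρ := h.ρ_pos
  have hε := h.ε_pos
  have hc := h.c_pos
  have hB0 : 0 ≤ B := (norm_nonneg _).trans (h.hess_le x₀ (Metric.mem_closedBall_self hρ.le))
  set w₀ := B / c with hw₀
  have hw₀0 : 0 ≤ w₀ := by positivity
  set τ₀ := 1 + w₀ * (2 * ρ) with hτ₀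
  have hτ₀0 : 0 < τ₀ := by positivity
  -- The four lower bounds serve, in order, the spherical part, the quadratic bound on `∂Ω`, the
  -- exclusion of small Hessians at critical points, and the linearized operator.
  obtain ⟨A, hA0, hA1, hA2, hA3, hA4⟩ := ((eventually_gt_atTop (0 : ℝ)).and
    ((eventually_le_mul (show 0 < ε * (ρ / 2) ^ 2 by positivity) ((C₁ + M) * τ₀)).and
      ((eventually_le_mul hε ((C₁ + M) / (2 * c) * (B + 2 * (B * w₀)))).and
        ((eventually_le_mul hc ((1 + M) * τ₀ + (C₁ + M) * w₀)).and
          (eventually_le_mul hε (M * τ₀ + (M * τ₀ + 2 * (M * w₀)))))))).exists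
  refine ⟨A * B + (C₁ + M) * w₀ + M, fun f u Φ hd p H hp hpC x' hx' hx'b η hη hηr e he => ?_⟩
  have hM : 0 < M := lt_of_lt_of_le one_pos hd.one_le
  obtain ⟨pΦ, HΦ, hpΦ⟩ := hd.memC_Φ.exists_isC2Ext (by norm_num)
  have hpΦle : ∀ x ∈ closure Ω, ‖pΦ x‖ ≤ M := norm_le_on_closure hpΦ.cont_p fun x hx => by
    rw [hpΦ.eq_p x hx]; exact hd.fderiv_Φ_le x hx
  have hHΦle : ∀ x ∈ closure Ω, ‖HΦ x‖ ≤ M := norm_le_on_closure hpΦ.cont_H fun x hx => by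
    rw [hpΦ.eq_H x hx]; exact hd.hessForm_Φ_le x hx
  have hu3 : ∀ x ∈ Ω, ContDiffAt ℝ 3 u x := fun x hx => hd.memC_u.contDiffAt hΩ hx
  have hΦ3 : ∀ x ∈ Ω, ContDiffAt ℝ 3 Φ x := fun x hx => hd.memC_Φ.contDiffAt hΩ hx
  have hu2 : ∀ x ∈ Ω, ContDiffAt ℝ 2 u x := fun x hx => (hu3 x hx).of_le (by norm_cast)
  have hΦ2 : ∀ x ∈ Ω, ContDiffAt ℝ 2 Φ x := fun x hx => (hΦ3 x hx).of_le (by norm_cast)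
  have hx'cb : x' ∈ Metric.closedBall x₀ ρ :=
    Metric.ball_subset_closedBall (Metric.ball_subset_ball (by linarith) hx'b)
  have hx'c : x' ∈ closure Ω := frontier_subset_closure hx'
  have hdef := h.defn.mono (h.sub hx'cb)
  obtain ⟨W, hWs, hWn, hWr⟩ := h.exists_rotation hx' hx'cb hη hηr
  obtain ⟨a, ha⟩ : ∃ a, a = η - W x' := ⟨_, rfl⟩
  have hτ : ∀ y, a + W y = η + W (y - x') := fun y => by rw [ha, map_sub]; abel
  have hτx : a + W x' = η := by rw [ha]; abel
  have hτn : ∀ y ∈ Metric.closedBall x₀ ρ, ‖a + W y‖ ≤ τ₀ := by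
    intro y hy
    rw [hτ]
    refine (norm_add_le _ _).trans (add_le_add hη.le ((hWn _).trans ?_))
    refine mul_le_mul_of_nonneg_left ?_ hw₀0
    rw [← dist_eq_norm]
    have := dist_triangle_right y x' x₀
    rw [Metric.mem_closedBall] at hy hx'cb
    linarith
  have hWop : ‖W‖ ≤ w₀ := W.opNorm_le_bound hw₀0 hWn
  have hdiff : ∀ x ∈ closure Ω, ‖p x - pΦ x‖ ≤ C₁ + M := fun x hx =>
    (norm_sub_le _ _).trans (add_le_add (hpC x hx) (hpΦle x hx))
  set v : E n → ℝ := fun y => 1 * p y (a + W y) + (-1) * pΦ y (a + W y) with hv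
  have hv_eq : ∀ y, v y = (p y - pΦ y) (a + W y) := fun y => by
    simp only [hv, _root_.sub_apply]; ring
  have hτc : ContinuousOn (fun y => a + W y) (closure Ω) := by fun_prop
  have hvc : ContinuousOn v (closure Ω) :=
    (continuousOn_const.mul (hp.cont_p.clm_apply hτc)).add
      (continuousOn_const.mul (hpΦ.cont_p.clm_apply hτc))
  have evu : ∀ y ∈ Ω, (fun y => p y (a + W y)) =ᶠ[𝓝 y] alongField u a W := fun y hy => by
    filter_upwards [hΩ.mem_nhds hy] with z hz
    rw [hp.eq_p z hz, alongField]
  have evΦ : ∀ y ∈ Ω, (fun y => pΦ y (a + W y)) =ᶠ[𝓝 y] alongField Φ a W := fun y hy => by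
    filter_upwards [hΩ.mem_nhds hy] with z hz
    rw [hpΦ.eq_p z hz, alongField]
  have cu : ∀ y ∈ Ω, ContDiffAt ℝ 2 (fun y => p y (a + W y)) y := fun y hy =>
    (contDiffAt_alongField (m := 2) (hu3 y hy) a W).congr_of_eventuallyEq (evu y hy)
  have cΦ : ∀ y ∈ Ω, ContDiffAt ℝ 2 (fun y => pΦ y (a + W y)) y := fun y hy =>
    (contDiffAt_alongField (m := 2) (hΦ3 y hy) a W).congr_of_eventuallyEq (evΦ y hy)
  set V : E n → E n →L[ℝ] ℝ := fun y =>
    (ContinuousLinearMap.flip (H y - HΦ y)) (a + W y) + (p y - pΦ y).comp W with hVdef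
  have hVd : ∀ y ∈ Ω, HasFDerivAt v (V y) y := by
    intro y hy
    have h1 := (hasFDerivAt_alongField (hu2 y hy) a W).congr_of_eventuallyEq (evu y hy)
    have h2 := (hasFDerivAt_alongField (hΦ2 y hy) a W).congr_of_eventuallyEq (evΦ y hy)
    refine ((h1.const_mul 1).add (h2.const_mul (-1))).congr_fderiv ?_
    rw [hVdef]
    simp only [hp.eq_p y hy, hpΦ.eq_p y hy, hp.eq_H y hy, hpΦ.eq_H y hy]
    ext z
    simp
    ring
  have hVc : ContinuousOn V (closure Ω) :=
    (((ContinuousLinearMap.flipₗᵢ ℝ (E n) (E n) ℝ).continuous.comp_continuousOn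
      (hp.cont_H.sub hpΦ.cont_H)).clm_apply hτc).add
        ((hp.cont_p.sub hpΦ.cont_p).clm_comp continuousOn_const)
  have hV := hdef.hasFDerivWithinAt_closure hx' hvc hVd (hVc x' hx'c)
  have hfin := h.compare hkn hΩ hb hx' hx'b hA0 hvc
    (fun y hy => (contDiffAt_const.mul (cu y hy)).add (contDiffAt_const.mul (cΦ y hy)))
    (fun y hy hyb => ?_) (fun y hy hyb => ?_) (fun y hy hyb hgr => ?_) hV
  · have h1 : V x' e = (H x' e η - HΦ x' e η) + (p x' - pΦ x') (W e) := by
      simp only [hVdef, hτx]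
      simp
    have h2 : |V x' e| ≤ A * B := by
      have := (V x').le_opNorm e
      rw [he, mul_one] at this
      exact this.trans hfin
    have h3 : |(p x' - pΦ x') (W e)| ≤ (C₁ + M) * w₀ := by
      refine ((p x' - pΦ x').le_opNorm (W e)).trans ?_
      have h4 := hWn e
      rw [he, mul_one] at h4
      exact mul_le_mul (hdiff x' hx'c) h4 (norm_nonneg _) (by positivity)
    have h5 : |HΦ x' e η| ≤ M := by
      have := (HΦ x').le_opNorm₂ e η
      rw [he, hη, mul_one, mul_one] at this
      exact this.trans (hHΦle x' hx'c)
    rw [abs_le] at h2 h3 h5 ⊢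
    constructor <;> linarith [h2.1, h2.2, h3.1, h3.2, h5.1, h5.2]
  · rw [hv_eq, mul_assoc]
    refine ((p y - pΦ y).le_opNorm _).trans (le_trans ?_ hA1.le)
    exact mul_le_mul (hdiff y hy) (hτn y hyb) (norm_nonneg _) (by positivity)
  · have hyc : y ∈ closure Ω := frontier_subset_closure hy
    have hdefy := h.defn.mono (h.sub hyb)
    have hGy : 2 * c ≤ ‖gradient r y‖ := by
      have := h.grad_ge y hyb
      have h2 : 0 < 4 * ε * ρ := by positivity
      linarith
    have hGy0 : 0 < ‖gradient r y‖ := by linarith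
    have hwy := hdefy.hasFDerivWithinAt_closure hy (v := fun y => 1 * u y + (-1) * Φ y)
      (V := fun y => p y - pΦ y)
      ((continuousOn_const.mul hp.cont).add (continuousOn_const.mul hpΦ.cont)) (fun z hz => by
        rw [hp.eq_p z hz, hpΦ.eq_p z hz]
        refine ((((hu2 z hz).differentiableAt (by simp)).hasFDerivAt.const_mul 1).add
          (((hΦ2 z hz).differentiableAt (by simp)).hasFDerivAt.const_mul (-1))).congr_fderiv ?_
        ext; simp; ring) ((hp.cont_p.sub hpΦ.cont_p) y hyc)
    -- Since `u = Φ` on `∂Ω`, only the normal component of the field contributes to `v` there, and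
    -- it is `O(|y - x'|²)`.
    have htan : ∀ t, inner ℝ (gradient r y) t = 0 → (p y - pΦ y) t = 0 := fun t ht => by
      refine hdefy.fderivWithin_apply_eq_zero hy hwy (C := 0) ?_ ht
      filter_upwards [self_mem_nhdsWithin] with z hz
      rw [hd.boundary z hz]
      simp
    set t := a + W y with htdef
    have h1 := htan (t - (inner ℝ (gradient r y) t / ‖gradient r y‖ ^ 2) • gradient r y) (by
      rw [inner_sub_right, inner_smul_right, real_inner_self_eq_norm_sq]; field_simp; ring)
    rw [map_sub, map_smul, sub_eq_zero, smul_eq_mul] at h1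
    have h2 := hWr y hy hyb
    rw [← hτ, ← htdef, fderiv_apply_eq_inner_gradient] at h2
    have h3 : |(p y - pΦ y) (gradient r y)| ≤ (C₁ + M) * ‖gradient r y‖ :=
      ((p y - pΦ y).le_opNorm _).trans (mul_le_mul_of_nonneg_right (hdiff y hyc) (norm_nonneg _))
    rw [hv_eq, ← htdef, h1, abs_mul, abs_div, abs_of_pos (by positivity : 0 < ‖gradient r y‖ ^ 2)]
    calc |inner ℝ (gradient r y) t| / ‖gradient r y‖ ^ 2 * |(p y - pΦ y) (gradient r y)|
        ≤ |inner ℝ (gradient r y) t| / ‖gradient r y‖ ^ 2 * ((C₁ + M) * ‖gradient r y‖) :=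
          mul_le_mul_of_nonneg_left h3 (by positivity)
      _ = |inner ℝ (gradient r y) t| * ((C₁ + M) / ‖gradient r y‖) := by field_simp
      _ ≤ ((B + 2 * (B * w₀)) * ‖y - x'‖ ^ 2) * ((C₁ + M) / (2 * c)) :=
          mul_le_mul h2 (div_le_div_of_nonneg_left (by positivity) (by positivity) hGy)
            (by positivity) (by positivity)
      _ = ((C₁ + M) / (2 * c) * (B + 2 * (B * w₀))) * ‖y - x'‖ ^ 2 := by ring
      _ ≤ A * ε * ‖y - x'‖ ^ 2 := mul_le_mul_of_nonneg_right hA2.le (by positivity)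
  · have hyc := subset_closure hy
    have hycb := Metric.ball_subset_closedBall hyb
    -- If the Hessian were smaller than `1`, the gradient of `v` would be too small to balance `A`
    -- times the barrier gradient.
    have hH1 : 1 ≤ ‖hessForm u y‖ := by
      by_contra! hlt
      have h1 : ‖V y‖ ≤ (1 + M) * τ₀ + (C₁ + M) * w₀ := by
        refine (norm_add_le _ _).trans (add_le_add ?_ ?_)
        · refine (ContinuousLinearMap.le_opNorm _ _).trans ?_
          rw [ContinuousLinearMap.opNorm_flip]
          refine mul_le_mul ?_ (hτn y hycb) (norm_nonneg _) (by positivity)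
          rw [hp.eq_H y hy]
          exact (norm_sub_le _ _).trans (add_le_add hlt.le (hHΦle y hyc))
        · exact (ContinuousLinearMap.opNorm_comp_le _ _).trans
            (mul_le_mul (hdiff y hyc) hWop (norm_nonneg _) (by positivity))
      rw [(hVd y hy).fderiv] at hgr
      linarith
    obtain ⟨q, g, hlin, -, -, h2⟩ := hd.exists_linearization hk hkn hΩ hy
    refine ⟨_, q, g, hlin, ?_⟩
    have hT := hlin.trace_pos (by omega)
    have h3 := h2 a W hWs hH1
    have h4 : |∑ i, g i * hessForm (alongField Φ a W) y (q i) (q i)| ≤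
        (M * τ₀ + 2 * (M * w₀)) * ∑ i, g i := by
      rw [Finset.mul_sum]
      refine (Finset.abs_sum_le_sum_abs _ _).trans (Finset.sum_le_sum fun i _ => ?_)
      rw [abs_mul, abs_of_pos (hlin.pos i), mul_comm]
      refine mul_le_mul_of_nonneg_right ?_ (hlin.pos i).le
      rw [hessForm_alongField (hΦ3 y hy)]
      have hqi := q.orthonormal.1 i
      have h5 : |fderiv ℝ (hessForm Φ) y (a + W y) (q i) (q i)| ≤ M * τ₀ := by
        have := (fderiv ℝ (hessForm Φ) y (a + W y)).le_opNorm₂ (q i) (q i)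
        rw [hqi, mul_one, mul_one] at this
        refine this.trans (((fderiv ℝ (hessForm Φ) y).le_opNorm _).trans ?_)
        exact mul_le_mul (hd.third_Φ_le y hy) (hτn y hycb) (norm_nonneg _) hM.le
      have h6 : |hessForm Φ y (q i) (W (q i))| ≤ M * w₀ := by
        have h7 := (hessForm Φ y).le_opNorm₂ (q i) (W (q i))
        rw [hqi, mul_one] at h7
        have h8 := hWn (q i)
        rw [hqi, mul_one] at h8
        exact h7.trans (mul_le_mul (hd.hessForm_Φ_le y hy) h8 (norm_nonneg _) hM.le)
      refine (abs_add_le _ _).trans (add_le_add h5 ?_)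
      rw [abs_mul, abs_two]
      exact mul_le_mul_of_nonneg_left h6 zero_le_two
    rw [hessForm_lincomb (cu y hy) (cΦ y hy), hessForm_congr (evu y hy), hessForm_congr (evΦ y hy)]
    have e1 : ∑ i, g i * ((1 : ℝ) • hessForm (alongField u a W) y +
        (-1 : ℝ) • hessForm (alongField Φ a W) y) (q i) (q i) =
        ∑ i, g i * hessForm (alongField u a W) y (q i) (q i) -
          ∑ i, g i * hessForm (alongField Φ a W) y (q i) (q i) := by
      rw [← Finset.sum_sub_distrib]
      refine Finset.sum_congr rfl fun i _ => ?_
      simp only [_root_.add_apply, _root_.smul_apply, smul_eq_mul]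
      ring
    rw [e1]
    have h5 := mul_lt_mul_of_pos_right hA4 hT
    have h6 : M * ‖a + W y‖ * ∑ i, g i ≤ M * τ₀ * ∑ i, g i :=
      mul_le_mul_of_nonneg_right (mul_le_mul_of_nonneg_left (hτn y hycb) hM.le) hT.le
    rw [abs_le] at h3 h4
    rw [abs_lt]
    constructor <;> linarith [h3.1, h3.2, h4.1, h4.2]

end BoundaryEstimates

end KHess

end

noncomputable section

set_option maxSynthPendingDepth 3

namespace KHess

open Set Filter Topology
open scoped ENNReal NNReal

/-! ### From the given norms to pointwise bounds. -/

section Norms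

variable {n : ℕ} {Ω : Set (E n)} {u : E n → ℝ}

lemma norm_iteratedFDeriv_le_of_normC_le {m : ℕ} {M : ℝ≥0} (h : normC m Ω u ≤ M) {j : ℕ}
    (hj : j ≤ m) {x : E n} (hx : x ∈ Ω) : ‖iteratedFDeriv ℝ j u x‖ ≤ M := by
  have h1 : (⨆ x ∈ Ω, ‖iteratedFDeriv ℝ j u x‖ₑ) ≤ M :=
    (Finset.single_le_sum (f := fun j => ⨆ x ∈ Ω, ‖iteratedFDeriv ℝ j u x‖ₑ)
      (fun _ _ => zero_le) (Finset.mem_range.2 (by omega))).trans h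
  have h2 : ‖iteratedFDeriv ℝ j u x‖ₑ ≤ M :=
    (le_iSup₂ (f := fun x (_ : x ∈ Ω) => ‖iteratedFDeriv ℝ j u x‖ₑ) x hx).trans h1
  exact_mod_cast enorm_le_coe.1 h2

lemma norm_fderiv_sub_le_of_lipSeminorm_le {M : ℝ≥0} (h : lipSeminorm 1 Ω u ≤ M) {x y : E n}
    (hx : x ∈ Ω) (hy : y ∈ Ω) : ‖fderiv ℝ u x - fderiv ℝ u y‖ ≤ M * ‖x - y‖ := by
  rcases eq_or_ne x y with rfl | hxy
  · simp
  have h1 : ‖iteratedFDeriv ℝ 1 u x - iteratedFDeriv ℝ 1 u y‖ₑ / edist x y ≤ M :=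
    le_trans (le_iSup₂ (f := fun y (_ : y ∈ Ω) =>
      ‖iteratedFDeriv ℝ 1 u x - iteratedFDeriv ℝ 1 u y‖ₑ / edist x y) y hy)
      ((le_iSup₂ (f := fun x (_ : x ∈ Ω) => ⨆ y ∈ Ω,
        ‖iteratedFDeriv ℝ 1 u x - iteratedFDeriv ℝ 1 u y‖ₑ / edist x y) x hx).trans h)
  rw [ENNReal.div_le_iff (by simpa using hxy) (edist_ne_top x y)] at h1
  have h2 := ENNReal.toReal_mono (ENNReal.mul_ne_top ENNReal.coe_ne_top (edist_ne_top x y)) h1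
  rw [toReal_enorm, ENNReal.toReal_mul, ← dist_edist, ENNReal.coe_toReal, dist_eq_norm] at h2
  refine le_trans (le_of_eq ?_) h2
  have e : fderiv ℝ u x - fderiv ℝ u y = continuousMultilinearCurryFin1 ℝ (E n) ℝ
      (iteratedFDeriv ℝ 1 u x - iteratedFDeriv ℝ 1 u y) := by
    ext v
    simp
  rw [e, LinearIsometryEquiv.norm_map]

/-- A connected set that meets an open set and avoids its frontier is contained in it. -/
lemma ball_subset_of_le_setDist {Ω₀ : Set (E n)} (hΩ₀ : IsOpen Ω₀) {d : ℝ}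
    (h : ENNReal.ofReal d ≤ setDist Ω (frontier Ω₀)) {x : E n} (hx : x ∈ Ω) (hx₀ : x ∈ Ω₀)
    (hd : 0 < d) : Metric.ball x d ⊆ Ω₀ := by
  refine (convex_ball x d).isPreconnected.subset_of_closure_inter_subset hΩ₀
    ⟨x, Metric.mem_ball_self hd, hx₀⟩ fun y ⟨hyc, hy⟩ => ?_
  by_contra hyn
  have hy₀ : y ∈ frontier Ω₀ := by rw [hΩ₀.frontier_eq]; exact ⟨hyc, hyn⟩
  have h1 : ENNReal.ofReal d ≤ edist x y := h.trans (iInf₂_le_of_le x hx (iInf₂_le y hy₀))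
  rw [edist_dist] at h1
  have h2 := (ENNReal.ofReal_le_ofReal_iff dist_nonneg).1 h1
  rw [Metric.mem_ball, dist_comm] at hy
  linarith

/-- The gradient of a nonnegative `C^{1,1}` function is bounded by its square root. -/
lemma norm_fderiv_le_mul_sqrt {g : E n → ℝ} {x : E n} {d L : ℝ} (hd : 0 < d) (hL : 1 ≤ L)
    (hg : ∀ y ∈ Metric.ball x d, DifferentiableAt ℝ g y) (hpos : ∀ y ∈ Metric.ball x d, 0 ≤ g y)
    (hlip : ∀ y ∈ Metric.ball x d, ‖fderiv ℝ g y - fderiv ℝ g x‖ ≤ L * ‖y - x‖)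
    (hgx : 0 < g x) (hgL : g x ≤ L) :
    ‖fderiv ℝ g x‖ ≤ ((d / (2 * √L))⁻¹ + L * (d / (2 * √L))) * √(g x) := by
  have hL0 : 0 < √L := Real.sqrt_pos.2 (by linarith)
  set s := d / (2 * √L) with hs
  have hs0 : 0 < s := by positivity
  have hq : 0 < √(g x) := Real.sqrt_pos.2 hgx
  -- A step of length `t` against the gradient keeps `g` nonnegative, so `t |Dg| ≤ g + L t²`. A step
  -- proportional to `√g` balances the two terms, and `g ≤ L` keeps it below `d / 2`.
  set t := s * √(g x) with ht
  have ht0 : 0 < t := by positivity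
  have htd : t < d := by
    have h1 : √(g x) ≤ √L := Real.sqrt_le_sqrt hgL
    have h2 : t ≤ s * √L := mul_le_mul_of_nonneg_left h1 hs0.le
    have h3 : s * √L = d / 2 := by rw [hs]; field_simp
    linarith
  have key : ∀ e : E n, ‖e‖ = 1 → t * fderiv ℝ g x e ≤ g x + L * t ^ 2 := by
    intro e he
    have hsub : Metric.closedBall x t ⊆ Metric.ball x d := Metric.closedBall_subset_ball htd
    have hxt : ‖x - t • e - x‖ = t := by
      rw [sub_sub_cancel_left, norm_neg, norm_smul, he, mul_one, Real.norm_of_nonneg ht0.le]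
    have hmem : x - t • e ∈ Metric.closedBall x t := by
      rw [mem_closedBall_iff_norm, hxt]
    have h1 := (convex_closedBall x t).norm_image_sub_le_of_norm_hasFDerivWithin_le' (f := g)
      (f' := fderiv ℝ g) (φ := fderiv ℝ g x) (C := L * t)
      (fun y hy => (hg y (hsub hy)).hasFDerivAt.hasFDerivWithinAt)
      (fun y hy => (hlip y (hsub hy)).trans (mul_le_mul_of_nonneg_left
        (mem_closedBall_iff_norm.1 hy) (by linarith)))
      (Metric.mem_closedBall_self ht0.le) hmem
    rw [hxt, sub_sub_cancel_left, map_neg, map_smul, smul_eq_mul, Real.norm_eq_abs] at h1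
    have h2 := hpos _ (hsub hmem)
    have h3 := (abs_le.1 h1).2
    nlinarith
  have h1 : ‖fderiv ℝ g x‖ ≤ (g x + L * t ^ 2) / t := by
    have hR : 0 ≤ (g x + L * t ^ 2) / t := by positivity
    refine ContinuousLinearMap.opNorm_le_of_unit_norm hR fun e he => ?_
    rw [le_div_iff₀ ht0, Real.norm_eq_abs, mul_comm]
    have h2 := key e he
    have h3 := key (-e) (by rwa [norm_neg])
    rw [map_neg] at h3
    rcases abs_choice (fderiv ℝ g x e) with h | h <;> rw [h] <;> linarith
  refine h1.trans (le_of_eq ?_)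
  have h4 : √(g x) ^ 2 = g x := Real.sq_sqrt hgx.le
  rw [ht, ← h4, Real.sqrt_sq hq.le]
  field_simp

/-- The bounds for `f` that follow from those for `f^{3/(2k-2)}`. -/
lemma exists_rhs_bound {k : ℕ} (hk : 2 ≤ k) {d : ℝ} (hd : 0 < d) {L : ℝ} (hL : 1 ≤ L) :
    ∃ M, ∀ (f : E n → ℝ) (x : E n), (∀ y ∈ Metric.ball x d, 0 < f y) →
      (∀ y ∈ Metric.ball x d, DifferentiableAt ℝ (fun x => f x ^ (3 / (2 * (k : ℝ) - 2))) y) →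
      (∀ y ∈ Metric.ball x d, ‖fderiv ℝ (fun x => f x ^ (3 / (2 * (k : ℝ) - 2))) y -
        fderiv ℝ (fun x => f x ^ (3 / (2 * (k : ℝ) - 2))) x‖ ≤ L * ‖y - x‖) →
      f x ^ (3 / (2 * (k : ℝ) - 2)) ≤ L →
      f x ≤ M ∧ ‖fderiv ℝ f x‖ ^ (k - 1) ≤ M * f x ^ (k - 2) := by
  have hk1 : (0 : ℝ) < k - 1 := by
    have : (2 : ℝ) ≤ k := by exact_mod_cast hk
    linarith
  set a : ℝ := (2 * (k : ℝ) - 2) / 3 with ha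
  have ha0 : 0 < a := by rw [ha]; linarith
  have hae : 3 / (2 * (k : ℝ) - 2) = a⁻¹ := by rw [ha, inv_div]
  rw [hae]
  set C := (d / (2 * √L))⁻¹ + L * (d / (2 * √L)) with hC
  have hL0 : 0 < √L := Real.sqrt_pos.2 (by linarith)
  have hC0 : 0 < C := by positivity
  refine ⟨max (L ^ a) ((a * C) ^ (k - 1) * L ^ (((k : ℝ) - 1) / 6)),
    fun f x hf hg hlip hgL => ?_⟩
  set g : E n → ℝ := fun x => f x ^ a⁻¹ with hgdef
  have hgpos : ∀ y ∈ Metric.ball x d, 0 < g y := fun y hy => Real.rpow_pos_of_pos (hf y hy) _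
  have hfg : ∀ y ∈ Metric.ball x d, f y = g y ^ a := fun y hy => by
    rw [hgdef, ← Real.rpow_mul (hf y hy).le, inv_mul_cancel₀ ha0.ne', Real.rpow_one]
  have hxb := Metric.mem_ball_self (x := x) hd
  have hgx := hgpos x hxb
  have hD := norm_fderiv_le_mul_sqrt hd hL hg (fun y hy => (hgpos y hy).le) hlip hgx hgL
  rw [← hC] at hD
  have hfd : fderiv ℝ f x = (a * g x ^ (a - 1)) • fderiv ℝ g x := by
    have h1 := ((hg x hxb).hasFDerivAt).rpow_const (p := a) (Or.inl hgx.ne')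
    refine (h1.congr_of_eventuallyEq ?_).fderiv
    filter_upwards [Metric.isOpen_ball.mem_nhds hxb] with y hy using hfg y hy
  constructor
  · refine le_max_of_le_left ?_
    rw [hfg x hxb]
    exact Real.rpow_le_rpow hgx.le hgL ha0.le
  · have h2 : ‖fderiv ℝ f x‖ ≤ a * C * g x ^ (a - 1 / 2) := by
      rw [hfd, norm_smul, Real.norm_of_nonneg (by positivity)]
      calc a * g x ^ (a - 1) * ‖fderiv ℝ g x‖ ≤ a * g x ^ (a - 1) * (C * √(g x)) :=
            mul_le_mul_of_nonneg_left hD (by positivity)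
        _ = a * C * (g x ^ (a - 1) * g x ^ (1 / 2 : ℝ)) := by rw [Real.sqrt_eq_rpow]; ring
        _ = _ := by rw [← Real.rpow_add hgx]; ring_nf
    -- The exponents match because `(a - 1/2)(k - 1) = (k - 1)/6 + a (k - 2)` for `a = (2k - 2)/3`.
    -- The spare power of `g` is nonnegative and is absorbed by the upper bound for `g`.
    have h3 : (g x ^ (a - 1 / 2)) ^ (k - 1) = g x ^ (((k : ℝ) - 1) / 6) * f x ^ (k - 2) := by
      rw [hfg x hxb, ← Real.rpow_natCast, ← Real.rpow_natCast, ← Real.rpow_mul hgx.le,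
        ← Real.rpow_mul hgx.le, ← Real.rpow_add hgx, Nat.cast_sub (by omega), Nat.cast_sub hk, ha]
      congr 1
      push_cast
      ring
    have hfx := hf x hxb
    calc ‖fderiv ℝ f x‖ ^ (k - 1) ≤ (a * C * g x ^ (a - 1 / 2)) ^ (k - 1) :=
          pow_le_pow_left₀ (norm_nonneg _) h2 _
      _ = (a * C) ^ (k - 1) * g x ^ (((k : ℝ) - 1) / 6) * f x ^ (k - 2) := by
          rw [mul_pow, h3, mul_assoc]
      _ ≤ (a * C) ^ (k - 1) * L ^ (((k : ℝ) - 1) / 6) * f x ^ (k - 2) := by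
          have := Real.rpow_le_rpow hgx.le hgL (by positivity : 0 ≤ ((k : ℝ) - 1) / 6)
          gcongr
      _ ≤ _ := mul_le_mul_of_nonneg_right (le_max_right _ _) (by positivity)

/-- The infimum over extensions need not be attained, hence the extra `1`. -/
lemma exists_extension {φ : E n → ℝ} {m : ℕ} {M : ℝ≥0} (h : normCBdry m Ω φ ≤ M) :
    ∃ Φ, MemC m Ω Φ ∧ EqOn Φ φ (frontier Ω) ∧ normC m Ω Φ ≤ (M + 1 : ℝ≥0) := by
  have h1 : normCBdry m Ω φ < (M + 1 : ℝ≥0) :=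
    h.trans_lt (by exact_mod_cast lt_add_one M)
  obtain ⟨Φ, h2⟩ := iInf_lt_iff.1 h1
  obtain ⟨h3, h4⟩ := iInf_lt_iff.1 h2
  exact ⟨Φ, h3.1, h3.2, h4.le⟩

end Norms

/-! ### Passage to uniform constants on the whole boundary. -/

section Main

variable {n k : ℕ} {Ω : Set (E n)}

/-- The constant is fixed before `Ω₀`, `φ`, `f` and `u`. The lower bound `c` of `f` enters only as
positivity, so the constant does not see it. -/
theorem exists_isDatum (hk : 2 ≤ k) {d : ℝ} (hd : 0 < d) (Mφ Mg : ℝ≥0) :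
    ∃ M, ∀ Ω₀ : Set (E n), IsOpen Ω₀ → closure Ω ⊆ Ω₀ →
      ENNReal.ofReal d ≤ setDist Ω (frontier Ω₀) →
      ∀ φ : E n → ℝ, normCBdry 3 Ω φ ≤ Mφ →
      ∀ f : E n → ℝ, (∃ c : ℝ, 0 < c ∧ ∀ x ∈ Ω₀, c ≤ f x) →
        MemCLip 1 Ω₀ (fun x => f x ^ (3 / (2 * (k : ℝ) - 2))) →
        normCLip 1 Ω₀ (fun x => f x ^ (3 / (2 * (k : ℝ) - 2))) ≤ Mg →
      ∀ u : E n → ℝ, MemC 3 Ω u → IsAdmissible k Ω u → SolvesDirichlet k Ω f φ u →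
        ∃ Φ, IsDatum k Ω M f u Φ := by
  obtain ⟨M₁, hM₁⟩ := exists_rhs_bound (n := n) hk hd (L := Mg + 1) (by simp)
  refine ⟨max M₁ (Mφ + 1), fun Ω₀ hΩ₀ hsub hdist φ hφ f ⟨c, hc, hcf⟩ hg hgn u hu hadm hsol => ?_⟩
  obtain ⟨Φ, hΦ, hΦφ, hΦn⟩ := exists_extension hφ
  have hΦle : ∀ {j}, j ≤ 3 → ∀ x ∈ Ω, ‖iteratedFDeriv ℝ j Φ x‖ ≤ max M₁ (Mφ + 1) :=
    fun hj x hx => le_max_of_le_right (by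
      exact_mod_cast norm_iteratedFDeriv_le_of_normC_le hΦn hj hx)
  have hfb : ∀ x ∈ Ω, f x ≤ M₁ ∧ ‖fderiv ℝ f x‖ ^ (k - 1) ≤ M₁ * f x ^ (k - 2) := by
    intro x hx
    have hball := ball_subset_of_le_setDist hΩ₀ hdist hx (hsub (subset_closure hx)) hd
    have hn1 : normC 1 Ω₀ (fun x => f x ^ (3 / (2 * (k : ℝ) - 2))) ≤ Mg :=
      le_self_add.trans hgn
    have hn2 : lipSeminorm 1 Ω₀ (fun x => f x ^ (3 / (2 * (k : ℝ) - 2))) ≤ Mg :=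
      le_add_self.trans hgn
    have hx₀ := hsub (subset_closure hx)
    refine hM₁ f x (fun y hy => hc.trans_le (hcf y (hball hy))) (fun y hy => ?_)
      (fun y hy => ?_) ?_
    · exact (hg.1.1.contDiffAt (hΩ₀.mem_nhds (hball hy))).differentiableAt (by simp)
    · refine (norm_fderiv_sub_le_of_lipSeminorm_le hn2 (hball hy) hx₀).trans ?_
      exact mul_le_mul_of_nonneg_right (by simp) (norm_nonneg _)
    · have h1 := norm_iteratedFDeriv_le_of_normC_le hn1 (Nat.zero_le 1) hx₀
      rw [norm_iteratedFDeriv_zero] at h1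
      linarith [le_abs_self (f x ^ (3 / (2 * (k : ℝ) - 2))), Real.norm_eq_abs
        (f x ^ (3 / (2 * (k : ℝ) - 2)))]
  refine ⟨Φ, ⟨hu, hΦ, hadm.2.2, hsol.1, fun x hx => (hsol.2 x hx).trans (hΦφ hx).symm,
    le_max_of_le_right (by simp), fun x hx => ?_, fun x hx => ?_, fun x hx => ?_, fun x hx => ?_,
    fun x hx => hc.trans_le (hcf x (hsub (subset_closure hx))),
    fun x hx => (hfb x hx).1.trans (le_max_left _ _), fun x hx => (hfb x hx).2.trans ?_⟩⟩
  · have := hΦle (Nat.zero_le 3) x hx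
    rwa [norm_iteratedFDeriv_zero] at this
  · have := hΦle (show 1 ≤ 3 by norm_num) x hx
    rwa [← norm_iteratedFDeriv_fderiv, norm_iteratedFDeriv_zero] at this
  · have := hΦle (show 2 ≤ 3 by norm_num) x hx
    rwa [← norm_iteratedFDeriv_fderiv, ← norm_iteratedFDeriv_fderiv,
      norm_iteratedFDeriv_zero] at this
  · have := hΦle (show 3 ≤ 3 by norm_num) x hx
    rwa [← norm_iteratedFDeriv_fderiv, ← norm_iteratedFDeriv_fderiv, ← norm_iteratedFDeriv_fderiv,
      norm_iteratedFDeriv_zero] at this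
  · have hfx : 0 < f x := hc.trans_le (hcf x (hsub (subset_closure hx)))
    exact mul_le_mul_of_nonneg_right (le_max_left _ _) (by positivity)

/-- A family of quantities that is locally uniformly bounded on a compact set is bounded. -/
lemma exists_bound_of_isCompact {X : Type*} [TopologicalSpace X] {S : Set X} (hS : IsCompact S)
    (R : X → ℝ → Prop)
    (h : ∀ x ∈ S, ∃ V ∈ 𝓝 x, ∃ C, ∀ y ∈ S, y ∈ V → ∀ t, R y t → t ≤ C) :
    ∃ C, ∀ y ∈ S, ∀ t, R y t → t ≤ C := by
  have := hS.induction_on (p := fun s => ∃ C, ∀ y ∈ S, y ∈ s → ∀ t, R y t → t ≤ C)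
    ⟨0, fun y _ hy => hy.elim⟩ (fun s t hst ⟨C, hC⟩ => ⟨C, fun y hy hys => hC y hy (hst hys)⟩)
    (fun s t ⟨C, hC⟩ ⟨C', hC'⟩ => ⟨max C C', fun y hy hyst z hz => hyst.elim
      (fun hys => (hC y hy hys z hz).trans (le_max_left _ _))
      (fun hyt => (hC' y hy hyt z hz).trans (le_max_right _ _))⟩)
    (fun x hx => by
      obtain ⟨V, hV, C, hC⟩ := h x hx
      exact ⟨V, mem_nhdsWithin_of_mem_nhds hV, C, hC⟩)
  obtain ⟨C, hC⟩ := this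
  exact ⟨C, fun y hy => hC y hy hy⟩

/-- The constants depend on one another in one direction only: the sup bound feeds the local
boundary gradient bounds, compactness unites these, and the interior bound follows. -/
theorem exists_gradient_le_closure (hk : 2 ≤ k) (hkn : k ≤ n) (hΩ : IsOpen Ω)
    (hb : Bornology.IsBounded Ω) (hC : HasCLipBoundary 3 Ω)
    (hΩk : StrictlyConvexBdry (k - 1) Ω) (M : ℝ) :
    ∃ C, 0 ≤ C ∧ ∀ f u Φ, IsDatum k Ω M f u Φ → ∀ p H, IsC2Ext Ω u p H →
      ∀ x ∈ closure Ω, ‖p x‖ ≤ C := by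
  have hcpt : IsCompact (frontier Ω) :=
    hb.isCompact_closure.of_isClosed_subset isClosed_frontier frontier_subset_closure
  obtain ⟨C₀, hC₀⟩ := exists_abs_le hk hkn hΩ hb M
  obtain ⟨C₁, hC₁⟩ := exists_bound_of_isCompact hcpt
    (fun x t => ∃ f u Φ, IsDatum k Ω M f u Φ ∧ ∃ p H, IsC2Ext Ω u p H ∧ t = ‖p x‖)
    (fun x₀ hx₀ => by
      obtain ⟨U, r, ρ, K, ε, c, B, h⟩ := exists_localBarrier hkn hC hΩk hx₀
      obtain ⟨C, hCb⟩ := h.exists_gradient_le hk hkn hΩ hb M C₀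
      refine ⟨_, Metric.ball_mem_nhds x₀ (half_pos h.ρ_pos), C, fun y hy hyb t ht => ?_⟩
      obtain ⟨f, u, Φ, hd, p, H, hp, rfl⟩ := ht
      exact hCb f u Φ hd (hC₀ f u Φ hd) p H hp y hy hyb)
  obtain ⟨C₂, hC₂⟩ := exists_gradient_le hk hkn hΩ hb M C₁
  refine ⟨max C₂ 0, le_max_right _ _, fun f u Φ hd p H hp x hx => le_max_of_le_left ?_⟩
  exact hC₂ f u Φ hd p H hp (fun y hy => hC₁ y hy _ ⟨f, u, Φ, hd, p, H, hp, rfl⟩) x hx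

theorem exists_hess_le_frontier (hk : 2 ≤ k) (hkn : k ≤ n) (hΩ : IsOpen Ω)
    (hb : Bornology.IsBounded Ω) (hC : HasCLipBoundary 3 Ω)
    (hΩk : StrictlyConvexBdry (k - 1) Ω) (M : ℝ) :
    ∃ C, ∀ f u Φ, IsDatum k Ω M f u Φ → ∀ p H, IsC2Ext Ω u p H →
      ∀ x ∈ frontier Ω, ∀ ν, IsInteriorNormal Ω x ν → ∀ η : E n, ‖η‖ = 1 → inner ℝ η ν = 0 →
        ∀ e : E n, ‖e‖ = 1 → |H x e η| ≤ C := by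
  have hcpt : IsCompact (frontier Ω) :=
    hb.isCompact_closure.of_isClosed_subset isClosed_frontier frontier_subset_closure
  obtain ⟨C₁, hC₁0, hC₁⟩ := exists_gradient_le_closure hk hkn hΩ hb hC hΩk M
  obtain ⟨C₂, hC₂⟩ := exists_bound_of_isCompact hcpt
    (fun x t => ∃ f u Φ, IsDatum k Ω M f u Φ ∧ ∃ p H, IsC2Ext Ω u p H ∧
      ∃ ν, IsInteriorNormal Ω x ν ∧ ∃ η : E n, ‖η‖ = 1 ∧ inner ℝ η ν = 0 ∧
        ∃ e : E n, ‖e‖ = 1 ∧ t = |H x e η|)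
    (fun x₀ hx₀ => by
      obtain ⟨U, r, ρ, K, ε, c, B, h⟩ := exists_localBarrier hkn hC hΩk hx₀
      obtain ⟨C, hCb⟩ := h.exists_hess_le hk hkn hΩ hb M C₁ hC₁0
      have hρ := h.ρ_pos
      refine ⟨_, Metric.ball_mem_nhds x₀ (half_pos hρ), C, fun y hy hyb t ht => ?_⟩
      obtain ⟨f, u, Φ, hd, p, H, hp, ν, ⟨U', r', hr', rfl⟩, η, hη, hην, e, he, rfl⟩ := ht
      have hyU : y ∈ U := h.sub
        (Metric.ball_subset_closedBall (Metric.ball_subset_ball (by linarith) hyb))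
      -- Tangency is given for an arbitrary defining function; proportional gradients transfer it to
      -- the one that carries the barrier.
      obtain ⟨a, -, hG⟩ := hr'.exists_gradient_eq_smul (h.defn.mono hyU) hy
      have hG0 : ‖gradient r' y‖ ≠ 0 := norm_ne_zero_iff.2 (hr'.gradient_ne_zero y hr'.mem)
      rw [inner_smul_right, mul_eq_zero, or_iff_right (inv_ne_zero hG0)] at hην
      refine hCb f u Φ hd p H hp (hC₁ f u Φ hd p H hp) y hy hyb η hη ?_ e he
      rw [hG, inner_smul_left, real_inner_comm, hην, mul_zero])
  exact ⟨C₂, fun f u Φ hd p H hp x hx ν hν η hη hην e he =>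
    hC₂ x hx _ ⟨f, u, Φ, hd, p, H, hp, ν, hν, η, hη, hην, e, he, rfl⟩⟩

lemma normC_one_le {u : E n → ℝ} {a b : ℝ} (h₀ : ∀ x ∈ Ω, |u x| ≤ a)
    (h₁ : ∀ x ∈ Ω, ‖fderiv ℝ u x‖ ≤ b) :
    normC 1 Ω u ≤ ENNReal.ofReal a + ENNReal.ofReal b := by
  rw [normC, Finset.sum_range_succ, Finset.sum_range_one]
  refine add_le_add (iSup₂_le fun x hx => ?_) (iSup₂_le fun x hx => ?_)
  · rw [← ofReal_norm, norm_iteratedFDeriv_zero]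
    exact ENNReal.ofReal_le_ofReal (h₀ x hx)
  · rw [← ofReal_norm, ← norm_iteratedFDeriv_fderiv, norm_iteratedFDeriv_zero]
    exact ENNReal.ofReal_le_ofReal (h₁ x hx)

lemma MemC.mono {m m' : ℕ} (h : m ≤ m') {u : E n → ℝ} (hu : MemC m' Ω u) : MemC m Ω u :=
  ⟨hu.1.of_le (by exact_mod_cast h), hu.2.1, fun j hj => hu.2.2 j (hj.trans h)⟩

lemma IsInteriorNormal.norm_eq_one {x ν : E n} (h : IsInteriorNormal Ω x ν) : ‖ν‖ = 1 := by
  obtain ⟨U, r, hr, rfl⟩ := h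
  have hG0 : ‖gradient r x‖ ≠ 0 := norm_ne_zero_iff.2 (hr.gradient_ne_zero x hr.mem)
  rw [norm_smul, norm_inv, norm_norm, inv_mul_cancel₀ hG0]

theorem exists_normC_add_bdryTangentialSup_le (hk : 2 ≤ k) (hkn : k ≤ n) (hΩ : IsOpen Ω)
    (hb : Bornology.IsBounded Ω) (hC : HasCLipBoundary 3 Ω)
    (hΩk : StrictlyConvexBdry (k - 1) Ω) (M : ℝ) :
    ∃ C : ℝ≥0, ∀ f u Φ, IsDatum k Ω M f u Φ → normC 1 Ω u + bdryTangentialSup Ω u ≤ C := by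
  obtain ⟨C₀, hC₀⟩ := exists_abs_le hk hkn hΩ hb M
  obtain ⟨C₁, -, hC₁⟩ := exists_gradient_le_closure hk hkn hΩ hb hC hΩk M
  obtain ⟨C₂, hC₂⟩ := exists_hess_le_frontier hk hkn hΩ hb hC hΩk M
  refine ⟨C₀.toNNReal + C₁.toNNReal + (C₂ + C₂).toNNReal, fun f u Φ hd => ?_⟩
  obtain ⟨p, H, hp⟩ := hd.memC_u.exists_isC2Ext (by norm_num)
  push_cast
  refine add_le_add (normC_one_le (fun x hx => hC₀ f u Φ hd x (subset_closure hx))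
    fun x hx => ?_) ?_
  · rw [← hp.eq_p x hx]
    exact hC₁ f u Φ hd p H hp x (subset_closure hx)
  · refine iSup₂_le fun x hx => iSup₂_le fun ν hν => iSup₂_le fun η hη =>
      ENNReal.ofReal_le_ofReal ?_
    have hu2 : MemC 2 Ω u := hd.memC_u.mono (by norm_num)
    rw [hp.secondDeriv_eq hu2 (frontier_subset_closure hx),
      hp.secondDeriv_eq hu2 (frontier_subset_closure hx)]
    exact add_le_add (hC₂ f u Φ hd p H hp x hx ν hν η hη.1 hη.2 ν hν.norm_eq_one)
      (hC₂ f u Φ hd p H hp x hx ν hν η hη.1 hη.2 η hη.1)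

end Main

end KHess

end

theorem mainTheorem11 (n k : ℕ) (hk : 2 ≤ k) (hkn : k ≤ n)
    (Ω : Set (KHess.E n)) (hΩ : KHess.IsDomainSet Ω) (hΩb : Bornology.IsBounded Ω)
    (hΩC : KHess.HasCLipBoundary 3 Ω) (hΩk : KHess.StrictlyConvexBdry (k - 1) Ω)
    (d : ℝ) (hd : 0 < d) (Mφ Mg : NNReal) :
    ∃ C : NNReal,
      ∀ (Ω₀ : Set (KHess.E n)), KHess.IsDomainSet Ω₀ → closure Ω ⊆ Ω₀ →
        ENNReal.ofReal d ≤ KHess.setDist Ω (frontier Ω₀) →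
      ∀ φ : KHess.E n → ℝ, KHess.MemCLipBdry 3 Ω φ → KHess.normCBdry 3 Ω φ ≤ Mφ →
      ∀ f : KHess.E n → ℝ, (∃ c : ℝ, 0 < c ∧ ∀ x ∈ Ω₀, c ≤ f x) →
        KHess.MemCLip 1 Ω₀ (fun x => f x ^ (3 / (2 * (k : ℝ) - 2))) →
        KHess.normCLip 1 Ω₀ (fun x => f x ^ (3 / (2 * (k : ℝ) - 2))) ≤ Mg →
      ∀ u : KHess.E n → ℝ, KHess.MemCLip 3 Ω u → KHess.IsAdmissible k Ω u →
        KHess.SolvesDirichlet k Ω f φ u →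
        KHess.normC 1 Ω u + KHess.bdryTangentialSup Ω u ≤ C := by
  obtain ⟨M, hM⟩ := KHess.exists_isDatum (Ω := Ω) hk hd Mφ Mg
  obtain ⟨C, hC⟩ := KHess.exists_normC_add_bdryTangentialSup_le hk hkn hΩ.1 hΩb hΩC hΩk M
  refine ⟨C, fun Ω₀ hΩ₀ hsub hdist φ _ hφ f hf hg hgn u hu hadm hsol => ?_⟩
  obtain ⟨Φ, hd⟩ := hM Ω₀ hΩ₀.1 hsub hdist φ hφ f hf hg hgn u hu.1 hadm hsol
  exact hC f u Φ hd
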